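/- **Setting.** Let $d\ge 1$, $T\ge 2$, $\delta\in(0,1)$, let $\mathcal A\subset\mathbb R^d$ be a nonempty fixed action set with $\|a\|_2\le 1$ for $a\in\mathcal A$, and let $\theta_1,\dots,\theta_T\in\mathbb R^d$ with $\|\theta_t\|_2\le 1$ be fixed in advance and unknown to the learner, such that $f_t(a)=a^\top\theta_t\in[0,1]$ for all $a\in\mathcal A$, $t\in[T]$. In round $t$ the learner plays $a_t\in\mathcal A$ and receives a reward $R_t\in[0,1]$ whose conditional mean, given the past and $a_t$, is $f_t(a_t)$. Put $f_t^\star=\sup_{a\in\mathcal A}f_t(a)$ and $\textsc{D-Reg}=\sum_{t=1}^T(f_t^\star-R_t)$. For $\Delta(\cdot)\ge 0$ let $\Delta_{[1,t]}=\sum_{\tau=1}^{t-1}\Delta(\tau)$, $L=1+\sum_{\tau=1}^{T-1}\mathbb 1[\Delta(\tau)\ne 0]$, and let $\widehat\Delta=\sum_{t=1}^{T-1}\|\theta_t-\theta_{t+1}\|_2$. **OFUL.** From the pairs $(a_\tau,R_\tau)$ it has collected so far, OFUL forms $\Lambda=I+\sum_\tau a_\tau a_\tau^\top$, $\widehat\theta=\Lambda^{-1}\sum_\tau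 R_\tau a_\tau$ and, with $\beta=4\sqrt{d\log(T/\delta)}$, plays any maximizer over $\mathcal A$ of the index $a^\top\widehat\theta+2\beta\|a\|_{\Lambda^{-1}}$. Its auxiliary output $\widetilde f$ is the supremum of the index over $\mathcal A$, clipped to $[0,1]$. **MASTER.** Input: a base algorithm with auxiliary output, and a function $\rho$; put $\widehat n=\log_2T+1$ and $\widehat\rho(t)=6\widehat n\log(T/\delta)\rho(t)$. MASTER works in consecutive blocks of orders $n=0,1,2,\dots$; a block of order $n$ starting at $t_n$ is planned for $[t_n,t_n+2^n-1]$. In it, for every $m\le n$ and every sub-interval $[s,s+2^m-1]$ with $2^m\mid s-t_n$, an order-$m$ instance of the base algorithm is scheduled with probability $\rho(2^n)/\rho(2^m)$, by independent coins. In every round the scheduled instance of least order that covers the round is active: it chooses the action, its auxiliary output is $\widetilde g_t$, and only it is updated. Let $U_t=\min_{\tau\in[t_n,t]}\widetilde g_\tau$. After round $t$, MASTER restarts with a block of order $0$ if (Test 1) $t$ is the last round of some scheduled order-$m$ instance, started at $s$, with $2^{-m}\sum_{\tau=s}^tR_\tau\ge U_t+9\widehat\rho(2^m)$, or (Test 2)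 $\frac1{t-t_n+1}\sum_{\tau=t_n}^t(\widetilde g_\tau-R_\tau)\ge 3\widehat\rho(t-t_n+1)$. **Theorem.** There are universal constants $c_\rho,c_\Delta,K>0$ and $k\in\mathbb N$ such that in every such setting, with $$\rho(t)=c_\rho\,\beta\sqrt{\frac{d\log(T/\delta)}{t}},\qquad C(t)=t\rho(t),\qquad \Delta(t)=c_\Delta\,d\sqrt{\log(T/\delta)}\,\|\theta_t-\theta_{t+1}\|_2 ,$$ the following hold. 1. OFUL, run alone, satisfies: $\widetilde f_t\in[0,1]$; $\Delta(t)\ge\sup_{a\in\mathcal A}|f_t(a)-f_{t+1}(a)|$ for $t<T$; $\rho$ is non-increasing, $\rho(t)\ge 1/\sqrt t$, and $C$ is non-decreasing on $[T]$; and for every $t\in[T]$ with $\Delta_{[1,t]}\le\rho(t)$, with probability at least $1-\delta/T$, $$\widetilde f_t\ge\min_{\tau\in[1,t]}f_\tau^\star-\Delta_{[1,t]}\quad\text{and}\quad\frac1t\sum_{\tau=1}^t(\widetilde f_\tau-R_\tau)\le\rho(t)+\Delta_{[1,t]} .$$ Moreover $C(t)\le K\log^k(T/\delta)\,d\sqrt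 t$ for $t\in[T]$. 2. MASTER with base algorithm OFUL and input $\rho$ (so without knowledge of $\theta_t$, $L$, $\Delta$ or $\widehat\Delta$) satisfies, with probability at least $1-\delta$, $$\textsc{D-Reg}\le K\log^k(T/\delta)\,\min\Big\{d\sqrt{LT},\ d\,\widehat\Delta^{1/3}T^{2/3}+d\sqrt T\Big\}.$$ -/

import Mathlib

open MeasureTheory ProbabilityTheory

universe u v

noncomputable section

/-! ## The interaction protocol -/

/-- A base algorithm over the policy set `P`. From the list of the (policy, reward) pairs that it
has collected so far it outputs an auxiliary scalar `est` and proposes a policy; `choices` is the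
set of policies it may propose (ties in an `argmax` may be broken in any way). -/
structure BaseAlg (P : Type v) where
  est : List (P × ℝ) → ℝ
  choices : List (P × ℝ) → Set P

/-- Interaction of a learner with the reward functions `f 1, …, f T`, which are fixed in advance.
In round `t` the learner plays `pol t` and receives the noisy reward `rew t ∈ [0, 1]`. The
σ-algebra `G t` is the information (past policies and rewards, internal randomness up to round `t`,
and the policy `pol t`) present just before the reward of round `t` is drawn; given this
information, the reward has mean `f t (pol t)`. -/
structure IsInteraction {Ω : Type u} [mΩ : MeasurableSpace Ω] {P : Type v} [MeasurableSpace P]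
    (μ : Measure Ω) (G : Filtration ℕ mΩ) (T : ℕ) (f : ℕ → P → ℝ)
    (pol : ℕ → Ω → P) (rew : ℕ → Ω → ℝ) : Prop where
  pol_meas : ∀ t ∈ Finset.Icc 1 T, Measurable[G t] (pol t)
  rew_meas : ∀ t ∈ Finset.Icc 1 T, Measurable[G (t + 1)] (rew t)
  rew_mem : ∀ t ∈ Finset.Icc 1 T, ∀ ω, rew t ω ∈ Set.Icc (0 : ℝ) 1
  rew_mean : ∀ t ∈ Finset.Icc 1 T, μ[rew t | G t] =ᵐ[μ] fun ω => f t (pol t ω)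

/-- The optimal expected reward `f_t^⋆` of round `t`. -/
def optReward {P : Type v} (f : ℕ → P → ℝ) (t : ℕ) : ℝ := ⨆ p : P, f t p

/-- Dynamic regret `∑_{t=1}^T (f_t^⋆ - R_t)` of a reward sequence. -/
def dynRegret {P : Type v} (f : ℕ → P → ℝ) (T : ℕ) (rew : ℕ → ℝ) : ℝ :=
  ∑ t ∈ Finset.Icc 1 T, (optReward f t - rew t)

/-- `Δ_{[s,e]} = ∑_{τ=s}^{e-1} Δ(τ)`. -/
def drift (Δ : ℕ → ℝ) (s e : ℕ) : ℝ := ∑ τ ∈ Finset.Ico s e, Δ τ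

open Classical in
/-- `L = 1 + ∑_{τ=1}^{T-1} 𝟙[Δ(τ) ≠ 0]`. -/
def numStationary (Δ : ℕ → ℝ) (T : ℕ) : ℕ := 1 + ((Finset.Ico 1 T).filter fun τ => Δ τ ≠ 0).card

/-! ## The requirement on a base algorithm -/

/-- What a base algorithm that runs alone has collected before round `t`. -/
def soloHistory {P : Type v} (pol : ℕ → P) (rew : ℕ → ℝ) (t : ℕ) : List (P × ℝ) :=
  (List.Ico 1 t).map fun τ => (pol τ, rew τ)

/-- The process is a run of the base algorithm alone in the environment `f`. -/
structure IsSoloRun {Ω : Type u} [mΩ : MeasurableSpace Ω] {P : Type v} [MeasurableSpace P]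
    (alg : BaseAlg P) (μ : Measure Ω) (G : Filtration ℕ mΩ) (T : ℕ) (f : ℕ → P → ℝ)
    (pol : ℕ → Ω → P) (rew : ℕ → Ω → ℝ) : Prop where
  interaction : IsInteraction μ G T f pol rew
  follows : ∀ t ∈ Finset.Icc 1 T, ∀ ω,
    pol t ω ∈ alg.choices (soloHistory (pol · ω) (rew · ω) t)

/-- The base algorithm `alg` satisfies the (near-)stationary guarantee in the environment `f` with
non-stationarity measure `Δ` and average regret bound `ρ` (so `C(t) = t ρ(t)`). -/
structure NearStationaryGuarantee {P : Type v} [MeasurableSpace P] (alg : BaseAlg P)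
    (f : ℕ → P → ℝ) (T : ℕ) (δ : ℝ) (Δ ρ : ℕ → ℝ) : Prop where
  est_mem : ∀ h, alg.est h ∈ Set.Icc (0 : ℝ) 1
  measure_dev : ∀ t ∈ Finset.Ico 1 T, ∀ p, |f t p - f (t + 1) p| ≤ Δ t
  rho_anti : AntitoneOn ρ (Set.Icc 1 T)
  rho_ge : ∀ t ∈ Finset.Icc 1 T, 1 / √(t : ℝ) ≤ ρ t
  cum_mono : MonotoneOn (fun t : ℕ => (t : ℝ) * ρ t) (Set.Icc 1 T)
  guarantee : ∀ (Ω : Type u) [mΩ : MeasurableSpace Ω] (μ : Measure Ω) [IsProbabilityMeasure μ]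
    (G : Filtration ℕ mΩ) (pol : ℕ → Ω → P) (rew : ℕ → Ω → ℝ),
    IsSoloRun alg μ G T f pol rew →
    ∀ t ∈ Finset.Icc 1 T, drift Δ 1 t ≤ ρ t →
      μ {ω | ¬ (sInf (optReward f '' Set.Icc 1 t) - drift Δ 1 t
                  ≤ alg.est (soloHistory (pol · ω) (rew · ω) t) ∧
                (1 / (t : ℝ)) * ∑ τ ∈ Finset.Icc 1 t,
                    (alg.est (soloHistory (pol · ω) (rew · ω) τ) - rew τ ω)
                  ≤ ρ t + drift Δ 1 t)}
        ≤ ENNReal.ofReal (δ / T)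

/-! ## MALG and MASTER -/

/-- One realization of the interaction: `coin t m` is the uniform random number that decides
whether an order-`m` instance is started in round `t`. -/
structure Transcript (P : Type v) where
  coin : ℕ → ℕ → unitInterval
  pol : ℕ → P
  rew : ℕ → ℝ

/-- A block, planned for the rounds `start, …, start + 2 ^ order - 1`. -/
structure Block where
  start : ℕ
  order : ℕ

/-- In block `B`, an instance of order `m` is scheduled for the rounds `s, …, s + 2 ^ m - 1`: this
happens with probability `ρ(2^n) / ρ(2^m)` if the offset of `s` in the block is a multiple of
`2 ^ m`. -/
def Scheduled {P : Type v} (ρ : ℕ → ℝ) (x : Transcript P) (B : Block) (s m : ℕ) : Prop :=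
  m ≤ B.order ∧ B.start ≤ s ∧ s < B.start + 2 ^ B.order ∧ 2 ^ m ∣ s - B.start ∧
    (x.coin s m : ℝ) ≤ ρ (2 ^ B.order) / ρ (2 ^ m)

/-- Starting round of the order-`m` sub-interval of block `B` that contains round `t`. -/
def subStart (B : Block) (m t : ℕ) : ℕ := B.start + (t - B.start) / 2 ^ m * 2 ^ m

/-- Order of the active instance, i.e. of the shortest scheduled instance covering round `t`. -/
def activeOrder {P : Type v} (ρ : ℕ → ℝ) (x : Transcript P) (B : Block) (t : ℕ) : ℕ :=
  sInf {m | Scheduled ρ x B (subStart B m t) m}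

/-- The active instance of round `t`, as (starting round, order). -/
def activeInst {P : Type v} (ρ : ℕ → ℝ) (x : Transcript P) (B : Block) (t : ℕ) : ℕ × ℕ :=
  (subStart B (activeOrder ρ x B t) t, activeOrder ρ x B t)

open Classical in
/-- What the active instance of round `t` has collected before round `t`: the data of the earlier
rounds of the block in which this same instance was active. -/
def instHistory {P : Type v} (ρ : ℕ → ℝ) (x : Transcript P) (B : Block) (t : ℕ) :
    List (P × ℝ) :=
  ((List.Ico B.start t).filter fun τ => activeInst ρ x B τ = activeInst ρ x B t).map
    fun τ => (x.pol τ, x.rew τ)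

/-- The scalar `g̃_t` output by MALG: the estimate of the active instance. -/
def malgEst {P : Type v} (alg : BaseAlg P) (ρ : ℕ → ℝ) (x : Transcript P) (B : Block) (t : ℕ) :
    ℝ :=
  alg.est (instHistory ρ x B t)

/-- `ρ̂(t) = 6 n̂ log(T/δ) ρ(t)` with `n̂ = log₂ T + 1`. -/
def rhoHat (T : ℕ) (δ : ℝ) (ρ : ℕ → ℝ) (t : ℕ) : ℝ :=
  6 * (Real.logb 2 T + 1) * Real.log (T / δ) * ρ t

/-- `U_t`, the minimum of `g̃` over the rounds of block `B` up to `t`. -/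
def runningMin {P : Type v} (alg : BaseAlg P) (ρ : ℕ → ℝ) (x : Transcript P) (B : Block)
    (t : ℕ) : ℝ :=
  sInf (malgEst alg ρ x B '' Set.Icc B.start t)

/-- Test 1 fails at the end of round `t`. -/
def Test1Fails {P : Type v} (alg : BaseAlg P) (T : ℕ) (δ : ℝ) (ρ : ℕ → ℝ) (x : Transcript P)
    (B : Block) (t : ℕ) : Prop :=
  ∃ s m : ℕ, Scheduled ρ x B s m ∧ t + 1 = s + 2 ^ m ∧
    runningMin alg ρ x B t + 9 * rhoHat T δ ρ (2 ^ m)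
      ≤ (1 / (2 : ℝ) ^ m) * ∑ τ ∈ Finset.Icc s t, x.rew τ

/-- Test 2 fails at the end of round `t`. -/
def Test2Fails {P : Type v} (alg : BaseAlg P) (T : ℕ) (δ : ℝ) (ρ : ℕ → ℝ) (x : Transcript P)
    (B : Block) (t : ℕ) : Prop :=
  3 * rhoHat T δ ρ (t - B.start + 1)
    ≤ (1 / ((t - B.start + 1 : ℕ) : ℝ)) *
        ∑ τ ∈ Finset.Icc B.start t, (malgEst alg ρ x B τ - x.rew τ)

open Classical in
/-- The block of MASTER that round `t` belongs to. Blocks have orders `0, 1, 2, …`, and after a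
failed test the sequence restarts from order `0`. The value at `0` is not used. -/
def masterBlock {P : Type v} (alg : BaseAlg P) (T : ℕ) (δ : ℝ) (ρ : ℕ → ℝ) (x : Transcript P) :
    ℕ → Block
  | 0 => ⟨1, 0⟩
  | 1 => ⟨1, 0⟩
  | t + 2 =>
    let B := masterBlock alg T δ ρ x (t + 1)
    if Test1Fails alg T δ ρ x B (t + 1) ∨ Test2Fails alg T δ ρ x B (t + 1) then ⟨t + 2, 0⟩
    else if t + 2 = B.start + 2 ^ B.order then ⟨t + 2, B.order + 1⟩
    else B

/-- The process is a run of MASTER, with base algorithm `alg` and regret bound `ρ`, in the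
environment `f`. The coins of a round are independent uniform random numbers, drawn independently
of everything that happened in the earlier rounds. -/
structure IsMasterRun {Ω : Type u} [mΩ : MeasurableSpace Ω] {P : Type v} [MeasurableSpace P]
    (alg : BaseAlg P) (δ : ℝ) (ρ : ℕ → ℝ) (μ : Measure Ω) (G : Filtration ℕ mΩ) (T : ℕ)
    (f : ℕ → P → ℝ) (coin : ℕ → ℕ → Ω → unitInterval) (pol : ℕ → Ω → P)
    (rew : ℕ → Ω → ℝ) : Prop where
  interaction : IsInteraction μ G T f pol rew
  coin_meas : ∀ t ∈ Finset.Icc 1 T, ∀ m, Measurable[G t] (coin t m)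
  coin_law : ∀ t ∈ Finset.Icc 1 T, ∀ m, μ.map (coin t m) = volume
  coin_indep : ∀ t ∈ Finset.Icc 1 T, iIndepFun (coin t) μ
  coin_fresh : ∀ t ∈ Finset.Ico 1 T,
    Indep (⨆ m, MeasurableSpace.comap (coin (t + 1) m) inferInstance)
      (G t ⊔ MeasurableSpace.comap (rew t) inferInstance) μ
  follows : ∀ t ∈ Finset.Icc 1 T, ∀ ω,
    let x : Transcript P := ⟨fun s m => coin s m ω, (pol · ω), (rew · ω)⟩
    pol t ω ∈ alg.choices (instHistory ρ x (masterBlock alg T δ ρ x t) t)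

/-! ## OFUL for linear bandits with a fixed action set -/

/-- `f_t(a) = aᵀ θ_t`. -/
def linReward {d : ℕ} (A : Set (EuclideanSpace ℝ (Fin d))) (θ : ℕ → EuclideanSpace ℝ (Fin d))
    (t : ℕ) (a : A) : ℝ :=
  inner ℝ (a : EuclideanSpace ℝ (Fin d)) (θ t)

/-- `β = 4 √(d log(T/δ))`. -/
def ofulBeta (d T : ℕ) (δ : ℝ) : ℝ := 4 * √((d : ℝ) * Real.log (T / δ))

/-- `Λ = I + ∑ a aᵀ`. -/
def ofulGram {d : ℕ} {A : Set (EuclideanSpace ℝ (Fin d))} (h : List (A × ℝ)) :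
    Matrix (Fin d) (Fin d) ℝ :=
  1 + (h.map fun p => Matrix.vecMulVec p.1.1.ofLp p.1.1.ofLp).sum

/-- `θ̂ = Λ⁻¹ ∑ R a`. -/
def ofulTheta {d : ℕ} {A : Set (EuclideanSpace ℝ (Fin d))} (h : List (A × ℝ)) : Fin d → ℝ :=
  Matrix.mulVec (ofulGram h)⁻¹ (h.map fun p => p.2 • p.1.1.ofLp).sum

/-- The optimistic index `aᵀ θ̂ + 2 β ‖a‖_{Λ⁻¹}` of an action. -/
def ofulIndex {d : ℕ} {A : Set (EuclideanSpace ℝ (Fin d))} (T : ℕ) (δ : ℝ) (h : List (A × ℝ))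
    (a : A) : ℝ :=
  dotProduct a.1.ofLp (ofulTheta h) +
    2 * ofulBeta d T δ * √(dotProduct a.1.ofLp (Matrix.mulVec (ofulGram h)⁻¹ a.1.ofLp))

/-- OFUL: plays a maximizer of the optimistic index; its auxiliary output is the maximal index,
clipped to the reward range `[0, 1]`. -/
def oful {d : ℕ} (A : Set (EuclideanSpace ℝ (Fin d))) (T : ℕ) (δ : ℝ) : BaseAlg A where
  est h := max 0 (min 1 (⨆ a : A, ofulIndex T δ h a))
  choices h := {a | ∀ b : A, ofulIndex T δ h b ≤ ofulIndex T δ h a}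

/-- The average regret bound `ρ(t) = c β √(d log(T/δ) / t)`. -/
def ofulRho (c : ℝ) (d T : ℕ) (δ : ℝ) (t : ℕ) : ℝ :=
  c * ofulBeta d T δ * √((d : ℝ) * Real.log (T / δ) / t)

/-- The non-stationarity measure `Δ(t) = c d √(log(T/δ)) ‖θ_t - θ_{t+1}‖₂`. -/
def ofulDelta {d : ℕ} (c : ℝ) (T : ℕ) (δ : ℝ) (θ : ℕ → EuclideanSpace ℝ (Fin d)) (t : ℕ) : ℝ :=
  c * d * √(Real.log (T / δ)) * ‖θ t - θ (t + 1)‖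

/-- The variation `Δ̂ = ∑_{t=1}^{T-1} ‖θ_t - θ_{t+1}‖₂`. -/
def paramVariation {d : ℕ} (T : ℕ) (θ : ℕ → EuclideanSpace ℝ (Fin d)) : ℝ :=
  ∑ t ∈ Finset.Ico 1 T, ‖θ t - θ (t + 1)‖

end

/-! The confidence sets of OFUL tolerate a little drift. In direction `a`, the error of the ridge
estimate is at most the Λ⁻¹-norm of `a` times the sum of a regularization bias of at most 1, the
self-normalized noise, and D√k, where D bounds the movement of the parameter over the k rounds used
(`abs_ridge_sub_le`). The noise is bounded path by path by a log-determinant plus twice the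
logarithm of an exponential supermartingale (`invForm_noiseSeq_le`, `measure_selfNorm_le`). With c_Δ
= 4c_ρ, the condition drift ≤ ρ(k) says exactly that D√k ≤ √log(T/δ), so the width 2β still
dominates the error. Optimism (`est_bounds`) and the elliptical potential lemma (`sum_width_le`)
then give the guarantee of OFUL run alone.

MASTER is analysed on one good event (`GoodPath`), relative to a deterministic monotone labelling κ
of the rounds in which the drift inside a class is at most ρ of the length. The data of an instance
come from a predictable set of rounds, so the same confidence bound holds for it, uniformly over all
possible blocks and instances. Three facts follow. On a near-stationary interval covered by a
scheduled instance, the estimates are optimistic and exceed the rewards by at most ρ̂/2 on average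
(`scheduled_regret`). No test fails while a block stays in one class (`not_testFails_of_drift_le`),
so every restart uses up a label. If an earlier estimate of the class was too low by more than
11ρ̂(2^m), then a scheduled order-m instance would make Test 1 fail (`miss_of_candidate`); since the
coins are fresh, only about log(T/δ)·ρ(2^m)/ρ(2^n) such opportunities can pass unused in a block of
order n.

Within a block, Test 2 controls the estimates minus the rewards, and slicing the deficit of the
estimates into dyadic layers, one for each m, controls the optimal rewards minus the estimates
(`sum_optReward_sub_est_le`). Summing over blocks by Cauchy–Schwarz gives d√((κ T + 1)T) up to
logarithms (`dynRegret_le`). Labelling by the number of changes yields the bound in L; labelling by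
windows of length about (T/Δ̂)^{2/3}, cut where drift accumulates, yields the bound in Δ̂. The
minimum of the two is a deterministic number, so only the better labelling is used and the failure
probability is not doubled. -/

/-! ## Quadratic forms of inverse Gram matrices -/

section InverseForm

open Matrix

variable {ι : Type*} [Fintype ι] [DecidableEq ι]

/-- The bilinear form of `A⁻¹`. -/
noncomputable def invForm (A : Matrix ι ι ℝ) (x y : ι → ℝ) : ℝ := x ⬝ᵥ (A⁻¹ *ᵥ y)

lemma invForm_add_right (A : Matrix ι ι ℝ) (x y z : ι → ℝ) :
    invForm A x (y + z) = invForm A x y + invForm A x z := by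
  simp [invForm, mulVec_add, dotProduct_add]

lemma invForm_add_left (A : Matrix ι ι ℝ) (x y z : ι → ℝ) :
    invForm A (x + y) z = invForm A x z + invForm A y z := by
  simp [invForm, add_dotProduct]

lemma invForm_smul_right (A : Matrix ι ι ℝ) (c : ℝ) (x y : ι → ℝ) :
    invForm A x (c • y) = c * invForm A x y := by
  simp [invForm, mulVec_smul, dotProduct_smul]

lemma invForm_smul_left (A : Matrix ι ι ℝ) (c : ℝ) (x y : ι → ℝ) :
    invForm A (c • x) y = c * invForm A x y := by
  simp [invForm, smul_dotProduct]

lemma invForm_zero_right (A : Matrix ι ι ℝ) (x : ι → ℝ) : invForm A x 0 = 0 := by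
  simp [invForm]

lemma invForm_zero_left (A : Matrix ι ι ℝ) (x : ι → ℝ) : invForm A 0 x = 0 := by
  simp [invForm]

lemma invForm_sum_right {κ : Type*} (A : Matrix ι ι ℝ) (x : ι → ℝ) (s : Finset κ)
    (y : κ → ι → ℝ) : invForm A x (∑ k ∈ s, y k) = ∑ k ∈ s, invForm A x (y k) := by
  classical
  induction s using Finset.induction_on with
  | empty => simp [invForm_zero_right]
  | insert a s ha ih => rw [Finset.sum_insert ha, Finset.sum_insert ha, invForm_add_right, ih]

variable {A : Matrix ι ι ℝ}

lemma invForm_comm (hA : A.PosDef) (x y : ι → ℝ) : invForm A x y = invForm A y x := by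
  have h : (A⁻¹)ᵀ = A⁻¹ := by
    have := hA.inv.isHermitian
    rwa [IsHermitian, conjTranspose_eq_transpose_of_trivial] at this
  rw [invForm, invForm, dotProduct_mulVec, ← mulVec_transpose, h, dotProduct_comm]

lemma invForm_self_nonneg (hA : A.PosDef) (x : ι → ℝ) : 0 ≤ invForm A x x := by
  simpa [invForm] using hA.inv.posSemidef.dotProduct_mulVec_nonneg x

lemma mulVec_inv_mulVec (hA : A.PosDef) (x : ι → ℝ) : A *ᵥ (A⁻¹ *ᵥ x) = x := by
  rw [mulVec_mulVec, mul_nonsing_inv _ ((isUnit_iff_isUnit_det _).1 hA.isUnit), one_mulVec]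

lemma inv_mulVec_mulVec (hA : A.PosDef) (x : ι → ℝ) : A⁻¹ *ᵥ (A *ᵥ x) = x := by
  rw [mulVec_mulVec, nonsing_inv_mul _ ((isUnit_iff_isUnit_det _).1 hA.isUnit), one_mulVec]

/-- Cauchy–Schwarz for the form of `A⁻¹`. -/
lemma sq_invForm_le (hA : A.PosDef) (x y : ι → ℝ) :
    invForm A x y ^ 2 ≤ invForm A x x * invForm A y y := by
  have h : ∀ c : ℝ, 0 ≤ invForm A y y * (c * c) + 2 * invForm A x y * c + invForm A x x := by
    intro c
    have := invForm_self_nonneg hA (x + c • y)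
    rw [invForm_add_left, invForm_add_right, invForm_add_right, invForm_smul_left,
      invForm_smul_left, invForm_smul_right, invForm_smul_right, invForm_comm hA y x] at this
    linarith
  have := discrim_le_zero h
  unfold discrim at this
  nlinarith

lemma abs_invForm_le (hA : A.PosDef) (x y : ι → ℝ) :
    |invForm A x y| ≤ √(invForm A x x) * √(invForm A y y) := by
  rw [← Real.sqrt_mul (invForm_self_nonneg hA x)]
  exact Real.abs_le_sqrt (sq_invForm_le hA x y)

lemma add_vecMulVec_mulVec (b z : ι → ℝ) :
    (A + vecMulVec b b) *ᵥ z = A *ᵥ z + (b ⬝ᵥ z) • b := by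
  rw [add_mulVec, vecMulVec_mulVec]
  simp

lemma posSemidef_vecMulVec_self (b : ι → ℝ) : (vecMulVec b b).PosSemidef := by
  simpa using posSemidef_vecMulVec_self_star (R := ℝ) b

lemma posDef_add_vecMulVec (hA : A.PosDef) (b : ι → ℝ) : (A + vecMulVec b b).PosDef :=
  hA.add_posSemidef (posSemidef_vecMulVec_self b)

/-- Sherman–Morrison. -/
lemma invForm_add_vecMulVec (hA : A.PosDef) (b x y : ι → ℝ) :
    invForm (A + vecMulVec b b) x y =
      invForm A x y - invForm A x b * invForm A b y / (1 + invForm A b b) := by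
  have hw : 1 + invForm A b b ≠ 0 := by linarith [invForm_self_nonneg hA b]
  set c := invForm A b y / (1 + invForm A b b) with hc
  have hz : (A + vecMulVec b b) *ᵥ (A⁻¹ *ᵥ y - c • (A⁻¹ *ᵥ b)) = y := by
    rw [add_vecMulVec_mulVec, mulVec_sub, mulVec_smul, mulVec_inv_mulVec hA,
      mulVec_inv_mulVec hA, dotProduct_sub, dotProduct_smul]
    change y - c • b + (invForm A b y - c • invForm A b b) • b = y
    have : invForm A b y - c • invForm A b b = c := by
      rw [smul_eq_mul, hc]; field_simp; ring
    rw [this]; simp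
  have h2 : (A + vecMulVec b b)⁻¹ *ᵥ y = A⁻¹ *ᵥ y - c • (A⁻¹ *ᵥ b) := by
    conv_lhs => rw [← hz]
    rw [inv_mulVec_mulVec (posDef_add_vecMulVec hA b)]
  rw [invForm, h2, dotProduct_sub, dotProduct_smul]
  change invForm A x y - c * invForm A x b = _
  rw [hc]; ring

/-- The matrix determinant lemma; it makes log det Λ telescope along the rounds. -/
lemma det_add_vecMulVec (hA : A.PosDef) (b : ι → ℝ) :
    (A + vecMulVec b b).det = A.det * (1 + invForm A b b) := by
  have h := det_add_replicateCol_mul_replicateRow (ι := Unit)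
    ((isUnit_iff_isUnit_det _).1 hA.isUnit) b b
  rw [vecMulVec_eq Unit, h, Matrix.mul_assoc, ← replicateCol_mulVec]
  congr 1
  simp [det_unique, invForm]

/-- `Λ = I + ∑ b bᵀ` over the rounds `u ≤ τ < t`. -/
noncomputable def gramSeq (b : ℕ → ι → ℝ) (u t : ℕ) : Matrix ι ι ℝ :=
  1 + ∑ τ ∈ Finset.Ico u t, vecMulVec (b τ) (b τ)

variable (b : ℕ → ι → ℝ) {u t : ℕ}

lemma gramSeq_self : gramSeq b u u = 1 := by simp [gramSeq]

lemma gramSeq_succ (h : u ≤ t) :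
    gramSeq b u (t + 1) = gramSeq b u t + vecMulVec (b t) (b t) := by
  rw [gramSeq, gramSeq, Finset.sum_Ico_succ_top h, add_assoc]

lemma posDef_gramSeq (u t : ℕ) : (gramSeq b u t).PosDef :=
  PosDef.one.add_posSemidef (posSemidef_sum _ fun _ _ => posSemidef_vecMulVec_self _)

lemma dotProduct_gramSeq_mulVec (u t : ℕ) (x y : ι → ℝ) :
    x ⬝ᵥ (gramSeq b u t *ᵥ y) = x ⬝ᵥ y + ∑ τ ∈ Finset.Ico u t, (x ⬝ᵥ b τ) * (b τ ⬝ᵥ y) := by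
  rw [gramSeq, add_mulVec, one_mulVec, sum_mulVec, dotProduct_add, dotProduct_sum]
  congr 1
  refine Finset.sum_congr rfl fun τ _ => ?_
  rw [vecMulVec_mulVec]
  simp [mul_comm]

lemma dotProduct_self_inv_gramSeq (u t : ℕ) (x : ι → ℝ) :
    invForm (gramSeq b u t) x x = ((gramSeq b u t)⁻¹ *ᵥ x) ⬝ᵥ ((gramSeq b u t)⁻¹ *ᵥ x)
      + ∑ τ ∈ Finset.Ico u t, invForm (gramSeq b u t) x (b τ) ^ 2 := by
  have hA := posDef_gramSeq b u t
  have h := dotProduct_gramSeq_mulVec b u t ((gramSeq b u t)⁻¹ *ᵥ x) ((gramSeq b u t)⁻¹ *ᵥ x)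
  rw [mulVec_inv_mulVec hA] at h
  rw [invForm, dotProduct_comm, h]
  congr 1
  refine Finset.sum_congr rfl fun τ _ => ?_
  rw [invForm_comm hA, invForm, sq, dotProduct_comm _ (b τ)]

/-- With z = Λ⁻¹x the form equals z·Λz, and Λ dominates its rank-one part. This is what lets the
drift bias be estimated by Cauchy–Schwarz with a factor √k instead of k. -/
lemma sum_sq_invForm_gramSeq_le (u t : ℕ) (x : ι → ℝ) :
    ∑ τ ∈ Finset.Ico u t, invForm (gramSeq b u t) x (b τ) ^ 2 ≤ invForm (gramSeq b u t) x x := by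
  have h := dotProduct_self_inv_gramSeq b u t x
  have := dotProduct_self_star_nonneg ((gramSeq b u t)⁻¹ *ᵥ x)
  simp only [star_trivial] at this
  linarith

/-- This is Λ⁻¹ ≤ I. For z = Λ⁻¹x one has z·z ≤ x·z, and expanding |x − z|² ≥ 0 gives x·z ≤ x·x. -/
lemma invForm_gramSeq_le (u t : ℕ) (x : ι → ℝ) : invForm (gramSeq b u t) x x ≤ x ⬝ᵥ x := by
  set z := (gramSeq b u t)⁻¹ *ᵥ x with hz
  have h : z ⬝ᵥ z ≤ invForm (gramSeq b u t) x x := by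
    rw [dotProduct_self_inv_gramSeq]
    exact le_add_of_nonneg_right (Finset.sum_nonneg fun _ _ => sq_nonneg _)
  have h2 : 0 ≤ (x - z) ⬝ᵥ (x - z) := by simpa using dotProduct_self_star_nonneg (x - z)
  rw [sub_dotProduct, dotProduct_sub, dotProduct_sub, dotProduct_comm z x] at h2
  change z ⬝ᵥ z ≤ x ⬝ᵥ z at h
  change x ⬝ᵥ z ≤ x ⬝ᵥ x
  linarith

lemma invForm_gramSeq_le_one (u t : ℕ) {x : ι → ℝ} (hx : x ⬝ᵥ x ≤ 1) :
    invForm (gramSeq b u t) x x ≤ 1 := (invForm_gramSeq_le b u t x).trans hx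

lemma det_gramSeq_pos (u t : ℕ) : 0 < (gramSeq b u t).det := (posDef_gramSeq b u t).det_pos

variable {b}

lemma dotProduct_sq_le (x y : ι → ℝ) : (x ⬝ᵥ y) ^ 2 ≤ (x ⬝ᵥ x) * (y ⬝ᵥ y) := by
  simp only [dotProduct, ← sq]
  exact Finset.sum_mul_sq_le_sq_mul_sq _ _ _

/-- Each eigenvalue is the value of the form of Λ at a unit eigenvector, where every round
contributes at most 1 by Cauchy–Schwarz. -/
lemma log_det_gramSeq_le (hb : ∀ τ, b τ ⬝ᵥ b τ ≤ 1) (u t : ℕ) :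
    Real.log (gramSeq b u t).det ≤ Fintype.card ι * Real.log (1 + (t - u : ℕ)) := by
  have hA := posDef_gramSeq b u t
  have hev : ∀ i, hA.isHermitian.eigenvalues i ≤ 1 + (t - u : ℕ) := by
    intro i
    set v : ι → ℝ := (hA.isHermitian.eigenvectorBasis i).ofLp with hv
    have h1 := hA.isHermitian.mulVec_eigenvectorBasis i
    have hn : v ⬝ᵥ v = 1 := by
      have := hA.isHermitian.eigenvectorBasis.orthonormal.1 i
      have h2 : ‖hA.isHermitian.eigenvectorBasis i‖ ^ 2 = 1 := by rw [this]; norm_num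
      rw [EuclideanSpace.real_norm_sq_eq] at h2
      simpa [dotProduct, sq] using h2
    have h3 := dotProduct_gramSeq_mulVec b u t v v
    rw [← hv] at h1
    rw [h1, dotProduct_smul, hn] at h3
    have h4 : ∑ τ ∈ Finset.Ico u t, (v ⬝ᵥ b τ) * (b τ ⬝ᵥ v) ≤ (t - u : ℕ) := by
      calc _ ≤ ∑ τ ∈ Finset.Ico u t, (1 : ℝ) := by
            refine Finset.sum_le_sum fun τ _ => ?_
            have := dotProduct_sq_le v (b τ)
            rw [dotProduct_comm (b τ) v, ← sq]
            rw [hn, one_mul] at this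
            exact this.trans (hb τ)
        _ = _ := by simp
    simp only [smul_eq_mul, mul_one] at h3
    linarith
  rw [hA.isHermitian.det_eq_prod_eigenvalues]
  simp only [RCLike.ofReal_real_eq_id, id_eq]
  rw [Real.log_prod fun i _ => (hA.eigenvalues_pos i).ne']
  calc _ ≤ ∑ _i : ι, Real.log (1 + (t - u : ℕ)) :=
        Finset.sum_le_sum fun i _ => Real.log_le_log (hA.eigenvalues_pos i) (hev i)
    _ = _ := by simp

/-- The elliptical potential lemma. -/
lemma sum_invForm_div_le_log_det (h : u ≤ t) :
    ∑ τ ∈ Finset.Ico u t, invForm (gramSeq b u τ) (b τ) (b τ) /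
        (1 + invForm (gramSeq b u τ) (b τ) (b τ)) ≤ Real.log (gramSeq b u t).det := by
  induction t, h using Nat.le_induction with
  | base => simp [gramSeq_self]
  | succ t h ih =>
    have hw := invForm_self_nonneg (posDef_gramSeq b u t) (b t)
    rw [Finset.sum_Ico_succ_top h, gramSeq_succ b h, det_add_vecMulVec (posDef_gramSeq b u t),
      Real.log_mul (det_gramSeq_pos b u t).ne' (by positivity)]
    refine add_le_add ih ?_
    have := Real.one_sub_inv_le_log_of_pos (x := 1 + invForm (gramSeq b u t) (b t) (b t))
      (by positivity)
    refine le_trans (le_of_eq ?_) this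
    field_simp
    ring

lemma sum_invForm_div_le (hb : ∀ τ, b τ ⬝ᵥ b τ ≤ 1) (h : u ≤ t) :
    ∑ τ ∈ Finset.Ico u t, invForm (gramSeq b u τ) (b τ) (b τ) /
        (1 + invForm (gramSeq b u τ) (b τ) (b τ)) ≤
      Fintype.card ι * Real.log (1 + (t - u : ℕ)) :=
  (sum_invForm_div_le_log_det h).trans (log_det_gramSeq_le hb u t)

/-- The factor 2 comes from w ≤ 2w/(1 + w), valid because w ≤ 1 for features in the unit ball. -/
lemma sum_invForm_le (hb : ∀ τ, b τ ⬝ᵥ b τ ≤ 1) (h : u ≤ t) :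
    ∑ τ ∈ Finset.Ico u t, invForm (gramSeq b u τ) (b τ) (b τ) ≤
      2 * (Fintype.card ι * Real.log (1 + (t - u : ℕ))) := by
  refine le_trans ?_ (mul_le_mul_of_nonneg_left (sum_invForm_div_le hb h) zero_le_two)
  rw [Finset.mul_sum]
  refine Finset.sum_le_sum fun τ _ => ?_
  have h0 := invForm_self_nonneg (posDef_gramSeq b u τ) (b τ)
  have h1 := invForm_gramSeq_le_one b u τ (hb τ)
  rw [mul_div_assoc', le_div_iff₀ (by positivity)]
  nlinarith

/-- `∑ η b` over the rounds `u ≤ τ < t`. -/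
def noiseSeq (b : ℕ → ι → ℝ) (η : ℕ → ℝ) (u t : ℕ) : ι → ℝ :=
  ∑ τ ∈ Finset.Ico u t, η τ • b τ

/-- The predictable weight of the noise of round `t` in the self-normalized process. -/
noncomputable def noiseWeight (b : ℕ → ι → ℝ) (η : ℕ → ℝ) (u t : ℕ) : ℝ :=
  invForm (gramSeq b u t) (b t) (noiseSeq b η u t) / (1 + invForm (gramSeq b u t) (b t) (b t))

/-- Pathwise form of the self-normalized concentration inequality. -/
lemma invForm_noiseSeq_le {η : ℕ → ℝ} (hη : ∀ τ ∈ Finset.Ico u t, |η τ| ≤ 1) (h : u ≤ t) :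
    invForm (gramSeq b u t) (noiseSeq b η u t) (noiseSeq b η u t) ≤
      ∑ τ ∈ Finset.Ico u t, invForm (gramSeq b u τ) (b τ) (b τ) /
        (1 + invForm (gramSeq b u τ) (b τ) (b τ)) +
      2 * ∑ τ ∈ Finset.Ico u t,
        (noiseWeight b η u τ * η τ - noiseWeight b η u τ ^ 2 / 2) := by
  induction t, h using Nat.le_induction with
  | base => simp [noiseSeq, invForm_zero_right]
  | succ t h ih =>
    have hA := posDef_gramSeq b u t
    have hw := invForm_self_nonneg hA (b t)
    have hS : noiseSeq b η u (t + 1) = noiseSeq b η u t + η t • b t := by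
      rw [noiseSeq, noiseSeq, Finset.sum_Ico_succ_top h]
    replace ih := ih fun τ hτ => hη τ (by simp at hτ ⊢; omega)
    rw [Finset.sum_Ico_succ_top h, Finset.sum_Ico_succ_top h, gramSeq_succ b h, hS]
    set A := gramSeq b u t
    set S := noiseSeq b η u t
    have hy : noiseWeight b η u t = invForm A (b t) S / (1 + invForm A (b t) (b t)) := rfl
    rw [hy]
    set w := invForm A (b t) (b t)
    set y := invForm A (b t) S with hyd
    have hyc : invForm A S (b t) = y := invForm_comm hA _ _
    rw [invForm_add_vecMulVec hA, invForm_add_left, invForm_add_right, invForm_add_right,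
      invForm_add_left, invForm_add_right]
    simp only [invForm_smul_left, invForm_smul_right, hyc]
    change invForm A S S + η t * y + (η t * y + η t * (η t * w)) -
      (y + η t * w) * (y + η t * w) / (1 + w) ≤ _
    have hη2 : η t ^ 2 ≤ 1 := by rw [sq_le_one_iff_abs_le_one]; exact hη t (by simp [h])
    have h1w : 0 < 1 + w := by positivity
    -- By Sherman–Morrison this is the increment of the form. The gap between the two sides is an
    -- explicit quotient, nonnegative since η² ≤ 1 and w ≥ 0.
    have key : η t * y + (η t * y + η t * (η t * w)) - (y + η t * w) * (y + η t * w) / (1 + w)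
        ≤ w / (1 + w) + 2 * (y / (1 + w) * η t - (y / (1 + w)) ^ 2 / 2) := by
      have e : w / (1 + w) + 2 * (y / (1 + w) * η t - (y / (1 + w)) ^ 2 / 2) -
          (η t * y + (η t * y + η t * (η t * w)) - (y + η t * w) * (y + η t * w) / (1 + w)) =
          (w * (1 - η t ^ 2) * (1 + w) + y ^ 2 * w) / (1 + w) ^ 2 := by
        field_simp; ring
      have : 0 ≤ (w * (1 - η t ^ 2) * (1 + w) + y ^ 2 * w) / (1 + w) ^ 2 := by
        apply div_nonneg _ (by positivity)
        have : 0 ≤ 1 - η t ^ 2 := by linarith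
        positivity
      linarith
    linarith

/-- A crude bound; it serves only to make the exponential process integrable and does not enter the
tail estimate. -/
lemma abs_noiseWeight_le {η : ℕ → ℝ} (hη : ∀ τ ∈ Finset.Ico u t, |η τ| ≤ 1) (hb : ∀ τ, b τ ⬝ᵥ b τ ≤ 1) :
    |noiseWeight b η u t| ≤ (t - u : ℕ) := by
  have hA := posDef_gramSeq b u t
  have hw := invForm_self_nonneg hA (b t)
  rw [noiseWeight, abs_div, abs_of_pos (by positivity : 0 < 1 + invForm (gramSeq b u t) (b t) (b t))]
  refine (div_le_self (abs_nonneg _) (by linarith)).trans ?_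
  rw [noiseSeq, invForm_sum_right]
  refine (Finset.abs_sum_le_sum_abs _ _).trans ?_
  calc _ ≤ ∑ τ ∈ Finset.Ico u t, (1 : ℝ) := by
        refine Finset.sum_le_sum fun τ hτ => ?_
        rw [invForm_smul_right, abs_mul]
        refine mul_le_one₀ (hη τ hτ) (abs_nonneg _) ((abs_invForm_le hA _ _).trans ?_)
        refine mul_le_one₀ ?_ (Real.sqrt_nonneg _) ?_ <;>
        · exact Real.sqrt_le_one.2 <| invForm_gramSeq_le_one b u t (hb _)
    _ = _ := by simp

end InverseForm

/-! ### Confidence widths under drifting parameters -/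

section ConfidenceWidth

open Matrix

variable {ι : Type*} [Fintype ι] [DecidableEq ι] {b : ℕ → ι → ℝ}

/-- Error of the ridge estimate in direction `a` under drifting parameters. -/
lemma abs_ridge_sub_le {u t : ℕ} {r η : ℕ → ℝ} {θ : ℕ → ι → ℝ} {ϑ : ι → ℝ} {D : ℝ}
    (hr : ∀ τ ∈ Finset.Ico u t, r τ • b τ = (b τ ⬝ᵥ θ τ + η τ) • b τ)
    (hϑ : ϑ ⬝ᵥ ϑ ≤ 1) (hD0 : 0 ≤ D)
    (hD : ∀ τ ∈ Finset.Ico u t, b τ ≠ 0 → |b τ ⬝ᵥ θ τ - b τ ⬝ᵥ ϑ| ≤ D) {k : ℕ}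
    (hk : ((Finset.Ico u t).filter fun τ => b τ ≠ 0).card ≤ k) (a : ι → ℝ) :
    |a ⬝ᵥ ((gramSeq b u t)⁻¹ *ᵥ ∑ τ ∈ Finset.Ico u t, r τ • b τ) - a ⬝ᵥ ϑ| ≤
      √(invForm (gramSeq b u t) a a) *
        (1 + √(invForm (gramSeq b u t) (noiseSeq b η u t) (noiseSeq b η u t)) + D * √k) := by
  have hA := posDef_gramSeq b u t
  set A := gramSeq b u t with hAdef
  have e1 : a ⬝ᵥ (A⁻¹ *ᵥ ∑ τ ∈ Finset.Ico u t, r τ • b τ) =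
      invForm A a (noiseSeq b η u t) +
        ∑ τ ∈ Finset.Ico u t, (b τ ⬝ᵥ θ τ) * invForm A a (b τ) := by
    change invForm A a _ = _
    rw [invForm_sum_right, noiseSeq, invForm_sum_right, ← Finset.sum_add_distrib]
    refine Finset.sum_congr rfl fun τ hτ => ?_
    rw [hr τ hτ, invForm_smul_right, invForm_smul_right]; ring
  -- Writing ϑ as Λ⁻¹Λϑ separates the bias of the identity part of Λ from the sum to be compared
  -- with the true means.
  have e2 : a ⬝ᵥ ϑ = invForm A a ϑ + ∑ τ ∈ Finset.Ico u t, (b τ ⬝ᵥ ϑ) * invForm A a (b τ) := by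
    have h := dotProduct_gramSeq_mulVec b u t (A⁻¹ *ᵥ a) ϑ
    rw [← hAdef, dotProduct_comm, dotProduct_comm _ ϑ] at h
    have h3 : (A *ᵥ ϑ) ⬝ᵥ (A⁻¹ *ᵥ a) = a ⬝ᵥ ϑ := by
      change invForm A (A *ᵥ ϑ) a = _
      rw [invForm_comm hA, invForm, inv_mulVec_mulVec hA]
    rw [h3] at h
    rw [h]
    congr 1
    · exact invForm_comm hA ϑ a
    · refine Finset.sum_congr rfl fun τ _ => ?_
      rw [invForm_comm hA a, invForm, mul_comm, dotProduct_comm (b τ) (A⁻¹ *ᵥ a)]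
  -- Rounds with zero feature drop out, so Cauchy–Schwarz runs over at most k terms.
  have e3 : |∑ τ ∈ Finset.Ico u t, (b τ ⬝ᵥ θ τ - b τ ⬝ᵥ ϑ) * invForm A a (b τ)| ≤
      D * √k * √(invForm A a a) := by
    set F := (Finset.Ico u t).filter fun τ => b τ ≠ 0 with hF
    have e4 : ∑ τ ∈ Finset.Ico u t, (b τ ⬝ᵥ θ τ - b τ ⬝ᵥ ϑ) * invForm A a (b τ) =
        ∑ τ ∈ F, (b τ ⬝ᵥ θ τ - b τ ⬝ᵥ ϑ) * invForm A a (b τ) := by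
      rw [hF, Finset.sum_filter]
      refine Finset.sum_congr rfl fun τ _ => ?_
      by_cases h : b τ = 0 <;> simp [h]
    rw [e4]
    have e5 : ∑ τ ∈ F, |invForm A a (b τ)| ≤ √k * √(invForm A a a) := by
      have h1 : (∑ τ ∈ F, |invForm A a (b τ)|) ^ 2 ≤ k * invForm A a a := by
        refine sq_sum_le_card_mul_sum_sq.trans ?_
        refine mul_le_mul (by exact_mod_cast hk) ?_ (by positivity) (by positivity)
        simp only [sq_abs]
        refine (Finset.sum_le_sum_of_subset_of_nonneg (Finset.filter_subset _ _)
          fun _ _ _ => sq_nonneg _).trans (sum_sq_invForm_gramSeq_le b u t a)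
      rw [← Real.sqrt_mul (by positivity)]
      exact Real.le_sqrt_of_sq_le h1
    calc _ ≤ ∑ τ ∈ F, D * |invForm A a (b τ)| := by
          refine (Finset.abs_sum_le_sum_abs _ _).trans (Finset.sum_le_sum fun τ hτ => ?_)
          rw [abs_mul]
          have := Finset.mem_filter.1 hτ
          exact mul_le_mul_of_nonneg_right (hD τ this.1 this.2) (abs_nonneg _)
      _ ≤ D * (√k * √(invForm A a a)) := by
          rw [← Finset.mul_sum]; exact mul_le_mul_of_nonneg_left e5 hD0
      _ = _ := by ring
  have e6 := abs_invForm_le hA a (noiseSeq b η u t)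
  have e7 : |invForm A a ϑ| ≤ √(invForm A a a) := by
    refine (abs_invForm_le hA a ϑ).trans (mul_le_of_le_one_right (Real.sqrt_nonneg _) ?_)
    exact Real.sqrt_le_one.2 (invForm_gramSeq_le_one b u t hϑ)
  have e8 : a ⬝ᵥ (A⁻¹ *ᵥ ∑ τ ∈ Finset.Ico u t, r τ • b τ) - a ⬝ᵥ ϑ =
      invForm A a (noiseSeq b η u t) +
        ∑ τ ∈ Finset.Ico u t, (b τ ⬝ᵥ θ τ - b τ ⬝ᵥ ϑ) * invForm A a (b τ) - invForm A a ϑ := by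
    rw [e1, e2]; simp only [sub_mul, Finset.sum_sub_distrib]; ring
  rw [e8]
  refine (abs_sub _ _).trans ?_
  refine (add_le_add (abs_add_le _ _) le_rfl).trans ?_
  nlinarith

/-- Sum of the confidence widths of the rounds in which `b ≠ 0`. -/
lemma sum_sqrt_invForm_le {u t : ℕ} (hb : ∀ τ, b τ ⬝ᵥ b τ ≤ 1) (h : u ≤ t) {k : ℕ}
    (hk : ((Finset.Ico u t).filter fun τ => b τ ≠ 0).card ≤ k) :
    ∑ τ ∈ Finset.Ico u t, √(invForm (gramSeq b u τ) (b τ) (b τ)) ≤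
      √(k * (2 * (Fintype.card ι * Real.log (1 + (t - u : ℕ))))) := by
  apply Real.le_sqrt_of_sq_le
  have e4 : ∑ τ ∈ Finset.Ico u t, √(invForm (gramSeq b u τ) (b τ) (b τ)) =
      ∑ τ ∈ (Finset.Ico u t).filter fun τ => b τ ≠ 0,
        √(invForm (gramSeq b u τ) (b τ) (b τ)) := by
    rw [Finset.sum_filter]
    refine Finset.sum_congr rfl fun τ _ => ?_
    by_cases h : b τ = 0 <;> simp [h, invForm_zero_left]
  rw [e4]
  refine sq_sum_le_card_mul_sum_sq.trans ?_
  refine mul_le_mul (by exact_mod_cast hk) ?_ (by positivity) (by positivity)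
  refine (Finset.sum_le_sum_of_subset_of_nonneg (Finset.filter_subset _ _)
          fun _ _ _ => sq_nonneg _).trans ?_
  refine le_trans (Finset.sum_le_sum fun τ _ => ?_) (sum_invForm_le hb h)
  rw [Real.sq_sqrt (invForm_self_nonneg (posDef_gramSeq b u τ) _)]

end ConfidenceWidth

/-! ## Exponential supermartingales -/

section Supermartingale

variable {Ω : Type u} [mΩ : MeasurableSpace Ω] {P : Type v} [MeasurableSpace P]
  {μ : Measure Ω} [IsProbabilityMeasure μ] {G : Filtration ℕ mΩ} {T : ℕ} {f : ℕ → P → ℝ}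
  {pol : ℕ → Ω → P} {rew : ℕ → Ω → ℝ}

/-- The noise of the reward of round `t`. -/
def rewNoise (f : ℕ → P → ℝ) (pol : ℕ → Ω → P) (rew : ℕ → Ω → ℝ) (t : ℕ) (ω : Ω) : ℝ :=
  rew t ω - f t (pol t ω)

lemma abs_rewNoise_le (hI : IsInteraction μ G T f pol rew)
    (hf : ∀ t ∈ Finset.Icc 1 T, ∀ p, f t p ∈ Set.Icc (0 : ℝ) 1) {t : ℕ}
    (ht : t ∈ Finset.Icc 1 T) (ω : Ω) : |rewNoise f pol rew t ω| ≤ 1 := by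
  have h1 := hI.rew_mem t ht ω
  have h2 := hf t ht (pol t ω)
  rw [rewNoise, abs_le]
  constructor <;> linarith [h1.1, h1.2, h2.1, h2.2]

lemma integrable_of_measurable_of_abs_le {W : Ω → ℝ} (hW : Measurable W) {C : ℝ}
    (hC : ∀ ω, |W ω| ≤ C) : Integrable W μ :=
  Integrable.of_bound hW.aestronglyMeasurable C (Filter.Eventually.of_forall hC)

/-- The noise is a martingale difference: a bounded `G t`-measurable weight can be pulled out of the
conditional expectation of the reward. -/
lemma integral_mul_rewNoise_eq_zero (hI : IsInteraction μ G T f pol rew)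
    (hf : ∀ t ∈ Finset.Icc 1 T, ∀ p, f t p ∈ Set.Icc (0 : ℝ) 1)
    (hfm : ∀ t ∈ Finset.Icc 1 T, Measurable[G t] fun ω => f t (pol t ω)) {t : ℕ}
    (ht : t ∈ Finset.Icc 1 T) {W : Ω → ℝ} (hW : Measurable[G t] W) {C : ℝ}
    (hC : ∀ ω, |W ω| ≤ C) : ∫ ω, W ω * rewNoise f pol rew t ω ∂μ = 0 := by
  have hG := G.le t
  have hr : Measurable (rew t) := (hI.rew_meas t ht).mono (G.le _) le_rfl
  have hrb : ∀ ω, |rew t ω| ≤ 1 := fun ω => by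
    have := hI.rew_mem t ht ω
    rw [abs_le]; constructor <;> linarith [this.1, this.2]
  have hfb : ∀ ω, |f t (pol t ω)| ≤ 1 := fun ω => by
    have := hf t ht (pol t ω)
    rw [abs_le]; constructor <;> linarith [this.1, this.2]
  have hri : Integrable (rew t) μ := integrable_of_measurable_of_abs_le hr hrb
  have hbd : ∀ {g : Ω → ℝ}, (∀ ω, |g ω| ≤ 1) → ∀ ω, |W ω * g ω| ≤ C := fun hg ω => by
    rw [abs_mul]
    exact (mul_le_of_le_one_right (abs_nonneg _) (hg ω)).trans (hC ω)
  have hWm : Measurable W := hW.mono hG le_rfl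
  have hWr : Integrable (fun ω => W ω * rew t ω) μ :=
    integrable_of_measurable_of_abs_le (hWm.mul hr) (hbd hrb)
  have hWf : Integrable (fun ω => W ω * f t (pol t ω)) μ :=
    integrable_of_measurable_of_abs_le (hWm.mul ((hfm t ht).mono hG le_rfl)) (hbd hfb)
  have h1 : μ[W * rew t | G t] =ᵐ[μ] W * μ[rew t | G t] :=
    condExp_stronglyMeasurable_mul_of_bound hG hW.stronglyMeasurable hri C
      (Filter.Eventually.of_forall hC)
  have h2 : ∫ ω, W ω * rew t ω ∂μ = ∫ ω, W ω * f t (pol t ω) ∂μ := by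
    calc _ = ∫ ω, (μ[W * rew t | G t]) ω ∂μ := (integral_condExp hG).symm
      _ = _ := by
        refine integral_congr_ae ?_
        filter_upwards [h1, hI.rew_mean t ht] with ω ha hb
        rw [ha, Pi.mul_apply, hb]
  simp only [rewNoise, mul_sub]
  rw [integral_sub hWr hWf, h2, sub_self]

/-- Convexity of the exponential on the segment from −y to y; the bound is affine in x, so the noise
can be averaged out. -/
lemma exp_mul_le_cosh_add {x y : ℝ} (hx : |x| ≤ 1) :
    Real.exp (y * x) ≤ Real.cosh y + Real.sinh y * x := by
  rw [abs_le] at hx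
  have h := convexOn_exp.2 (Set.mem_univ y) (Set.mem_univ (-y))
    (by linarith : 0 ≤ (1 + x) / 2) (by linarith : 0 ≤ (1 - x) / 2) (by ring)
  simp only [smul_eq_mul] at h
  rw [Real.cosh_eq, Real.sinh_eq]
  calc _ = Real.exp ((1 + x) / 2 * y + (1 - x) / 2 * -y) := by congr 1; ring
    _ ≤ _ := h
    _ = _ := by ring

/-- One step of the supermartingale. After the affine bound, the sinh term has mean zero and cosh y
≤ exp(y²/2) absorbs the rest. -/
lemma integral_mul_exp_noise_le (hI : IsInteraction μ G T f pol rew)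
    (hf : ∀ t ∈ Finset.Icc 1 T, ∀ p, f t p ∈ Set.Icc (0 : ℝ) 1)
    (hfm : ∀ t ∈ Finset.Icc 1 T, Measurable[G t] fun ω => f t (pol t ω)) {t : ℕ}
    (ht : t ∈ Finset.Icc 1 T) {Z y : Ω → ℝ} (hZ : Measurable[G t] Z) (hy : Measurable[G t] y)
    {C D : ℝ} (hZ0 : ∀ ω, 0 ≤ Z ω) (hC : ∀ ω, Z ω ≤ C) (hD : ∀ ω, |y ω| ≤ D) :
    ∫ ω, Z ω * Real.exp (y ω * rewNoise f pol rew t ω - y ω ^ 2 / 2) ∂μ ≤ ∫ ω, Z ω ∂μ := by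
  have hG := G.le t
  have hym : Measurable y := hy.mono hG le_rfl
  have hZm : Measurable Z := hZ.mono hG le_rfl
  have hηm : Measurable (rewNoise f pol rew t) :=
    ((hI.rew_meas t ht).mono (G.le _) le_rfl).sub ((hfm t ht).mono hG le_rfl)
  have hη := abs_rewNoise_le hI hf ht
  set W : Ω → ℝ := fun ω => Z ω * Real.exp (-(y ω ^ 2 / 2)) * Real.sinh (y ω) with hWdef
  have hW : Measurable[G t] W :=
    (hZ.mul (Real.measurable_exp.comp ((hy.pow_const 2).div_const 2).neg)).mul
      (Real.measurable_sinh.comp hy)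
  have hexp : ∀ ω, Real.exp (-(y ω ^ 2 / 2)) * Real.cosh (y ω) ≤ 1 := fun ω => by
    rw [Real.exp_neg, inv_mul_le_iff₀ (Real.exp_pos _), mul_one]
    exact Real.cosh_le_exp_half_sq _
  have hsinh : ∀ x : ℝ, |Real.sinh x| ≤ Real.cosh x := fun x => by
    rw [abs_le, Real.cosh_eq, Real.sinh_eq]
    constructor <;> linarith [Real.exp_pos x, Real.exp_pos (-x)]
  have hWC : ∀ ω, |W ω| ≤ C := fun ω => by
    rw [hWdef]
    simp only
    rw [abs_mul, abs_mul, abs_of_nonneg (hZ0 ω), abs_of_pos (Real.exp_pos _), mul_assoc]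
    refine (mul_le_of_le_one_right (hZ0 ω) ?_).trans (hC ω)
    exact (mul_le_mul_of_nonneg_left (hsinh _) (Real.exp_pos _).le).trans (hexp ω)
  have hZi : Integrable Z μ :=
    integrable_of_measurable_of_abs_le hZm (C := C) fun ω => by rw [abs_of_nonneg (hZ0 ω)]; exact hC ω
  have hWi : Integrable (fun ω => W ω * rewNoise f pol rew t ω) μ :=
    integrable_of_measurable_of_abs_le (C := C) ((hW.mono hG le_rfl).mul hηm) fun ω => by
      rw [abs_mul]
      exact (mul_le_of_le_one_right (abs_nonneg _) (hη ω)).trans (hWC ω)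
  have hpt : ∀ ω, Z ω * Real.exp (y ω * rewNoise f pol rew t ω - y ω ^ 2 / 2) ≤
      Z ω + W ω * rewNoise f pol rew t ω := fun ω => by
    rw [sub_eq_add_neg, Real.exp_add]
    have h1 := exp_mul_le_cosh_add (y := y ω) (hη ω)
    have h2 := hexp ω
    have h3 := Real.exp_pos (-(y ω ^ 2 / 2))
    rw [hWdef]
    simp only
    have h4 := mul_le_mul_of_nonneg_right h1 h3.le
    have h5 : Real.exp (y ω * rewNoise f pol rew t ω) * Real.exp (-(y ω ^ 2 / 2)) ≤
        1 + Real.exp (-(y ω ^ 2 / 2)) * Real.sinh (y ω) * rewNoise f pol rew t ω := by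
      nlinarith
    have := mul_le_mul_of_nonneg_left h5 (hZ0 ω)
    nlinarith
  have hLi : Integrable
      (fun ω => Z ω * Real.exp (y ω * rewNoise f pol rew t ω - y ω ^ 2 / 2)) μ := by
    refine integrable_of_measurable_of_abs_le (C := C * Real.exp D) (hZm.mul
      (Real.measurable_exp.comp ((hym.mul hηm).sub ((hym.pow_const 2).div_const 2)))) fun ω => ?_
    rw [abs_mul, abs_of_nonneg (hZ0 ω), abs_of_pos (Real.exp_pos _)]
    refine mul_le_mul (hC ω) (Real.exp_le_exp.2 ?_) (Real.exp_pos _).le ((hZ0 ω).trans (hC ω))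
    have h1 : y ω * rewNoise f pol rew t ω ≤ |y ω| * 1 := by
      refine (le_abs_self _).trans ?_
      rw [abs_mul]
      exact mul_le_mul_of_nonneg_left (hη ω) (abs_nonneg _)
    nlinarith [hD ω, sq_nonneg (y ω)]
  calc _ ≤ ∫ ω, (Z ω + W ω * rewNoise f pol rew t ω) ∂μ :=
        integral_mono hLi (hZi.add hWi) hpt
    _ = _ := by
        rw [integral_add hZi hWi, integral_mul_rewNoise_eq_zero hI hf hfm ht hW hWC, add_zero]

/-- The exponential process of a predictable bounded weight. -/
noncomputable def expNoise (f : ℕ → P → ℝ) (pol : ℕ → Ω → P) (rew : ℕ → Ω → ℝ)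
    (y : ℕ → Ω → ℝ) (s e : ℕ) (ω : Ω) : ℝ :=
  ∑ t ∈ Finset.Ico s e, (y t ω * rewNoise f pol rew t ω - y t ω ^ 2 / 2)

lemma measurable_rewNoise (hI : IsInteraction μ G T f pol rew)
    (hfm : ∀ t ∈ Finset.Icc 1 T, Measurable[G t] fun ω => f t (pol t ω)) {t : ℕ}
    (ht : t ∈ Finset.Icc 1 T) : Measurable[G (t + 1)] (rewNoise f pol rew t) :=
  (hI.rew_meas t ht).sub ((hfm t ht).mono (G.mono t.le_succ) le_rfl)

lemma measurable_expNoise (hI : IsInteraction μ G T f pol rew)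
    (hfm : ∀ t ∈ Finset.Icc 1 T, Measurable[G t] fun ω => f t (pol t ω)) {y : ℕ → Ω → ℝ}
    {s e : ℕ} (hs : 1 ≤ s) (he : e ≤ T + 1) (hy : ∀ t ∈ Finset.Ico s e, Measurable[G t] (y t)) :
    Measurable[G e] (expNoise f pol rew y s e) := by
  refine Finset.measurable_fun_sum _ fun t ht => ?_
  have ht' := Finset.mem_Ico.1 ht
  have h1 : Measurable[G e] (y t) := (hy t ht).mono (G.mono ht'.2.le) le_rfl
  have h2 : Measurable[G e] (rewNoise f pol rew t) :=
    (measurable_rewNoise hI hfm (by simp; omega)).mono (G.mono (by omega)) le_rfl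
  exact (h1.mul h2).sub ((h1.pow_const 2).div_const 2)

lemma integral_exp_expNoise_le (hI : IsInteraction μ G T f pol rew)
    (hf : ∀ t ∈ Finset.Icc 1 T, ∀ p, f t p ∈ Set.Icc (0 : ℝ) 1)
    (hfm : ∀ t ∈ Finset.Icc 1 T, Measurable[G t] fun ω => f t (pol t ω)) {y : ℕ → Ω → ℝ}
    {s : ℕ} (hs : 1 ≤ s) {C : ℝ} (e : ℕ) (he : e ≤ T + 1)
    (hy : ∀ t ∈ Finset.Ico s e, Measurable[G t] (y t))
    (hC : ∀ t ∈ Finset.Ico s e, ∀ ω, |y t ω| ≤ C) :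
    ∫ ω, Real.exp (expNoise f pol rew y s e ω) ∂μ ≤ 1 := by
  induction e with
  | zero => simp [expNoise]
  | succ e ih =>
    rcases le_or_gt s e with hse | hse
    · have hsub : ∀ t ∈ Finset.Ico s e, t ∈ Finset.Ico s (e + 1) := fun t ht => by
        simp at ht ⊢; omega
      have ih' := ih (by omega) (fun t ht => hy t (hsub t ht)) (fun t ht => hC t (hsub t ht))
      have hee : e ∈ Finset.Ico s (e + 1) := by simp [hse]
      refine le_trans ?_ ih'
      have hb : ∀ ω, Real.exp (expNoise f pol rew y s e ω) ≤
          Real.exp (∑ t ∈ Finset.Ico s e, C) := fun ω => by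
        refine Real.exp_le_exp.2 (Finset.sum_le_sum fun t ht => ?_)
        have ht' := Finset.mem_Ico.1 ht
        have h1 : y t ω * rewNoise f pol rew t ω ≤ |y t ω| * 1 := by
          refine (le_abs_self _).trans ?_
          rw [abs_mul]
          exact mul_le_mul_of_nonneg_left (abs_rewNoise_le hI hf (by simp; omega) ω) (abs_nonneg _)
        nlinarith [hC t (hsub t ht) ω, sq_nonneg (y t ω)]
      have := integral_mul_exp_noise_le hI hf hfm (t := e) (by simp; omega)
        (Real.measurable_exp.comp (measurable_expNoise hI hfm hs (by omega : e ≤ T + 1)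
          fun t ht => hy t (hsub t ht))) (hy e hee) (fun ω => (Real.exp_pos _).le) hb (hC e hee)
      refine le_trans (le_of_eq ?_) this
      refine integral_congr_ae (Filter.Eventually.of_forall fun ω => ?_)
      simp only [expNoise, Function.comp]
      rw [Finset.sum_Ico_succ_top hse, Real.exp_add]
    · have : expNoise f pol rew y s (e + 1) = fun _ => 0 := by
        funext ω; simp [expNoise, Finset.Ico_eq_empty_of_le (show e + 1 ≤ s by omega)]
      simp [this]

/-- Tail bound for the exponential process. -/
lemma measure_le_expNoise (hI : IsInteraction μ G T f pol rew)
    (hf : ∀ t ∈ Finset.Icc 1 T, ∀ p, f t p ∈ Set.Icc (0 : ℝ) 1)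
    (hfm : ∀ t ∈ Finset.Icc 1 T, Measurable[G t] fun ω => f t (pol t ω)) {y : ℕ → Ω → ℝ}
    {s e : ℕ} (hs : 1 ≤ s) {C : ℝ} (he : e ≤ T + 1)
    (hy : ∀ t ∈ Finset.Ico s e, Measurable[G t] (y t))
    (hC : ∀ t ∈ Finset.Ico s e, ∀ ω, |y t ω| ≤ C) (z : ℝ) :
    μ {ω | z ≤ expNoise f pol rew y s e ω} ≤ ENNReal.ofReal (Real.exp (-z)) := by
  have h1 := integral_exp_expNoise_le hI hf hfm hs e he hy hC
  have hm : Measurable (fun ω => Real.exp (expNoise f pol rew y s e ω)) :=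
    (Real.measurable_exp.comp (measurable_expNoise hI hfm hs he hy)).mono (G.le _) le_rfl
  have hb : ∀ ω, Real.exp (expNoise f pol rew y s e ω) ≤
      Real.exp (∑ t ∈ Finset.Ico s e, C) := fun ω => by
    refine Real.exp_le_exp.2 (Finset.sum_le_sum fun t ht => ?_)
    have ht' := Finset.mem_Ico.1 ht
    have h1 : y t ω * rewNoise f pol rew t ω ≤ |y t ω| * 1 := by
      refine (le_abs_self _).trans ?_
      rw [abs_mul]
      exact mul_le_mul_of_nonneg_left (abs_rewNoise_le hI hf (by simp; omega) ω) (abs_nonneg _)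
    nlinarith [hC t ht ω, sq_nonneg (y t ω)]
  have hi : Integrable (fun ω => Real.exp (expNoise f pol rew y s e ω)) μ :=
    integrable_of_measurable_of_abs_le hm fun ω => by
      rw [abs_of_pos (Real.exp_pos _)]; exact hb ω
  have h2 := mul_meas_ge_le_integral_of_nonneg
    (Filter.Eventually.of_forall fun ω => (Real.exp_pos (expNoise f pol rew y s e ω)).le) hi
    (Real.exp z)
  simp only [Real.exp_le_exp] at h2
  have h3 : μ.real {ω | z ≤ expNoise f pol rew y s e ω} ≤ Real.exp (-z) := by
    rw [Real.exp_neg, ← one_div, le_div_iff₀ (Real.exp_pos _), mul_comm]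
    linarith
  rw [← ENNReal.ofReal_toReal (measure_ne_top μ {ω | z ≤ expNoise f pol rew y s e ω})]
  exact ENNReal.ofReal_le_ofReal h3

end Supermartingale

/-! ### Concentration of the scheduling coins -/

section Coins

open Classical in
/-- Supermartingale of independent coins that are used on predictable events. -/
lemma lintegral_prod_coin_le {Ω : Type u} [mΩ : MeasurableSpace Ω] {P : Type v}
    [MeasurableSpace P] {alg : BaseAlg P} {δ : ℝ} {ρ : ℕ → ℝ} {μ : Measure Ω}
    [IsProbabilityMeasure μ] {G : Filtration ℕ mΩ} {T : ℕ} {f : ℕ → P → ℝ}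
    {coin : ℕ → ℕ → Ω → unitInterval} {pol : ℕ → Ω → P} {rew : ℕ → Ω → ℝ}
    (hM : IsMasterRun alg δ ρ μ G T f coin pol rew) (m : ℕ) {φ : unitInterval → ENNReal}
    (hφ : Measurable φ) (hφ1 : ∫⁻ c, φ c ≤ 1) {cand : ℕ → Set Ω}
    (hcand : ∀ t ∈ Finset.Ico 1 T, MeasurableSet[G t] (cand (t + 1))) (e : ℕ) (he : e ≤ T) :
    ∫⁻ ω, ∏ s ∈ Finset.Ico 2 (e + 1), (if ω ∈ cand s then φ (coin s m ω) else 1) ∂μ ≤ 1 := by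
  -- The product starts at round 2: freshness relates the coins of a round to the previous round, so
  -- it says nothing about round 1.
  induction e with
  | zero => simp
  | succ e ih =>
    rcases Nat.eq_zero_or_pos e with rfl | hepos
    · simp
    have he1 : e ∈ Finset.Ico 1 T := by simp; omega
    have ih := ih (by omega)
    simp only [Finset.prod_Ico_succ_top (show 2 ≤ e + 1 by omega)]
    set Z : Ω → ENNReal := fun ω =>
      ∏ s ∈ Finset.Ico 2 (e + 1), (if ω ∈ cand s then φ (coin s m ω) else 1) with hZ
    have hZm : Measurable[G e] Z := by
      refine Finset.measurable_fun_prod _ fun s hs => ?_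
      have hs' := Finset.mem_Ico.1 hs
      obtain ⟨t, rfl⟩ : ∃ t, s = t + 1 := ⟨s - 1, by omega⟩
      refine Measurable.ite (G.mono (by omega : t ≤ e) _ (hcand t (by simp; omega))) ?_
        measurable_const
      exact hφ.comp ((hM.coin_meas (t + 1) (by simp; omega) m).mono (G.mono (by omega)) le_rfl)
    have hre : Measurable (rew e) := (hM.interaction.rew_meas e (by simp; omega)).mono (G.le _) le_rfl
    have hcm : Measurable (coin (e + 1) m) :=
      (hM.coin_meas (e + 1) (by simp; omega) m).mono (G.le _) le_rfl
    have hce := hcand e he1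
    -- The new coin matters only on the candidate event, which is decided one round earlier. There
    -- the past factor is independent of the coin; off it the factor is 1.
    set Z1 : Ω → ENNReal := (cand (e + 1)).indicator Z
    set Z2 : Ω → ENNReal := (cand (e + 1))ᶜ.indicator Z
    have hZ1 : Measurable[G e] Z1 := hZm.indicator hce
    have hZ1' : Measurable Z1 := hZ1.mono (G.le _) le_rfl
    have hZ2' : Measurable Z2 := (hZm.indicator hce.compl).mono (G.le _) le_rfl
    have hsplit : ∀ ω, Z ω * (if ω ∈ cand (e + 1) then φ (coin (e + 1) m ω) else 1) =
        Z1 ω * φ (coin (e + 1) m ω) + Z2 ω := fun ω => by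
      by_cases h : ω ∈ cand (e + 1) <;> simp [Z1, Z2, h]
    have hind : ∫⁻ ω, Z1 ω * φ (coin (e + 1) m ω) ∂μ =
        (∫⁻ ω, Z1 ω ∂μ) * ∫⁻ ω, φ (coin (e + 1) m ω) ∂μ := by
      refine lintegral_mul_eq_lintegral_mul_lintegral_of_independent_measurableSpace
        (Mf := G e ⊔ MeasurableSpace.comap (rew e) inferInstance) (Mg := ⨆ m, MeasurableSpace.comap (coin (e + 1) m) inferInstance)
        (sup_le (G.le _) hre.comap_le) (iSup_le fun k => ?_) (hM.coin_fresh e he1).symm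
        (hZ1.mono le_sup_left le_rfl) ?_
      · exact ((hM.coin_meas (e + 1) (by simp; omega) k).mono (G.le _) le_rfl).comap_le
      · exact hφ.comp ((comap_measurable (coin (e + 1) m)).mono
          (le_iSup (fun k => MeasurableSpace.comap (coin (e + 1) k) inferInstance) m) le_rfl)
    have hlaw : ∫⁻ ω, φ (coin (e + 1) m ω) ∂μ ≤ 1 := by
      rw [← lintegral_map hφ hcm, hM.coin_law (e + 1) (by simp; omega) m]
      exact hφ1
    calc _ = ∫⁻ ω, (Z1 ω * φ (coin (e + 1) m ω) + Z2 ω) ∂μ :=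
          lintegral_congr hsplit
      _ = ∫⁻ ω, Z1 ω * φ (coin (e + 1) m ω) ∂μ + ∫⁻ ω, Z2 ω ∂μ := lintegral_add_right _ hZ2'
      _ ≤ ∫⁻ ω, Z1 ω ∂μ + ∫⁻ ω, Z2 ω ∂μ := by
          rw [hind]; gcongr; exact mul_le_of_le_one_right zero_le hlaw
      _ = ∫⁻ ω, Z ω ∂μ := by
          rw [← lintegral_add_right _ hZ2']
          congr 1; funext ω
          by_cases h : ω ∈ cand (e + 1) <;> simp [Z1, Z2, h]
      _ ≤ 1 := ih

variable {Ω : Type u} [mΩ : MeasurableSpace Ω] {P : Type v} [MeasurableSpace P]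
  {alg : BaseAlg P} {δ : ℝ} {ρ : ℕ → ℝ} {μ : Measure Ω} [IsProbabilityMeasure μ]
  {G : Filtration ℕ mΩ} {T : ℕ} {f : ℕ → P → ℝ} {coin : ℕ → ℕ → Ω → unitInterval}
  {pol : ℕ → Ω → P} {rew : ℕ → Ω → ℝ}

lemma volume_coin_le {q : ℝ} (h0 : 0 ≤ q) (h1 : q ≤ 1) :
    volume {c : unitInterval | (c : ℝ) ≤ q} = ENNReal.ofReal q := by
  have : {c : unitInterval | (c : ℝ) ≤ q} = Set.Iic ⟨q, h0, h1⟩ := by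
    ext c; simp [← Subtype.coe_le_coe]
  rw [this, unitInterval.volume_Iic]

lemma measurableSet_coin_le (q : ℝ) : MeasurableSet {c : unitInterval | (c : ℝ) ≤ q} :=
  measurableSet_le measurable_subtype_coe measurable_const

lemma measure_le_of_lintegral_exp_le {X : Ω → ENNReal} (hX : Measurable X)
    (h : ∫⁻ ω, X ω ∂μ ≤ 1) {E : Set Ω} (z : ℝ)
    (hE : ∀ ω ∈ E, ENNReal.ofReal (Real.exp z) ≤ X ω) :
    μ E ≤ ENNReal.ofReal (Real.exp (-z)) := by
  have h1 := mul_meas_ge_le_lintegral (μ := μ) hX (ENNReal.ofReal (Real.exp z))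
  have h2 : ENNReal.ofReal (Real.exp z) * μ E ≤ 1 :=
    (mul_le_mul_right (measure_mono hE) _).trans (h1.trans h)
  rw [Real.exp_neg, ENNReal.ofReal_inv_of_pos (Real.exp_pos _)]
  rw [mul_comm] at h2
  exact ENNReal.le_inv_iff_mul_le.2 h2

open Classical in
/-- Chernoff bound for the number of successful coins. -/
lemma measure_card_coin_le (hM : IsMasterRun alg δ ρ μ G T f coin pol rew) (m : ℕ) {q : ℝ}
    (h0 : 0 ≤ q) (h1 : q ≤ 1) {D : Finset ℕ} (hD : D ⊆ Finset.Icc 2 T) (z : ℝ) :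
    μ {ω | 2 * q * D.card + z ≤ ((D.filter fun s => (coin s m ω : ℝ) ≤ q).card : ℝ)} ≤
      ENNReal.ofReal (Real.exp (-z)) := by
  -- Chernoff factor exp(1[success] − 2q). Its mean e^{−2q}(1 + q(e − 1)) is at most 1 because e − 1
  -- ≤ 2.
  set φ : unitInterval → ENNReal := fun c =>
    ENNReal.ofReal (Real.exp ((if (c : ℝ) ≤ q then 1 else 0) - 2 * q)) with hφ
  have hφm : Measurable φ := ENNReal.measurable_ofReal.comp (Real.measurable_exp.comp
    ((Measurable.ite (measurableSet_coin_le q) measurable_const measurable_const).sub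
      measurable_const))
  have hφ1 : ∫⁻ c, φ c ≤ 1 := by
    have e1 : ∀ c, φ c = ENNReal.ofReal (Real.exp (-(2 * q))) * (1 +
        {c : unitInterval | (c : ℝ) ≤ q}.indicator
          (fun _ => ENNReal.ofReal (Real.exp 1 - 1)) c) := fun c => by
      by_cases h : (c : ℝ) ≤ q
      · have he : (0 : ℝ) ≤ Real.exp 1 - 1 := by linarith [Real.add_one_le_exp (1 : ℝ)]
        have : (1 : ENNReal) + ENNReal.ofReal (Real.exp 1 - 1) = ENNReal.ofReal (Real.exp 1) := by
          rw [← ENNReal.ofReal_one, ← ENNReal.ofReal_add zero_le_one he]; congr 1; ring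
        simp only [hφ, h, if_true, Set.indicator, Set.mem_ofPred_eq, this]
        rw [← ENNReal.ofReal_mul (Real.exp_pos _).le, ← Real.exp_add]
        congr 2; ring
      · simp [hφ, h, Set.indicator]
    simp only [e1]
    have hm1 : Measurable fun c : unitInterval => (1 : ENNReal) +
        {c : unitInterval | (c : ℝ) ≤ q}.indicator (fun _ => ENNReal.ofReal (Real.exp 1 - 1)) c :=
      (measurable_const.indicator (measurableSet_coin_le q)).const_add 1
    rw [lintegral_const_mul _ hm1, lintegral_add_left measurable_const,
      lintegral_indicator_const (measurableSet_coin_le q), volume_coin_le h0 h1]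
    have he : (0 : ℝ) ≤ Real.exp 1 - 1 := by linarith [Real.add_one_le_exp (1 : ℝ)]
    rw [← ENNReal.ofReal_mul he]
    simp only [lintegral_const, measure_univ, mul_one]
    rw [← ENNReal.ofReal_one, ← ENNReal.ofReal_add zero_le_one (by positivity),
      ← ENNReal.ofReal_mul (Real.exp_pos _).le]
    refine ENNReal.ofReal_le_ofReal ?_
    rw [Real.exp_neg, inv_mul_le_iff₀ (Real.exp_pos _), mul_one]
    have h3 : Real.exp 1 - 1 ≤ 2 := by linarith [Real.exp_one_lt_d9]
    have := Real.add_one_le_exp (2 * q)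
    nlinarith
  set cand : ℕ → Set Ω := fun s => if s ∈ D then Set.univ else ∅ with hc
  have hcs : ∀ s, MeasurableSet (cand s) := fun s => by by_cases h : s ∈ D <;> simp [hc, h]
  have hmem : ∀ s ω, ω ∈ cand s ↔ s ∈ D := fun s ω => by by_cases h : s ∈ D <;> simp [hc, h]
  have hmeas : Measurable fun ω => ∏ s ∈ Finset.Ico 2 (T + 1),
      (if ω ∈ cand s then φ (coin s m ω) else 1) := by
    refine Finset.measurable_fun_prod _ fun s hs => ?_
    refine Measurable.ite (hcs s) ?_ measurable_const
    refine hφm.comp ((hM.coin_meas s ?_ m).mono (G.le _) le_rfl)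
    simp at hs ⊢; omega
  refine measure_le_of_lintegral_exp_le hmeas
    (lintegral_prod_coin_le hM m hφm hφ1 (cand := cand)
      (fun t _ => by by_cases h : t + 1 ∈ D <;> simp [hc, h]) T le_rfl) z fun ω hω => ?_
  have hDT : (Finset.Ico 2 (T + 1)).filter (· ∈ D) = D := by
    ext s; simp only [Finset.mem_filter, Finset.mem_Ico]
    refine ⟨fun h => h.2, fun h => ⟨?_, h⟩⟩
    have := hD h; simp at this; omega
  have e2 : ∏ s ∈ Finset.Ico 2 (T + 1), (if ω ∈ cand s then φ (coin s m ω) else 1) =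
      ENNReal.ofReal (Real.exp ((D.filter fun s => (coin s m ω : ℝ) ≤ q).card - 2 * q * D.card)) := by
    simp only [hmem]
    rw [← Finset.prod_filter, hDT, ← ENNReal.ofReal_prod_of_nonneg fun _ _ => (Real.exp_pos _).le,
      ← Real.exp_sum]
    congr 2
    rw [Finset.sum_sub_distrib, Finset.card_filter]
    push_cast
    simp; ring
  rw [e2]
  refine ENNReal.ofReal_le_ofReal (Real.exp_le_exp.2 ?_)
  have := hω
  simp only [Set.mem_ofPred_eq] at this
  linarith

open Classical in
/-- Predictable candidates are hit by their coins before too many of them have accumulated. -/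
lemma measure_forall_miss_le (hM : IsMasterRun alg δ ρ μ G T f coin pol rew) (m : ℕ) {q : ℝ}
    (h0 : 0 ≤ q) (h1 : q ≤ 1) {D : Finset ℕ} (hD : D ⊆ Finset.Icc 2 T) {cand : ℕ → Set Ω}
    (hcand : ∀ t ∈ Finset.Ico 1 T, t + 1 ∈ D → MeasurableSet[G t] (cand (t + 1))) (z : ℝ) :
    μ {ω | (∀ s ∈ D, ω ∈ cand s → q < (coin s m ω : ℝ)) ∧
        z ≤ q * ((D.filter fun s => ω ∈ cand s).card : ℝ)} ≤
      ENNReal.ofReal (Real.exp (-z)) := by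
  -- The factor e^q on a miss and 0 on a hit has mean e^q(1 − q) ≤ 1; along a path of misses only,
  -- the product is e^{q·#candidates}.
  set φ : unitInterval → ENNReal :=
    {c : unitInterval | (c : ℝ) ≤ q}ᶜ.indicator (fun _ => ENNReal.ofReal (Real.exp q)) with hφ
  have hφm : Measurable φ := measurable_const.indicator (measurableSet_coin_le q).compl
  have hφ1 : ∫⁻ c, φ c ≤ 1 := by
    rw [hφ, lintegral_indicator_const (measurableSet_coin_le q).compl,
      prob_compl_eq_one_sub (measurableSet_coin_le q), volume_coin_le h0 h1, ← ENNReal.ofReal_one,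
      ← ENNReal.ofReal_sub _ h0, ← ENNReal.ofReal_mul (Real.exp_pos _).le]
    refine ENNReal.ofReal_le_ofReal ?_
    have := Real.add_one_le_exp (-q)
    rw [Real.exp_neg] at this
    calc Real.exp q * (1 - q) ≤ Real.exp q * (Real.exp q)⁻¹ :=
          mul_le_mul_of_nonneg_left (by linarith) (Real.exp_pos _).le
      _ = 1 := mul_inv_cancel₀ (Real.exp_pos _).ne'
  set cand' : ℕ → Set Ω := fun s => if s ∈ D then cand s else ∅ with hc'
  have hcand' : ∀ t ∈ Finset.Ico 1 T, MeasurableSet[G t] (cand' (t + 1)) := fun t ht => by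
    by_cases h : t + 1 ∈ D
    · simpa [hc', h] using hcand t ht h
    · simp [hc', h]
  have hmeas : Measurable fun ω => ∏ s ∈ Finset.Ico 2 (T + 1),
      (if ω ∈ cand' s then φ (coin s m ω) else 1) := by
    refine Finset.measurable_fun_prod _ fun s hs => ?_
    have hs' := Finset.mem_Ico.1 hs
    obtain ⟨t, rfl⟩ : ∃ t, s = t + 1 := ⟨s - 1, by omega⟩
    refine Measurable.ite (G.le t _ (hcand' t (by simp; omega))) ?_ measurable_const
    exact hφm.comp ((hM.coin_meas (t + 1) (by simp; omega) m).mono (G.le _) le_rfl)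
  refine measure_le_of_lintegral_exp_le hmeas
    (lintegral_prod_coin_le hM m hφm hφ1 hcand' T le_rfl) z fun ω hω => ?_
  obtain ⟨hmiss, hcard⟩ := hω
  have hDT : (Finset.Ico 2 (T + 1)).filter (fun s => ω ∈ cand' s) =
      D.filter fun s => ω ∈ cand s := by
    ext s; simp only [Finset.mem_filter, Finset.mem_Ico, hc']
    by_cases h : s ∈ D
    · have := hD h; simp at this; simp [h]; omega
    · simp [h]
  rw [← Finset.prod_filter, hDT, Finset.prod_congr rfl (g := fun _ => ENNReal.ofReal (Real.exp q)),
    Finset.prod_const, ← ENNReal.ofReal_pow (Real.exp_pos _).le, ← Real.exp_nat_mul]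
  · exact ENNReal.ofReal_le_ofReal (Real.exp_le_exp.2 (by linarith))
  · intro s hs
    have hs' := Finset.mem_filter.1 hs
    have := hmiss s hs'.1 hs'.2
    simp [hφ, this]

/-- Union bound over at most `T` events, each of probability at most `(δ/T)^{c+1}`. -/
lemma measure_exists_le_exp {ι : Type*} {s : Finset ι} {L : ℝ} (hs : (s.card : ℝ) ≤ Real.exp L)
    {E : ι → Set Ω} {c : ℝ}
    (hE : ∀ i ∈ s, μ (E i) ≤ ENNReal.ofReal (Real.exp (-((c + 1) * L)))) :
    μ {ω | ∃ i ∈ s, ω ∈ E i} ≤ ENNReal.ofReal (Real.exp (-(c * L))) := by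
  have h1 : {ω | ∃ i ∈ s, ω ∈ E i} = ⋃ i ∈ s, E i := by ext; simp
  rw [h1]
  refine (measure_biUnion_finset_le _ _).trans ((Finset.sum_le_sum hE).trans ?_)
  rw [Finset.sum_const, nsmul_eq_mul, ← ENNReal.ofReal_natCast,
    ← ENNReal.ofReal_mul (by positivity)]
  refine ENNReal.ofReal_le_ofReal ?_
  calc _ ≤ Real.exp L * Real.exp (-((c + 1) * L)) :=
        mul_le_mul_of_nonneg_right hs (Real.exp_pos _).le
    _ = _ := by rw [← Real.exp_add]; congr 1; ring

end Coins

/-! ## OFUL on a selected set of rounds -/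

section MatrixMeasurability

open Matrix

variable {Ω : Type*} {m : MeasurableSpace Ω} {ι : Type*} [Fintype ι] [DecidableEq ι]

lemma measurable_inv_apply {M : Ω → Matrix ι ι ℝ} (hM : ∀ i j, Measurable fun ω => M ω i j)
    (i j : ι) : Measurable fun ω => (M ω)⁻¹ i j := by
  have hM' : Measurable fun ω => (fun i j => M ω i j : ι → ι → ℝ) :=
    measurable_pi_iff.2 fun i => measurable_pi_iff.2 fun j => hM i j
  have h1 : Continuous fun N : ι → ι → ℝ => (Matrix.of N).det :=
    Continuous.matrix_det continuous_id
  have h2 : Continuous fun N : ι → ι → ℝ => (Matrix.of N).adjugate i j :=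
    (Continuous.matrix_adjugate continuous_id).matrix_elem i j
  have e : (fun ω => (M ω)⁻¹ i j) = fun ω => ((M ω).det)⁻¹ * (M ω).adjugate i j := by
    funext ω
    rw [inv_def, Matrix.smul_apply, Ring.inverse_eq_inv', smul_eq_mul]
  rw [e]
  exact (h1.measurable.comp hM').inv.mul (h2.measurable.comp hM')

lemma measurable_invForm {M : Ω → Matrix ι ι ℝ} {x y : Ω → ι → ℝ}
    (hM : ∀ i j, Measurable fun ω => M ω i j) (hx : ∀ i, Measurable fun ω => x ω i)
    (hy : ∀ i, Measurable fun ω => y ω i) : Measurable fun ω => invForm (M ω) (x ω) (y ω) := by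
  simp only [invForm, dotProduct, mulVec]
  exact Finset.measurable_fun_sum _ fun i _ => (hx i).mul
    (Finset.measurable_fun_sum _ fun j _ => (measurable_inv_apply hM i j).mul (hy j))

lemma measurable_gramSeq {b : Ω → ℕ → ι → ℝ} {s t : ℕ}
    (hb : ∀ τ ∈ Finset.Ico s t, ∀ i, Measurable fun ω => b ω τ i) (i j : ι) :
    Measurable fun ω => gramSeq (b ω) s t i j := by
  simp only [gramSeq, Matrix.add_apply, Matrix.sum_apply, vecMulVec_apply]
  exact (Finset.measurable_fun_sum _ fun τ hτ => (hb τ hτ i).mul (hb τ hτ j)).const_add _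

lemma measurable_noiseSeq {b : Ω → ℕ → ι → ℝ} {η : Ω → ℕ → ℝ} {s t : ℕ}
    (hb : ∀ τ ∈ Finset.Ico s t, ∀ i, Measurable fun ω => b ω τ i)
    (hη : ∀ τ ∈ Finset.Ico s t, Measurable fun ω => η ω τ) (i : ι) :
    Measurable fun ω => noiseSeq (b ω) (η ω) s t i := by
  simp only [noiseSeq, Finset.sum_apply, Pi.smul_apply, smul_eq_mul]
  exact Finset.measurable_fun_sum _ fun τ hτ => (hη τ hτ).mul (hb τ hτ i)

lemma measurable_noiseWeight {b : Ω → ℕ → ι → ℝ} {η : Ω → ℕ → ℝ} {s t : ℕ} (hst : s ≤ t)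
    (hb : ∀ τ ∈ Finset.Icc s t, ∀ i, Measurable fun ω => b ω τ i)
    (hη : ∀ τ ∈ Finset.Ico s t, Measurable fun ω => η ω τ) :
    Measurable fun ω => noiseWeight (b ω) (η ω) s t := by
  have hb' : ∀ τ ∈ Finset.Ico s t, ∀ i, Measurable fun ω => b ω τ i := fun τ hτ =>
    hb τ (by simp at hτ ⊢; omega)
  have hbt := hb t (by simp [hst])
  have hg := measurable_gramSeq hb'
  exact (measurable_invForm hg hbt (measurable_noiseSeq hb' hη)).div
    ((measurable_invForm hg hbt hbt).const_add 1)

end MatrixMeasurability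

section Oful

open Matrix

variable {d : ℕ} {A : Set (EuclideanSpace ℝ (Fin d))}

open Classical in
/-- The feature vectors of the selected rounds, `0` in the other rounds. -/
noncomputable def selVec (sel : ℕ → Prop) (pol : ℕ → A) (τ : ℕ) : Fin d → ℝ :=
  if sel τ then (pol τ).1.ofLp else 0

open Classical in
/-- The data of the selected rounds `u ≤ τ < t`. -/
noncomputable def selHistory (sel : ℕ → Prop) (pol : ℕ → A) (rew : ℕ → ℝ) (u t : ℕ) :
    List (A × ℝ) :=
  ((List.Ico u t).filter fun τ => sel τ).map fun τ => (pol τ, rew τ)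

lemma sum_map_filter_Ico {M : Type*} [AddCommMonoid M] (p : ℕ → Prop) [DecidablePred p]
    (g : ℕ → M) (u t : ℕ) :
    (((List.Ico u t).filter fun τ => p τ).map g).sum =
      ∑ τ ∈ Finset.Ico u t, if p τ then g τ else 0 := by
  rw [← Finset.sum_filter]
  rfl

lemma dotProduct_ofLp (x y : EuclideanSpace ℝ (Fin d)) : x.ofLp ⬝ᵥ y.ofLp = inner ℝ x y := by
  rw [EuclideanSpace.inner_eq_star_dotProduct]
  simp [dotProduct_comm]

lemma linReward_eq (θ : ℕ → EuclideanSpace ℝ (Fin d)) (t : ℕ) (a : A) :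
    linReward A θ t a = a.1.ofLp ⬝ᵥ (θ t).ofLp := (dotProduct_ofLp _ _).symm

/-- Padding the unselected rounds with zero features turns the data list of an instance into a
sequence indexed by the rounds, to which the martingale bounds apply. -/
lemma ofulGram_selHistory (sel : ℕ → Prop) (pol : ℕ → A) (rew : ℕ → ℝ) (u t : ℕ) :
    ofulGram (selHistory sel pol rew u t) = gramSeq (selVec sel pol) u t := by
  classical
  rw [ofulGram, gramSeq, selHistory, List.map_map, sum_map_filter_Ico]
  congr 1
  refine Finset.sum_congr rfl fun τ _ => ?_
  by_cases h : sel τ <;> simp [selVec, h]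

lemma ofulTheta_selHistory (sel : ℕ → Prop) (pol : ℕ → A) (rew : ℕ → ℝ) (u t : ℕ) :
    ofulTheta (selHistory sel pol rew u t) =
      (gramSeq (selVec sel pol) u t)⁻¹ *ᵥ ∑ τ ∈ Finset.Ico u t, rew τ • selVec sel pol τ := by
  classical
  rw [ofulTheta, ofulGram_selHistory, selHistory, List.map_map, sum_map_filter_Ico]
  congr 1
  refine Finset.sum_congr rfl fun τ _ => ?_
  by_cases h : sel τ <;> simp [selVec, h]

lemma ofulIndex_selHistory (T : ℕ) (δ : ℝ) (sel : ℕ → Prop) (pol : ℕ → A) (rew : ℕ → ℝ)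
    (u t : ℕ) (a : A) :
    ofulIndex T δ (selHistory sel pol rew u t) a =
      a.1.ofLp ⬝ᵥ ((gramSeq (selVec sel pol) u t)⁻¹ *ᵥ
        ∑ τ ∈ Finset.Ico u t, rew τ • selVec sel pol τ) +
      2 * ofulBeta d T δ * √(invForm (gramSeq (selVec sel pol) u t) a.1.ofLp a.1.ofLp) := by
  rw [ofulIndex, ofulTheta_selHistory, ofulGram_selHistory]
  rfl

/-- The noise of a realized reward. -/
noncomputable def pathNoise (θ : ℕ → EuclideanSpace ℝ (Fin d)) (pol : ℕ → A) (rew : ℕ → ℝ) (τ : ℕ) : ℝ :=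
  rew τ - linReward A θ τ (pol τ)

/-- The squared self-normalized norm of the noise of the selected rounds. -/
noncomputable def selfNorm (θ : ℕ → EuclideanSpace ℝ (Fin d)) (sel : ℕ → Prop) (pol : ℕ → A)
    (rew : ℕ → ℝ) (u t : ℕ) : ℝ :=
  invForm (gramSeq (selVec sel pol) u t)
    (noiseSeq (selVec sel pol) (pathNoise θ pol rew) u t)
    (noiseSeq (selVec sel pol) (pathNoise θ pol rew) u t)

/-- The standing assumptions on the linear bandit environment. -/
structure LinSetting (d T : ℕ) (δ : ℝ) (A : Set (EuclideanSpace ℝ (Fin d)))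
    (θ : ℕ → EuclideanSpace ℝ (Fin d)) : Prop where
  d_pos : 1 ≤ d
  T_ge : 2 ≤ T
  δ_pos : 0 < δ
  δ_lt : δ < 1
  nonempty : A.Nonempty
  norm_act : ∀ a ∈ A, ‖a‖ ≤ 1
  norm_param : ∀ t ∈ Finset.Icc 1 T, ‖θ t‖ ≤ 1
  reward_mem : ∀ t ∈ Finset.Icc 1 T, ∀ a : A, linReward A θ t a ∈ Set.Icc (0 : ℝ) 1

namespace LinSetting

variable {T : ℕ} {δ : ℝ} {θ : ℕ → EuclideanSpace ℝ (Fin d)}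

lemma log_ge (h : LinSetting d T δ A θ) : (0.69 : ℝ) ≤ Real.log (T / δ) := by
  have hT : (2 : ℝ) ≤ T := by exact_mod_cast h.T_ge
  have h1 : (2 : ℝ) ≤ T / δ := by
    rw [le_div_iff₀ h.δ_pos]; nlinarith [h.δ_lt, h.δ_pos]
  have := Real.log_le_log (by norm_num) h1
  linarith [Real.log_two_gt_d9]

lemma log_T_le (h : LinSetting d T δ A θ) : Real.log T ≤ Real.log (T / δ) := by
  have hT : (2 : ℝ) ≤ T := by exact_mod_cast h.T_ge
  refine Real.log_le_log (by linarith) ?_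
  rw [le_div_iff₀ h.δ_pos]; nlinarith [h.δ_lt, h.δ_pos]

lemma exp_log (h : LinSetting d T δ A θ) : Real.exp (Real.log (T / δ)) = T / δ := by
  have hT : (2 : ℝ) ≤ T := by exact_mod_cast h.T_ge
  exact Real.exp_log (div_pos (by linarith) h.δ_pos)

lemma T_le_exp (h : LinSetting d T δ A θ) : (T : ℝ) ≤ Real.exp (Real.log (T / δ)) := by
  have hT : (2 : ℝ) ≤ T := by exact_mod_cast h.T_ge
  rw [h.exp_log, le_div_iff₀ h.δ_pos]; nlinarith [h.δ_lt, h.δ_pos]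

lemma log_one_add_le (h : LinSetting d T δ A θ) {k : ℕ} (hk : k ≤ T) :
    Real.log (1 + k) ≤ 2 * Real.log (T / δ) := by
  have hT : (2 : ℝ) ≤ T := by exact_mod_cast h.T_ge
  have hk' : (k : ℝ) ≤ T := by exact_mod_cast hk
  have : Real.log (1 + k) ≤ Real.log ((T : ℝ) ^ 2) :=
    Real.log_le_log (by positivity) (by nlinarith)
  rw [Real.log_pow] at this
  push_cast at this
  linarith [h.log_T_le]

lemma d_cast (h : LinSetting d T δ A θ) : (1 : ℝ) ≤ d := by exact_mod_cast h.d_pos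

lemma selVec_le_one (h : LinSetting d T δ A θ) (sel : ℕ → Prop) (pol : ℕ → A) (τ : ℕ) :
    selVec sel pol τ ⬝ᵥ selVec sel pol τ ≤ 1 := by
  by_cases hs : sel τ
  · simp only [selVec, hs, if_true]
    rw [dotProduct_ofLp, real_inner_self_eq_norm_sq]
    exact pow_le_one₀ (norm_nonneg _) (h.norm_act _ (pol τ).2)
  · simp [selVec, hs]

lemma optReward_bdd (h : LinSetting d T δ A θ) {t : ℕ} (ht : t ∈ Finset.Icc 1 T) :
    BddAbove (Set.range (linReward A θ t)) :=
  ⟨1, by rintro _ ⟨a, rfl⟩; exact (h.reward_mem t ht a).2⟩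

lemma le_optReward (h : LinSetting d T δ A θ) {t : ℕ} (ht : t ∈ Finset.Icc 1 T) (a : A) :
    linReward A θ t a ≤ optReward (linReward A θ) t := le_ciSup (h.optReward_bdd ht) a

lemma optReward_le (h : LinSetting d T δ A θ) (t : ℕ) {c : ℝ}
    (hc : ∀ a : A, linReward A θ t a ≤ c) : optReward (linReward A θ) t ≤ c :=
  haveI := h.nonempty.to_subtype
  ciSup_le hc

lemma optReward_mem (h : LinSetting d T δ A θ) {t : ℕ} (ht : t ∈ Finset.Icc 1 T) :
    optReward (linReward A θ) t ∈ Set.Icc (0 : ℝ) 1 := by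
  obtain ⟨a, ha⟩ := h.nonempty
  exact ⟨(h.reward_mem t ht ⟨a, ha⟩).1.trans (h.le_optReward ht ⟨a, ha⟩),
    h.optReward_le t fun a => (h.reward_mem t ht a).2⟩

lemma beta_mul (h : LinSetting d T δ A θ) :
    ofulBeta d T δ * √((d : ℝ) * Real.log (T / δ)) = 4 * (d * Real.log (T / δ)) := by
  have := h.log_ge
  have := h.d_cast
  rw [ofulBeta, mul_assoc, Real.mul_self_sqrt (by positivity)]

/-- Validity of the confidence width under small drift. -/
lemma abs_est_sub_le (h : LinSetting d T δ A θ) {sel : ℕ → Prop} {pol : ℕ → A} {rew : ℕ → ℝ}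
    {u t k : ℕ} {D : ℝ} (ht : t ∈ Finset.Icc 1 T)
    (hX : selfNorm θ sel pol rew u t ≤ 18 * (d * Real.log (T / δ)))
    (hD0 : 0 ≤ D) (hD : ∀ τ ∈ Finset.Ico u t, sel τ → ‖θ τ - θ t‖ ≤ D)
    (hk : ((Finset.Ico u t).filter fun τ => selVec sel pol τ ≠ 0).card ≤ k)
    (hDk : D * √k ≤ √(Real.log (T / δ))) (a : A) :
    |a.1.ofLp ⬝ᵥ ((gramSeq (selVec sel pol) u t)⁻¹ *ᵥ
        ∑ τ ∈ Finset.Ico u t, rew τ • selVec sel pol τ) - linReward A θ t a| ≤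
      2 * ofulBeta d T δ * √(invForm (gramSeq (selVec sel pol) u t) a.1.ofLp a.1.ofLp) := by
  have hL := h.log_ge
  have hd := h.d_cast
  set L := Real.log (T / δ) with hLdef
  have h1 := abs_ridge_sub_le (b := selVec sel pol) (u := u) (t := t) (r := rew)
    (η := pathNoise θ pol rew) (θ := fun τ => (θ τ).ofLp) (ϑ := (θ t).ofLp) (D := D) (k := k)
    (fun τ _ => ?_) ?_ hD0 (fun τ hτ hne => ?_) hk a.1.ofLp
  · rw [linReward_eq]
    refine h1.trans ?_
    rw [mul_comm]
    refine mul_le_mul_of_nonneg_right ?_ (Real.sqrt_nonneg _)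
    change 1 + √(selfNorm θ sel pol rew u t) + D * √k ≤ _
    rw [ofulBeta, ← hLdef]
    set g := √((d : ℝ) * L) with hg
    have hg0 : 0 ≤ g := Real.sqrt_nonneg _
    have hg2 : g ^ 2 = d * L := Real.sq_sqrt (by positivity)
    have hdL : 0.69 ≤ d * L := by nlinarith
    -- Budget in units of g = √(d log(T/δ)): noise 4.25 (as 4.25² > 18), regularization 1.25, drift
    -- 1. The total 6.5 is below 2β = 8g.
    have e1 : √(selfNorm θ sel pol rew u t) ≤ 4.25 * g :=
      Real.sqrt_le_iff.2 ⟨by positivity, by nlinarith⟩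
    have e2 : 1 ≤ 1.25 * g := by nlinarith
    have e3 : √L ≤ g := Real.sqrt_le_sqrt (by nlinarith)
    linarith
  · by_cases hs : sel τ
    · simp only [selVec, hs, if_true, pathNoise, linReward_eq]
      congr 1; ring
    · simp [selVec, hs]
  · rw [dotProduct_ofLp, real_inner_self_eq_norm_sq]
    exact pow_le_one₀ (norm_nonneg _) (h.norm_param t ht)
  · have hs : sel τ := by
      by_contra hs; exact hne (by simp [selVec, hs])
    simp only [selVec, hs, if_true]
    rw [dotProduct_ofLp, dotProduct_ofLp, ← inner_sub_right]
    refine (abs_real_inner_le_norm _ _).trans ?_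
    calc _ ≤ 1 * ‖θ τ - θ t‖ :=
          mul_le_mul_of_nonneg_right (h.norm_act _ (pol τ).2) (norm_nonneg _)
      _ ≤ D := by rw [one_mul]; exact hD τ hτ hs

/-- The output of OFUL is optimistic and exceeds the mean reward of the played action by at most
the confidence width. -/
lemma est_bounds (h : LinSetting d T δ A θ) {sel : ℕ → Prop} {pol : ℕ → A} {rew : ℕ → ℝ}
    {u t k : ℕ} {D : ℝ} (ht : t ∈ Finset.Icc 1 T)
    (hX : selfNorm θ sel pol rew u t ≤ 18 * (d * Real.log (T / δ)))
    (hD0 : 0 ≤ D) (hD : ∀ τ ∈ Finset.Ico u t, sel τ → ‖θ τ - θ t‖ ≤ D)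
    (hk : ((Finset.Ico u t).filter fun τ => selVec sel pol τ ≠ 0).card ≤ k)
    (hDk : D * √k ≤ √(Real.log (T / δ))) {p : A}
    (hp : p ∈ (oful A T δ).choices (selHistory sel pol rew u t)) :
    optReward (linReward A θ) t ≤ (oful A T δ).est (selHistory sel pol rew u t) ∧
    (oful A T δ).est (selHistory sel pol rew u t) ≤ linReward A θ t p +
      4 * ofulBeta d T δ *
        √(invForm (gramSeq (selVec sel pol) u t) p.1.ofLp p.1.ofLp) := by
  set H := selHistory sel pol rew u t with hH
  have hp' : ∀ b : A, ofulIndex T δ H b ≤ ofulIndex T δ H p := hp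
  have key := fun a => abs_le.1 (h.abs_est_sub_le ht hX hD0 hD hk hDk a)
  have hidx := fun a => ofulIndex_selHistory T δ sel pol rew u t a
  rw [← hH] at hidx
  have hlow : ∀ a : A, linReward A θ t a ≤ ofulIndex T δ H a := fun a => by
    rw [hidx a]; linarith [(key a).1]
  have hsup : ⨆ a : A, ofulIndex T δ H a = ofulIndex T δ H p :=
    le_antisymm (haveI := h.nonempty.to_subtype; ciSup_le hp') (le_ciSup ⟨_, by
      rintro _ ⟨b, rfl⟩; exact hp' b⟩ p)
  have hest : (oful A T δ).est H = max 0 (min 1 (ofulIndex T δ H p)) := by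
    change max 0 (min 1 (⨆ a : A, ofulIndex T δ H a)) = _
    rw [hsup]
  rw [hest]
  constructor
  -- Clipping costs nothing: the optimal reward is at most 1, and the mean reward in the upper bound
  -- is nonnegative.
  · refine le_max_of_le_right (le_min (h.optReward_mem ht).2 ?_)
    exact h.optReward_le t fun a => (hlow a).trans (hp' a)
  · refine max_le ?_ ((min_le_right _ _).trans ?_)
    · have := (h.reward_mem t ht p).1
      have : 0 ≤ ofulBeta d T δ := by rw [ofulBeta]; positivity
      positivity
    · rw [hidx p]; linarith [(key p).2]

/-- Sum of the confidence widths along the selected rounds. -/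
lemma sum_width_le (h : LinSetting d T δ A θ) (sel : ℕ → Prop) (pol : ℕ → A) {u t k : ℕ}
    (hut : u ≤ t) (htu : t - u ≤ T)
    (hk : ((Finset.Ico u t).filter fun τ => selVec sel pol τ ≠ 0).card ≤ k) :
    ∑ τ ∈ Finset.Ico u t, 4 * ofulBeta d T δ *
        √(invForm (gramSeq (selVec sel pol) u τ) (selVec sel pol τ) (selVec sel pol τ)) ≤
      32 * (d * Real.log (T / δ)) * √k := by
  rw [← Finset.mul_sum]
  have hβ : 0 ≤ ofulBeta d T δ := by rw [ofulBeta]; positivity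
  have hL := h.log_ge
  have hd := h.d_cast
  have h1 := sum_sqrt_invForm_le (h.selVec_le_one sel pol) hut hk
  have h2 : √(k * (2 * (Fintype.card (Fin d) * Real.log (1 + (t - u : ℕ))))) ≤
      2 * √(d * Real.log (T / δ)) * √k := by
    apply Real.sqrt_le_iff.2 ⟨by positivity, ?_⟩
    rw [mul_pow, mul_pow, Real.sq_sqrt (by positivity), Real.sq_sqrt (by positivity),
      Fintype.card_fin]
    have := h.log_one_add_le htu
    have h3 := mul_le_mul_of_nonneg_left this (by positivity : (0 : ℝ) ≤ k * (2 * d))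
    nlinarith
  calc _ ≤ 4 * ofulBeta d T δ * (2 * √(d * Real.log (T / δ)) * √k) :=
        mul_le_mul_of_nonneg_left (h1.trans h2) (by positivity)
    _ = 8 * (ofulBeta d T δ * √(d * Real.log (T / δ))) * √k := by ring
    _ = _ := by rw [h.beta_mul]; ring

end LinSetting

end Oful

/-! ### The guarantee of OFUL run alone -/

section OfulGuarantee

open Matrix

variable {d T : ℕ} {δ : ℝ} {A : Set (EuclideanSpace ℝ (Fin d))}
  {θ : ℕ → EuclideanSpace ℝ (Fin d)}

namespace LinSetting

lemma ofulRho_eq (h : LinSetting d T δ A θ) (t : ℕ) :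
    ofulRho 100 d T δ t = 400 * (d * Real.log (T / δ)) / √t := by
  have hL := h.log_ge
  have hd := h.d_cast
  rw [ofulRho, Real.sqrt_div (by positivity), mul_assoc, mul_div_assoc', h.beta_mul]
  ring

lemma mul_ofulRho (h : LinSetting d T δ A θ) (t : ℕ) :
    (t : ℝ) * ofulRho 100 d T δ t = 400 * (d * Real.log (T / δ)) * √t := by
  rw [h.ofulRho_eq]
  rcases Nat.eq_zero_or_pos t with rfl | ht
  · simp
  have : (0 : ℝ) < √t := Real.sqrt_pos.2 (by exact_mod_cast ht)
  field_simp
  rw [Real.sq_sqrt (by positivity)]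
  ring

lemma ofulRho_le (h : LinSetting d T δ A θ) {s t : ℕ} (hs : 1 ≤ s) (hst : s ≤ t) :
    ofulRho 100 d T δ t ≤ ofulRho 100 d T δ s := by
  have hL := h.log_ge
  have hd := h.d_cast
  rw [h.ofulRho_eq, h.ofulRho_eq]
  have : (0 : ℝ) < √s := Real.sqrt_pos.2 (by exact_mod_cast hs)
  have h2 : √(s : ℝ) ≤ √t := Real.sqrt_le_sqrt (by exact_mod_cast hst)
  gcongr

lemma ofulRho_pos (h : LinSetting d T δ A θ) {t : ℕ} (ht : 1 ≤ t) : 0 < ofulRho 100 d T δ t := by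
  have hL := h.log_ge
  have hd := h.d_cast
  have : (0 : ℝ) < √t := Real.sqrt_pos.2 (by exact_mod_cast ht)
  rw [h.ofulRho_eq]
  positivity

lemma drift_ofulDelta (s e : ℕ) :
    drift (ofulDelta 400 T δ θ) s e =
      400 * d * √(Real.log (T / δ)) * ∑ τ ∈ Finset.Ico s e, ‖θ τ - θ (τ + 1)‖ := by
  rw [drift, Finset.mul_sum]
  rfl

lemma norm_sub_le_sum {s e τ τ' : ℕ} (h1 : s ≤ τ) (h2 : τ ≤ τ') (h3 : τ' ≤ e) :
    ‖θ τ - θ τ'‖ ≤ ∑ i ∈ Finset.Ico s e, ‖θ i - θ (i + 1)‖ := by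
  have := dist_le_Ico_sum_dist θ h2
  simp only [dist_eq_norm] at this
  refine this.trans (Finset.sum_le_sum_of_subset_of_nonneg ?_ fun _ _ _ => norm_nonneg _)
  exact Finset.Ico_subset_Ico h1 h3

/-- This is where c_Δ = 400 is matched to c_ρ = 100: with β = 4√(d log(T/δ)) the factor 400d
cancels, leaving exactly the drift that the confidence width can absorb. -/
lemma sum_norm_mul_sqrt_le (h : LinSetting d T δ A θ) {s e n : ℕ} (hn : 1 ≤ n)
    (hdr : drift (ofulDelta 400 T δ θ) s e ≤ ofulRho 100 d T δ n) :
    (∑ i ∈ Finset.Ico s e, ‖θ i - θ (i + 1)‖) * √n ≤ √(Real.log (T / δ)) := by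
  have hL := h.log_ge
  have hd := h.d_cast
  have hn' : (0 : ℝ) < √n := Real.sqrt_pos.2 (by exact_mod_cast hn)
  set D := ∑ i ∈ Finset.Ico s e, ‖θ i - θ (i + 1)‖
  rw [drift_ofulDelta, h.ofulRho_eq, le_div_iff₀ hn'] at hdr
  set g := √(Real.log (T / δ))
  have hg : 0 < g := Real.sqrt_pos.2 (by linarith)
  have hgg : Real.log (T / δ) = g * g := (Real.mul_self_sqrt (by linarith)).symm
  rw [hgg] at hdr
  have : 400 * (d : ℝ) * g * (D * √n) ≤ 400 * d * g * g := by linarith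
  exact le_of_mul_le_mul_left this (by positivity)

lemma abs_linReward_sub_le (h : LinSetting d T δ A θ) (t t' : ℕ) (a : A) :
    |linReward A θ t a - linReward A θ t' a| ≤ ‖θ t - θ t'‖ := by
  rw [linReward, linReward, ← inner_sub_right]
  refine (abs_real_inner_le_norm _ _).trans ?_
  exact mul_le_of_le_one_left (norm_nonneg _) (h.norm_act _ a.2)

lemma optReward_sub_le (h : LinSetting d T δ A θ) {t t' : ℕ} (ht' : t' ∈ Finset.Icc 1 T) :
    optReward (linReward A θ) t ≤ optReward (linReward A θ) t' + ‖θ t - θ t'‖ :=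
  h.optReward_le t fun a => by
    linarith [(abs_le.1 (h.abs_linReward_sub_le t t' a)).2, h.le_optReward ht' a]

lemma norm_le_ofulDelta (h : LinSetting d T δ A θ) (t : ℕ) :
    ‖θ t - θ (t + 1)‖ ≤ ofulDelta 400 T δ θ t := by
  have hL := h.log_ge
  have hd := h.d_cast
  have h1 : 0.5 ≤ √(Real.log (T / δ)) := Real.le_sqrt_of_sq_le (by linarith)
  rw [ofulDelta]
  have : (1 : ℝ) ≤ 400 * d * √(Real.log (T / δ)) := by nlinarith
  nlinarith [norm_nonneg (θ t - θ (t + 1))]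

lemma sum_norm_le_drift (h : LinSetting d T δ A θ) (s e : ℕ) :
    ∑ i ∈ Finset.Ico s e, ‖θ i - θ (i + 1)‖ ≤ drift (ofulDelta 400 T δ θ) s e :=
  Finset.sum_le_sum fun i _ => h.norm_le_ofulDelta i

lemma drift_nonneg (s e : ℕ) : 0 ≤ drift (ofulDelta 400 T δ θ) s e :=
  Finset.sum_nonneg fun i _ => by rw [ofulDelta]; positivity

lemma drift_le_of_subset {s s' e e' : ℕ} (hs : s' ≤ s) (he : e ≤ e') :
    drift (ofulDelta 400 T δ θ) s e ≤ drift (ofulDelta 400 T δ θ) s' e' :=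
  Finset.sum_le_sum_of_subset_of_nonneg (Finset.Ico_subset_Ico hs he)
    fun i _ _ => by rw [ofulDelta]; positivity

end LinSetting

variable {Ω : Type u} [mΩ : MeasurableSpace Ω] {μ : Measure Ω} [IsProbabilityMeasure μ]
  {G : Filtration ℕ mΩ} {pol : ℕ → Ω → A} {rew : ℕ → Ω → ℝ}

namespace LinSetting

lemma measurable_coord {Ω' : Type*} {m : MeasurableSpace Ω'} {p : Ω' → A} (hp : Measurable p) (i : Fin d) :
    Measurable fun ω => (p ω).1.ofLp i := by
  have hc : Continuous fun a : A => a.1.ofLp i := by fun_prop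
  exact hc.measurable.comp hp

lemma measurable_linReward (hI : IsInteraction μ G T (linReward A θ) pol rew) :
    ∀ t ∈ Finset.Icc 1 T, Measurable[G t] fun ω => linReward A θ t (pol t ω) := by
  intro t ht
  have hc : Continuous fun a : A => linReward A θ t a := by unfold linReward; fun_prop
  exact hc.measurable.comp (hI.pol_meas t ht)

lemma measurable_selVec (hI : IsInteraction μ G T (linReward A θ) pol rew) {sel : ℕ → Ω → Prop}
    {τ t : ℕ} (hτ : τ ∈ Finset.Icc 1 T) (hτt : τ ≤ t) (hs : MeasurableSet[G t] {ω | sel τ ω})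
    (i : Fin d) : Measurable[G t] fun ω => selVec (sel · ω) (pol · ω) τ i := by
  classical
  have e : (fun ω => selVec (sel · ω) (pol · ω) τ i) =
      fun ω => if sel τ ω then (pol τ ω).1.ofLp i else 0 := by
    funext ω
    by_cases h : sel τ ω <;> simp [selVec, h]
  rw [e]
  exact Measurable.ite hs (measurable_coord ((hI.pol_meas τ hτ).mono (G.mono hτt) le_rfl) i)
    measurable_const

/-- Tail bound for the self-normalized noise of a predictable selection of rounds. -/
lemma measure_selfNorm_le (h : LinSetting d T δ A θ)
    (hI : IsInteraction μ G T (linReward A θ) pol rew) {sel : ℕ → Ω → Prop} {s t : ℕ}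
    (hs1 : 1 ≤ s) (hst : s ≤ t) (htT : t ≤ T)
    (hsel : ∀ τ ∈ Finset.Ico s t, MeasurableSet[G τ] {ω | sel τ ω}) :
    μ {ω | ¬ selfNorm θ (sel · ω) (pol · ω) (rew · ω) s t ≤ 18 * (d * Real.log (T / δ))} ≤
      ENNReal.ofReal (Real.exp (-(8 * Real.log (T / δ)))) := by
  set y : ℕ → Ω → ℝ := fun τ ω =>
    noiseWeight (selVec (sel · ω) (pol · ω)) (pathNoise θ (pol · ω) (rew · ω)) s τ with hy
  have hη : ∀ τ ∈ Finset.Ico s t, ∀ ω, |pathNoise θ (pol · ω) (rew · ω) τ| ≤ 1 := fun τ hτ ω =>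
    abs_rewNoise_le hI h.reward_mem (by simp at hτ ⊢; omega) ω
  have hsub : ∀ τ ∈ Finset.Ico s t, ∀ τ' ∈ Finset.Ico s τ, τ' ∈ Finset.Ico s t :=
    fun τ hτ τ' hτ' => by simp at hτ hτ' ⊢; omega
  refine (measure_mono ?_).trans (measure_le_expNoise hI h.reward_mem
    (measurable_linReward hI) hs1 (C := T) (by omega : t ≤ T + 1) (y := y) (fun τ hτ => ?_)
    (fun τ hτ ω => ?_) _)
  · intro ω hω
    simp only [Set.mem_ofPred_eq, not_le] at hω ⊢
    -- The constant 18 is 2 from the log-determinant (log(1 + T) ≤ 2 log(T/δ)) plus twice the level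
    -- 8 log(T/δ) of the supermartingale.
    have h1 := invForm_noiseSeq_le (b := selVec (sel · ω) (pol · ω)) (fun τ hτ => hη τ hτ ω) hst
    have h2 := sum_invForm_div_le (h.selVec_le_one (sel · ω) (pol · ω)) hst
    have h3 := h.log_one_add_le (show t - s ≤ T by omega)
    change selfNorm θ (sel · ω) (pol · ω) (rew · ω) s t ≤ _ + 2 * expNoise _ _ _ y s t ω at h1
    rw [Fintype.card_fin] at h2
    have hd := h.d_cast
    have hL := h.log_ge
    nlinarith
  · have hτ' := Finset.mem_Ico.1 hτ
    refine measurable_noiseWeight hτ'.1 (fun τ' hτ'' i => ?_) (fun τ' hτ'' => ?_)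
    · have := Finset.mem_Icc.1 hτ''
      exact measurable_selVec hI (by simp; omega) this.2
        (G.mono this.2 _ (hsel τ' (by simp; omega))) i
    · have := Finset.mem_Ico.1 hτ''
      exact (measurable_rewNoise hI (measurable_linReward hI)
        (by simp; omega : τ' ∈ Finset.Icc 1 T)).mono (G.mono (by omega)) le_rfl
  · have hτ' := Finset.mem_Ico.1 hτ
    refine (abs_noiseWeight_le (fun τ' hτ'' => hη τ' (hsub τ hτ τ' hτ'') ω)
      (h.selVec_le_one _ _)).trans ?_
    exact_mod_cast (by omega : τ - s ≤ T)

/-- Azuma–Hoeffding for the rewards of an interval of rounds. -/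
lemma measure_sum_noise_le (h : LinSetting d T δ A θ)
    (hI : IsInteraction μ G T (linReward A θ) pol rew) {s t : ℕ} (hs1 : 1 ≤ s) (hst : s ≤ t)
    (htT : t ≤ T) :
    μ {ω | ¬ |∑ τ ∈ Finset.Icc s t, pathNoise θ (pol · ω) (rew · ω) τ| ≤
        4 * √((t - s + 1 : ℕ) * Real.log (T / δ))} ≤
      ENNReal.ofReal (Real.exp (-(7 * Real.log (T / δ)))) := by
  have hL := h.log_ge
  set L := Real.log (T / δ) with hLd
  set n : ℕ := t - s + 1 with hn
  have hn0 : (0 : ℝ) < n := by exact_mod_cast (by omega : 0 < n)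
  -- With constant weight ±a/n the exponent at deviation a is a²/n − a²/(2n) = 8L. The two signs
  -- together cost a factor 2 ≤ e^L.
  set a := 4 * √(n * L) with ha
  have ha0 : 0 ≤ a := by positivity
  have ha2 : a ^ 2 = 16 * (n * L) := by
    rw [ha, mul_pow, Real.sq_sqrt (by positivity)]; ring
  have key : ∀ ε : ℝ, |ε| = 1 →
      μ {ω | 8 * L ≤ expNoise (linReward A θ) pol rew (fun _ _ => ε * (a / n)) s (t + 1) ω} ≤
        ENNReal.ofReal (Real.exp (-(8 * L))) := fun ε hε =>
    measure_le_expNoise hI h.reward_mem (measurable_linReward hI) hs1 (C := a / n) (by omega)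
      (fun _ _ => measurable_const)
      (fun _ _ _ => by rw [abs_mul, hε, one_mul, abs_of_nonneg (by positivity)]) _
  have hval : ∀ (ε : ℝ) (ω : Ω), |ε| = 1 →
      expNoise (linReward A θ) pol rew (fun _ _ => ε * (a / n)) s (t + 1) ω =
        (a / n) * (ε * ∑ τ ∈ Finset.Icc s t, pathNoise θ (pol · ω) (rew · ω) τ) - 8 * L := by
    intro ε ω hε
    have hε2 : ε ^ 2 = 1 := by rw [← sq_abs, hε, one_pow]
    have hico : Finset.Ico s (t + 1) = Finset.Icc s t := by ext; simp
    rw [expNoise, Finset.sum_sub_distrib, ← Finset.mul_sum, hico]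
    congr 1
    · change _ * ∑ τ ∈ Finset.Icc s t, pathNoise θ (pol · ω) (rew · ω) τ = _
      ring
    · rw [Finset.sum_const, Nat.card_Icc, nsmul_eq_mul, show t + 1 - s = n by omega, mul_pow, hε2,
        div_pow, ha2]
      field_simp
      ring
  have hsub : {ω | ¬ |∑ τ ∈ Finset.Icc s t, pathNoise θ (pol · ω) (rew · ω) τ| ≤ a} ⊆
      {ω | 8 * L ≤ expNoise (linReward A θ) pol rew (fun _ _ => (1 : ℝ) * (a / n)) s (t + 1) ω} ∪
      {ω | 8 * L ≤
        expNoise (linReward A θ) pol rew (fun _ _ => (-1 : ℝ) * (a / n)) s (t + 1) ω} := by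
    intro ω hω
    simp only [Set.mem_ofPred_eq, not_le, Set.mem_union] at hω ⊢
    rw [hval 1 ω (by norm_num), hval (-1) ω (by norm_num)]
    have e : ∀ z, a ≤ z → 8 * L ≤ a / n * z - 8 * L := fun z hz => by
      have : a / n * a ≤ a / n * z := mul_le_mul_of_nonneg_left hz (by positivity)
      have e2 : a / n * a = 16 * L := by
        rw [div_mul_eq_mul_div, ← sq, ha2]; field_simp
      linarith
    rcases le_or_gt 0 (∑ τ ∈ Finset.Icc s t, pathNoise θ (pol · ω) (rew · ω) τ) with h0 | h0
    · rw [abs_of_nonneg h0] at hω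
      exact Or.inl (e _ (by linarith))
    · rw [abs_of_neg h0] at hω
      exact Or.inr (e _ (by linarith))
  refine (measure_mono hsub).trans ((measure_union_le _ _).trans
    ((add_le_add (key 1 (by norm_num)) (key (-1) (by norm_num))).trans ?_))
  rw [← ENNReal.ofReal_add (Real.exp_pos _).le (Real.exp_pos _).le]
  refine ENNReal.ofReal_le_ofReal ?_
  have h2 : (2 : ℝ) ≤ Real.exp L := by
    have h3 : (2 : ℝ) ≤ T := by exact_mod_cast h.T_ge
    exact h3.trans h.T_le_exp
  have h3 : Real.exp (-(7 * L)) = Real.exp L * Real.exp (-(8 * L)) := by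
    rw [← Real.exp_add]; congr 1; ring
  rw [h3]
  nlinarith [Real.exp_pos (-(8 * L))]

lemma soloHistory_eq (pol : ℕ → A) (rew : ℕ → ℝ) (t : ℕ) :
    soloHistory pol rew t = selHistory (fun _ => True) pol rew 1 t := by
  simp [soloHistory, selHistory]

lemma card_filter_Ico_le (p : ℕ → Prop) [DecidablePred p] (s t : ℕ) :
    ((Finset.Ico s t).filter p).card ≤ t - s :=
  (Finset.card_filter_le _ _).trans (by simp)

/-- Deterministic part of the guarantee of OFUL. -/
lemma solo_guarantee (h : LinSetting d T δ A θ) {pol : ℕ → A} {rew : ℕ → ℝ} {t : ℕ}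
    (ht : t ∈ Finset.Icc 1 T)
    (hfol : ∀ τ ∈ Finset.Icc 1 T, pol τ ∈ (oful A T δ).choices (soloHistory pol rew τ))
    (hdr : drift (ofulDelta 400 T δ θ) 1 t ≤ ofulRho 100 d T δ t)
    (hX : ∀ τ ∈ Finset.Icc 1 T,
      selfNorm θ (fun _ => True) pol rew 1 τ ≤ 18 * (d * Real.log (T / δ)))
    (hη : |∑ τ ∈ Finset.Icc 1 t, pathNoise θ pol rew τ| ≤
        4 * √((t - 1 + 1 : ℕ) * Real.log (T / δ))) :
    sInf (optReward (linReward A θ) '' Set.Icc 1 t) - drift (ofulDelta 400 T δ θ) 1 t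
        ≤ (oful A T δ).est (soloHistory pol rew t) ∧
      (1 / (t : ℝ)) * ∑ τ ∈ Finset.Icc 1 t, ((oful A T δ).est (soloHistory pol rew τ) - rew τ)
        ≤ ofulRho 100 d T δ t + drift (ofulDelta 400 T δ θ) 1 t := by
  have hL := h.log_ge
  have hd := h.d_cast
  obtain ⟨ht1, htT⟩ := Finset.mem_Icc.1 ht
  have hD := h.sum_norm_mul_sqrt_le ht1 hdr
  have hmem : ∀ τ ∈ Finset.Icc 1 t, τ ∈ Finset.Icc 1 T := fun τ hτ => by simp at hτ ⊢; omega
  -- The total variation up to `t` and the count k = t serve all earlier rounds at once.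
  have key : ∀ τ ∈ Finset.Icc 1 t, _ := fun τ hτ =>
    h.est_bounds (hmem τ hτ) (hX τ (hmem τ hτ))
      (Finset.sum_nonneg fun i (_ : i ∈ Finset.Ico 1 t) => norm_nonneg (θ i - θ (i + 1)))
      (fun τ' hτ' _ => norm_sub_le_sum (Finset.mem_Ico.1 hτ').1 (Finset.mem_Ico.1 hτ').2.le
        (Finset.mem_Icc.1 hτ).2)
      ((card_filter_Ico_le _ 1 τ).trans (by have := (Finset.mem_Icc.1 hτ).2; omega : τ - 1 ≤ t))
      hD (soloHistory_eq pol rew τ ▸ hfol τ (hmem τ hτ))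
  simp only [← soloHistory_eq] at key
  have hdr0 := drift_nonneg (T := T) (δ := δ) (θ := θ) 1 t
  constructor
  · have h1 := (key t (by simp [ht1])).1
    have h2 : sInf (optReward (linReward A θ) '' Set.Icc 1 t) ≤ optReward (linReward A θ) t :=
      csInf_le ((Set.finite_Icc 1 t).image _).bddBelow ⟨t, by simp [ht1], rfl⟩
    linarith
  · have h1 : ∑ τ ∈ Finset.Icc 1 t, ((oful A T δ).est (soloHistory pol rew τ) - rew τ) ≤
        32 * (d * Real.log (T / δ)) * √t -
          ∑ τ ∈ Finset.Icc 1 t, pathNoise θ pol rew τ := by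
      have h2 := h.sum_width_le (fun _ => True) pol (u := 1) (t := t + 1) (k := t) (by omega)
        (by omega) ((card_filter_Ico_le _ 1 (t + 1)).trans (by omega))
      have hico : Finset.Ico 1 (t + 1) = Finset.Icc 1 t := by ext; simp
      rw [hico] at h2
      rw [le_sub_iff_add_le, ← Finset.sum_add_distrib]
      refine le_trans (Finset.sum_le_sum fun τ hτ => ?_) h2
      have := (key τ hτ).2
      simp only [pathNoise, selVec, if_true]
      linarith
    have ht0 : (0 : ℝ) < t := by exact_mod_cast ht1
    -- Widths contribute 32 and noise 5 in units of d log(T/δ)√t, far below the 400 in tρ(t).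
    have h3 : 4 * √((t - 1 + 1 : ℕ) * Real.log (T / δ)) ≤ 5 * (d * Real.log (T / δ)) * √t := by
      rw [show t - 1 + 1 = t by omega, Real.sqrt_mul (by positivity)]
      have h4 : √(Real.log (T / δ)) ≤ 1.25 * (d * Real.log (T / δ)) := by
        refine Real.sqrt_le_iff.2 ⟨by positivity, ?_⟩
        have h8 : Real.log (T / δ) ≤ d * Real.log (T / δ) := le_mul_of_one_le_left (by linarith) hd
        nlinarith
      nlinarith [Real.sqrt_nonneg (t : ℝ)]
    have h5 := (abs_le.1 hη).1
    have h6 := h.mul_ofulRho t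
    have h7 : 0 ≤ (d * Real.log (T / δ)) * √t := by positivity
    rw [one_div, inv_mul_le_iff₀ ht0, mul_add]
    have : 0 ≤ (t : ℝ) * drift (ofulDelta 400 T δ θ) 1 t := by positivity
    linarith

/-- OFUL satisfies the near-stationary guarantee. -/
theorem nearStationaryGuarantee (h : LinSetting d T δ A θ) :
    NearStationaryGuarantee.{u} (oful A T δ) (linReward A θ) T δ
      (ofulDelta 400 T δ θ) (ofulRho 100 d T δ) where
  est_mem := fun H => ⟨le_max_left _ _, max_le zero_le_one (min_le_left _ _)⟩
  measure_dev := fun t _ p => (h.abs_linReward_sub_le t (t + 1) p).trans (h.norm_le_ofulDelta t)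
  rho_anti := fun s hs t _ hst => h.ofulRho_le hs.1 hst
  rho_ge := fun t ht => by
    have hL := h.log_ge
    have hd := h.d_cast
    rw [h.ofulRho_eq]
    exact div_le_div_of_nonneg_right (by nlinarith) (Real.sqrt_nonneg _)
  cum_mono := fun s _ t _ hst => by
    have hL := h.log_ge
    have hd := h.d_cast
    simp only [h.mul_ofulRho]
    have h2 : √(s : ℝ) ≤ √t := Real.sqrt_le_sqrt (by exact_mod_cast hst)
    gcongr
  guarantee := by
    intro Ω mΩ μ _ G pol rew hrun t ht hdr
    have hI := hrun.interaction
    obtain ⟨ht1, htT⟩ := Finset.mem_Icc.1 ht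
    set L := Real.log (T / δ) with hLd
    have hL := h.log_ge
    set E1 : Set Ω := {ω | ∃ τ ∈ Finset.Icc 1 T, ω ∈ {ω |
      ¬ selfNorm θ (fun _ => True) (pol · ω) (rew · ω) 1 τ ≤ 18 * (d * L)}} with hE1
    set E2 : Set Ω := {ω | ¬ |∑ τ ∈ Finset.Icc 1 t, pathNoise θ (pol · ω) (rew · ω) τ| ≤
        4 * √((t - 1 + 1 : ℕ) * L)} with hE2
    have h1 : μ E1 ≤ ENNReal.ofReal (Real.exp (-(7 * L))) := by
      refine measure_exists_le_exp (L := L) ?_ fun τ hτ => ?_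
      · rw [Nat.card_Icc, Nat.add_sub_cancel]; exact h.T_le_exp
      · have hτ' := Finset.mem_Icc.1 hτ
        have := h.measure_selfNorm_le hI (sel := fun _ _ => True) le_rfl hτ'.1 hτ'.2
          (fun _ _ => by simp)
        rw [show (7 + 1 : ℝ) = 8 by norm_num]
        exact this
    have h2 : μ E2 ≤ ENNReal.ofReal (Real.exp (-(7 * L))) := h.measure_sum_noise_le hI le_rfl ht1 htT
    refine (measure_mono (t := E1 ∪ E2) fun ω hω => ?_).trans ((measure_union_le _ _).trans
      ((add_le_add h1 h2).trans ?_))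
    · by_contra hn
      simp only [hE1, hE2, Set.mem_union, Set.mem_ofPred_eq, not_or, not_exists, not_and,
        not_not] at hn
      exact hω (h.solo_guarantee ht (fun τ hτ => hrun.follows τ hτ ω) hdr hn.1 hn.2)
    · rw [← ENNReal.ofReal_add (Real.exp_pos _).le (Real.exp_pos _).le]
      refine ENNReal.ofReal_le_ofReal ?_
      have e : δ / T = Real.exp (-L) := by rw [Real.exp_neg, h.exp_log, inv_div]
      have h2 : (2 : ℝ) ≤ Real.exp L := by
        have h3 : (2 : ℝ) ≤ T := by exact_mod_cast h.T_ge
        exact h3.trans h.T_le_exp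
      have h3 : Real.exp (-(6 * L)) = Real.exp L * Real.exp (-(7 * L)) := by
        rw [← Real.exp_add]; congr 1; ring
      have h4 : Real.exp (-(6 * L)) ≤ Real.exp (-L) := Real.exp_le_exp.2 (by linarith)
      rw [e]
      nlinarith [Real.exp_pos (-(7 * L))]

end LinSetting

end OfulGuarantee

section MasterMeasurability

open Matrix

/-! ## The good event of a MASTER run -/

/-- The transcript of one outcome. -/
def runTranscript {Ω : Type u} {P : Type v} (coin : ℕ → ℕ → Ω → unitInterval)
    (pol : ℕ → Ω → P) (rew : ℕ → Ω → ℝ) (ω : Ω) : Transcript P :=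
  ⟨fun s m => coin s m ω, (pol · ω), (rew · ω)⟩

lemma start_le_subStart (B : Block) (m t : ℕ) : B.start ≤ subStart B m t := Nat.le_add_right _ _

lemma subStart_le {B : Block} {t : ℕ} (m : ℕ) (h : B.start ≤ t) : subStart B m t ≤ t := by
  have := Nat.div_mul_le_self (t - B.start) (2 ^ m)
  rw [subStart]; omega

variable {Ω : Type u} [mΩ : MeasurableSpace Ω] {P : Type v} [MeasurableSpace P]
  {alg : BaseAlg P} {δ : ℝ} {ρ : ℕ → ℝ} {μ : Measure Ω}
  {G : Filtration ℕ mΩ} {T : ℕ} {f : ℕ → P → ℝ} {coin : ℕ → ℕ → Ω → unitInterval}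
  {pol : ℕ → Ω → P} {rew : ℕ → Ω → ℝ}

lemma measurableSet_scheduled (hM : IsMasterRun alg δ ρ μ G T f coin pol rew) (B : Block)
    {s : ℕ} (hs : s ∈ Finset.Icc 1 T) (m : ℕ) :
    MeasurableSet[G s] {ω | Scheduled ρ (runTranscript coin pol rew ω) B s m} := by
  have h1 : MeasurableSet[G s] {ω | (coin s m ω : ℝ) ≤ ρ (2 ^ B.order) / ρ (2 ^ m)} :=
    hM.coin_meas s hs m (measurableSet_coin_le _)
  by_cases h : m ≤ B.order ∧ B.start ≤ s ∧ s < B.start + 2 ^ B.order ∧ 2 ^ m ∣ s - B.start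
  · convert h1 using 1
    ext ω
    simp [Scheduled, runTranscript, h]
  · convert MeasurableSet.empty using 1
    ext ω
    simp only [Set.mem_ofPred_eq, Set.mem_empty_iff_false, iff_false]
    exact fun hS => h ⟨hS.1, hS.2.1, hS.2.2.1, hS.2.2.2.1⟩

/-- For a fixed block, the active instance of round `t` depends only on coins of rounds up to `t`;
this makes the rounds of an instance a predictable selection. -/
lemma measurable_activeInst (hM : IsMasterRun alg δ ρ μ G T f coin pol rew) {B : Block}
    (hB : 1 ≤ B.start) {t t' : ℕ} (h1 : B.start ≤ t) (h2 : t ≤ T) (htt : t ≤ t') :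
    Measurable[G t'] fun ω => activeInst ρ (runTranscript coin pol rew ω) B t := by
  have hS : ∀ m, MeasurableSet[G t']
      {ω | Scheduled ρ (runTranscript coin pol rew ω) B (subStart B m t) m} := fun m => by
    have := subStart_le m h1
    have := start_le_subStart B m t
    exact G.mono (by omega) _ (measurableSet_scheduled hM B (by simp; omega) m)
  have ho : Measurable[G t'] fun ω => activeOrder ρ (runTranscript coin pol rew ω) B t := by
    refine measurable_of_Iic fun k => ?_
    -- The second set accounts for outcomes with no scheduled order, where the infimum of the empty
    -- set is 0.
    have e : (fun ω => activeOrder ρ (runTranscript coin pol rew ω) B t) ⁻¹' Set.Iic k =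
        (⋃ m ∈ Set.Iic k,
          {ω | Scheduled ρ (runTranscript coin pol rew ω) B (subStart B m t) m}) ∪
        ⋂ m, {ω | Scheduled ρ (runTranscript coin pol rew ω) B (subStart B m t) m}ᶜ := by
      ext ω
      simp only [Set.mem_preimage, Set.mem_Iic, Set.mem_union, Set.mem_iUnion, Set.mem_iInter,
        Set.mem_compl_iff, Set.mem_ofPred_eq, activeOrder, exists_prop]
      set S := {m | Scheduled ρ (runTranscript coin pol rew ω) B (subStart B m t) m} with hSd
      rcases S.eq_empty_or_nonempty with he | hne
      · have : ∀ m, ¬ Scheduled ρ (runTranscript coin pol rew ω) B (subStart B m t) m :=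
          fun m hm => by
            have : m ∈ S := hm
            rw [he] at this; exact this
        simp [he, this]
      · constructor
        · exact fun h => Or.inl ⟨sInf S, h, Nat.sInf_mem hne⟩
        · rintro (⟨m, hm, hmS⟩ | h)
          · exact (Nat.sInf_le (show m ∈ S from hmS)).trans hm
          · obtain ⟨m, hm⟩ := hne
            exact absurd hm (h m)
    rw [e]
    exact (MeasurableSet.biUnion (Set.to_countable _) fun m _ => hS m).union
      (MeasurableSet.iInter fun m => (hS m).compl)
  exact (measurable_of_countable fun m => (subStart B m t, m)).comp ho

end MasterMeasurability

/-! ### Paths on which every concentration bound holds -/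

section GoodPath

open Matrix

variable {d T : ℕ} {δ : ℝ} {A : Set (EuclideanSpace ℝ (Fin d))}
  {θ : ℕ → EuclideanSpace ℝ (Fin d)}

lemma instHistory_eq (ρ : ℕ → ℝ) (x : Transcript A) (B : Block) (t : ℕ) :
    instHistory ρ x B t =
      selHistory (fun τ => activeInst ρ x B τ = activeInst ρ x B t) x.pol x.rew B.start t := by
  rw [instHistory, selHistory]
  congr!

variable (T δ θ) in
/-- In block `⟨u, n⟩`, an earlier round of the label class of `s` has an estimate that is too low
for the resolution of an order-`m` instance. -/
def Candidate (κ : ℕ → ℕ) (x : Transcript A) (u n m s : ℕ) : Prop :=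
  ∃ τ ∈ Finset.Ico u s, κ τ = κ s ∧
    11 * rhoHat T δ (ofulRho 100 d T δ) (2 ^ m) <
      optReward (linReward A θ) τ -
        malgEst (oful A T δ) (ofulRho 100 d T δ) x ⟨u, n⟩ τ

/-- Starting rounds after `u` of the order-`m` sub-intervals that end before round `e` and do not
leave their label class. -/
def probeRounds (κ : ℕ → ℕ) (u m e : ℕ) : Finset ℕ :=
  (Finset.Ioo u e).filter fun s => 2 ^ m ∣ s - u ∧ s + 2 ^ m ≤ e ∧ κ (s + 2 ^ m - 1) = κ s

/-- Starting rounds after `s` and up to `e` of the order-`m` sub-intervals of a block that starts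
in round `u`. -/
def gridRounds (u m s e : ℕ) : Finset ℕ := (Finset.Ioc s e).filter fun s' => 2 ^ m ∣ s' - u

open Classical in
variable (T δ θ) in
/-- The concentration properties of a realization on which the regret analysis rests. -/
structure GoodPath (κ : ℕ → ℕ) (x : Transcript A) : Prop where
  noise : ∀ s ∈ Finset.Icc 1 T, ∀ t ∈ Finset.Icc 1 T, s ≤ t →
    |∑ τ ∈ Finset.Icc s t, pathNoise θ x.pol x.rew τ| ≤
      4 * √((t - s + 1 : ℕ) * Real.log (T / δ))
  conf : ∀ u ∈ Finset.Icc 1 T, ∀ n ∈ Finset.range T, ∀ s ∈ Finset.Icc 1 T,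
    ∀ m ∈ Finset.range T, ∀ t ∈ Finset.Icc 1 T, u ≤ t →
    selfNorm θ (fun τ => activeInst (ofulRho 100 d T δ) x ⟨u, n⟩ τ = (s, m)) x.pol x.rew u t ≤
      18 * (d * Real.log (T / δ))
  count : ∀ u ∈ Finset.Icc 1 T, ∀ n ∈ Finset.range T, ∀ m ∈ Finset.range T,
    ∀ s ∈ Finset.Icc 1 T, ∀ e ∈ Finset.Icc 1 T, m ≤ n →
    ((((gridRounds u m s e).filter fun s' =>
      (x.coin s' m : ℝ) ≤ ofulRho 100 d T δ (2 ^ n) / ofulRho 100 d T δ (2 ^ m)).card : ℕ) : ℝ) <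
      2 * (ofulRho 100 d T δ (2 ^ n) / ofulRho 100 d T δ (2 ^ m)) * (gridRounds u m s e).card +
        8 * Real.log (T / δ)
  hit : ∀ u ∈ Finset.Icc 1 T, ∀ n ∈ Finset.range T, ∀ m ∈ Finset.range T,
    ∀ e ∈ Finset.Icc 1 T, m ≤ n →
    (∀ s ∈ probeRounds κ u m e, Candidate T δ θ κ x u n m s →
      ofulRho 100 d T δ (2 ^ n) / ofulRho 100 d T δ (2 ^ m) < (x.coin s m : ℝ)) →
    ofulRho 100 d T δ (2 ^ n) / ofulRho 100 d T δ (2 ^ m) *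
      (((probeRounds κ u m e).filter fun s => Candidate T δ θ κ x u n m s).card : ℝ) <
        8 * Real.log (T / δ)

variable {Ω : Type u} [mΩ : MeasurableSpace Ω] {μ : Measure Ω} [IsProbabilityMeasure μ]
  {G : Filtration ℕ mΩ} {coin : ℕ → ℕ → Ω → unitInterval} {pol : ℕ → Ω → A} {rew : ℕ → Ω → ℝ}

namespace LinSetting

/-- The action set may be uncountable, but the index is continuous in the action, so its supremum is
that over a countable dense subset. -/
lemma measurable_oful_est (h : LinSetting d T δ A θ) {Ω : Type*} {m : MeasurableSpace Ω}
    {sel : ℕ → Ω → Prop} {pol : ℕ → Ω → A} {rew : ℕ → Ω → ℝ} {s t : ℕ}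
    (hb : ∀ τ ∈ Finset.Ico s t, ∀ i, Measurable fun ω => selVec (sel · ω) (pol · ω) τ i)
    (hr : ∀ τ ∈ Finset.Ico s t, Measurable (rew τ)) :
    Measurable fun ω => (oful A T δ).est (selHistory (sel · ω) (pol · ω) (rew · ω) s t) := by
  obtain ⟨S, hSc, hSd⟩ := TopologicalSpace.exists_countable_dense A
  have := hSc.to_subtype
  have hcont : ∀ ω, Continuous fun a : A =>
      ofulIndex T δ (selHistory (sel · ω) (pol · ω) (rew · ω) s t) a := fun ω => by
    have hc : Continuous fun a : A => a.1.ofLp := by fun_prop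
    simp only [ofulIndex_selHistory, invForm]
    exact (hc.dotProduct continuous_const).add (continuous_const.mul
      (hc.dotProduct (continuous_const.matrix_mulVec hc)).sqrt)
  have e : ∀ ω, (oful A T δ).est (selHistory (sel · ω) (pol · ω) (rew · ω) s t) =
      max 0 (min 1 (⨆ a : S,
        ofulIndex T δ (selHistory (sel · ω) (pol · ω) (rew · ω) s t) a)) := fun ω => by
    rw [hSd.ciSup' (hcont ω)]
    rfl
  simp only [e]
  refine measurable_const.max (measurable_const.min (Measurable.iSup fun a => ?_))
  simp only [ofulIndex_selHistory]
  have hg := measurable_gramSeq hb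
  refine Measurable.add (measurable_invForm (x := fun _ => a.1.1.ofLp) (y := fun ω => ∑ τ ∈ Finset.Ico s t,
    rew τ ω • selVec (sel · ω) (pol · ω) τ) hg (fun i => measurable_const) fun i => ?_)
    ((measurable_invForm (x := fun _ => a.1.1.ofLp) (y := fun _ => a.1.1.ofLp) hg
      (fun i => measurable_const) fun i => measurable_const).sqrt.const_mul _)
  simp only [Finset.sum_apply, Pi.smul_apply, smul_eq_mul]
  exact Finset.measurable_fun_sum _ fun τ hτ => (hr τ hτ).mul (hb τ hτ i)

variable {ρ : ℕ → ℝ}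

lemma measurable_malgEst (h : LinSetting d T δ A θ)
    (hM : IsMasterRun (oful A T δ) δ ρ μ G T (linReward A θ) coin pol rew) {B : Block}
    (hB : 1 ≤ B.start) {t : ℕ} (h1 : B.start ≤ t) (h2 : t ≤ T) :
    Measurable[G t] fun ω => malgEst (oful A T δ) ρ (runTranscript coin pol rew ω) B t := by
  simp only [malgEst, instHistory_eq]
  refine h.measurable_oful_est (sel := fun τ ω =>
    activeInst ρ (runTranscript coin pol rew ω) B τ =
      activeInst ρ (runTranscript coin pol rew ω) B t) (pol := pol) (rew := rew)
    (fun τ hτ i => ?_) fun τ hτ => ?_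
  · have hτ' := Finset.mem_Ico.1 hτ
    exact measurable_selVec (sel := fun τ ω =>
      activeInst ρ (runTranscript coin pol rew ω) B τ =
        activeInst ρ (runTranscript coin pol rew ω) B t) hM.interaction (by simp; omega) hτ'.2.le
      (measurableSet_eq_fun (measurable_activeInst hM hB hτ'.1 (by omega) hτ'.2.le)
        (measurable_activeInst hM hB h1 h2 le_rfl)) i
  · have hτ' := Finset.mem_Ico.1 hτ
    exact (hM.interaction.rew_meas τ (by simp; omega)).mono (G.mono (by omega)) le_rfl

/-- Whether round `t + 1` is a candidate is known before its coins are drawn: it involves estimates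
of rounds up to `t` only, and the estimate of round `t` uses earlier rewards. -/
lemma measurableSet_candidate (h : LinSetting d T δ A θ)
    (hM : IsMasterRun (oful A T δ) δ (ofulRho 100 d T δ) μ G T (linReward A θ) coin pol rew)
    (κ : ℕ → ℕ) {u t : ℕ} (hu : 1 ≤ u) (ht : t ≤ T) (n m : ℕ) :
    MeasurableSet[G t]
      {ω | Candidate T δ θ κ (runTranscript coin pol rew ω) u n m (t + 1)} := by
  have e : {ω | Candidate T δ θ κ (runTranscript coin pol rew ω) u n m (t + 1)} =
      ⋃ τ ∈ (Finset.Ico u (t + 1)).filter (fun τ => κ τ = κ (t + 1)),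
        {ω | 11 * rhoHat T δ (ofulRho 100 d T δ) (2 ^ m) < optReward (linReward A θ) τ -
          malgEst (oful A T δ) (ofulRho 100 d T δ) (runTranscript coin pol rew ω) ⟨u, n⟩ τ} := by
    ext ω
    simp only [Candidate, Set.mem_ofPred_eq, Set.mem_iUnion, Finset.mem_filter, exists_prop]
    exact ⟨fun ⟨τ, a, b, c⟩ => ⟨τ, ⟨a, b⟩, c⟩, fun ⟨τ, ⟨a, b⟩, c⟩ => ⟨τ, a, b, c⟩⟩
  rw [e]
  refine Finset.measurableSet_biUnion _ fun τ hτ => ?_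
  have hτ' := Finset.mem_Ico.1 (Finset.mem_filter.1 hτ).1
  refine measurableSet_lt measurable_const (measurable_const.sub ?_)
  exact (h.measurable_malgEst hM (B := ⟨u, n⟩) hu hτ'.1 (by omega)).mono (G.mono (by omega)) le_rfl

lemma ofulRho_ratio_mem (h : LinSetting d T δ A θ) {m n : ℕ} (hmn : m ≤ n) :
    ofulRho 100 d T δ (2 ^ n) / ofulRho 100 d T δ (2 ^ m) ∈ Set.Icc (0 : ℝ) 1 := by
  have h1 := h.ofulRho_pos (Nat.one_le_two_pow (n := n))
  have h2 := h.ofulRho_pos (Nat.one_le_two_pow (n := m))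
  exact ⟨by positivity, (div_le_one h2).2
    (h.ofulRho_le Nat.one_le_two_pow (Nat.pow_le_pow_right (by norm_num) hmn))⟩

/-- A MASTER run is a good path with high probability. -/
theorem measure_not_goodPath_le (h : LinSetting d T δ A θ)
    (hM : IsMasterRun (oful A T δ) δ (ofulRho 100 d T δ) μ G T (linReward A θ) coin pol rew)
    (κ : ℕ → ℕ) :
    μ {ω | ¬ GoodPath T δ θ κ (runTranscript coin pol rew ω)} ≤ ENNReal.ofReal δ := by
  classical
  set L := Real.log (T / δ) with hLd
  have hL := h.log_ge
  -- Every index range has at most T ≤ e^L elements, so each nested existential below lowers the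
  -- exponent of the tail bound by one.
  have hcI : ((Finset.Icc 1 T).card : ℝ) ≤ Real.exp L := by
    rw [Nat.card_Icc, Nat.add_sub_cancel]; exact h.T_le_exp
  have hcr : ((Finset.range T).card : ℝ) ≤ Real.exp L := by
    rw [Finset.card_range]; exact h.T_le_exp
  set x := runTranscript coin pol rew with hx
  set q : ℕ → ℕ → ℝ := fun n m => ofulRho 100 d T δ (2 ^ n) / ofulRho 100 d T δ (2 ^ m) with hq
  have hI := hM.interaction
  -- noise
  have b1 : μ {ω | ∃ s ∈ Finset.Icc 1 T, ω ∈ {ω | ∃ t ∈ Finset.Icc 1 T, ω ∈ {ω | s ≤ t ∧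
      ¬ |∑ τ ∈ Finset.Icc s t, pathNoise θ (pol · ω) (rew · ω) τ| ≤
        4 * √((t - s + 1 : ℕ) * L)}}} ≤ ENNReal.ofReal (Real.exp (-(5 * L))) := by
    refine measure_exists_le_exp hcI fun s hs => measure_exists_le_exp hcI fun t ht => ?_
    rw [show (5 + 1 + 1 : ℝ) = 7 by norm_num]
    by_cases hst : s ≤ t
    · refine (measure_mono fun ω hω => ?_).trans
        (h.measure_sum_noise_le hI (Finset.mem_Icc.1 hs).1 hst (Finset.mem_Icc.1 ht).2)
      exact hω.2
    · simp [hst]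
  -- confidence sets
  have b2 : μ {ω | ∃ u ∈ Finset.Icc 1 T, ω ∈ {ω | ∃ n ∈ Finset.range T, ω ∈
      {ω | ∃ s ∈ Finset.Icc 1 T, ω ∈ {ω | ∃ m ∈ Finset.range T, ω ∈ {ω | ∃ t ∈ Finset.Icc 1 T,
        ω ∈ {ω | u ≤ t ∧ ¬ selfNorm θ
          (fun τ => activeInst (ofulRho 100 d T δ) (x ω) ⟨u, n⟩ τ = (s, m))
          (pol · ω) (rew · ω) u t ≤ 18 * (d * L)}}}}}} ≤
        ENNReal.ofReal (Real.exp (-(3 * L))) := by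
    -- The block that MASTER is in is random. For each fixed block and instance the selection is
    -- predictable, so all of them are treated by a union bound.
    refine measure_exists_le_exp hcI fun u hu => measure_exists_le_exp hcr fun n _ =>
      measure_exists_le_exp hcI fun s _ => measure_exists_le_exp hcr fun m _ =>
      measure_exists_le_exp hcI fun t ht => ?_
    rw [show (3 + 1 + 1 + 1 + 1 + 1 : ℝ) = 8 by norm_num]
    have hu1 := (Finset.mem_Icc.1 hu).1
    have htT := (Finset.mem_Icc.1 ht).2
    by_cases hut : u ≤ t
    · refine (measure_mono fun ω hω => ?_).trans (h.measure_selfNorm_le hI (sel := fun τ ω =>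
        activeInst (ofulRho 100 d T δ) (x ω) ⟨u, n⟩ τ = (s, m)) hu1 hut htT fun τ hτ => ?_)
      · exact hω.2
      · have hτ' := Finset.mem_Ico.1 hτ
        exact measurable_activeInst hM (B := ⟨u, n⟩) hu1 hτ'.1 (by omega) le_rfl
          (measurableSet_singleton (s, m))
    · simp [hut]
  -- number of scheduled instances
  have b3 : μ {ω | ∃ u ∈ Finset.Icc 1 T, ω ∈ {ω | ∃ n ∈ Finset.range T, ω ∈
      {ω | ∃ m ∈ Finset.range T, ω ∈ {ω | ∃ s ∈ Finset.Icc 1 T, ω ∈ {ω | ∃ e ∈ Finset.Icc 1 T,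
        ω ∈ {ω | m ≤ n ∧ 2 * q n m * (gridRounds u m s e).card + 8 * L ≤
          (((gridRounds u m s e).filter fun s' => (coin s' m ω : ℝ) ≤ q n m).card : ℝ)}}}}}} ≤
        ENNReal.ofReal (Real.exp (-(3 * L))) := by
    refine measure_exists_le_exp hcI fun u hu => measure_exists_le_exp hcr fun n _ =>
      measure_exists_le_exp hcr fun m _ => measure_exists_le_exp hcI fun s hs =>
      measure_exists_le_exp hcI fun e he => ?_
    rw [show (3 + 1 + 1 + 1 + 1 + 1 : ℝ) = 8 by norm_num]
    by_cases hmn : m ≤ n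
    · have hr := h.ofulRho_ratio_mem hmn
      refine (measure_mono fun ω hω => ?_).trans (measure_card_coin_le hM m hr.1 hr.2
        (D := gridRounds u m s e) (fun s' hs' => ?_) _)
      · exact hω.2
      · have h1 := Finset.mem_Ioc.1 (Finset.mem_filter.1 hs').1
        have h2 := Finset.mem_Icc.1 hs
        have h3 := Finset.mem_Icc.1 he
        simp; omega
    · simp [hmn]
  -- probes
  have b4 : μ {ω | ∃ u ∈ Finset.Icc 1 T, ω ∈ {ω | ∃ n ∈ Finset.range T, ω ∈
      {ω | ∃ m ∈ Finset.range T, ω ∈ {ω | ∃ e ∈ Finset.Icc 1 T, ω ∈ {ω | m ≤ n ∧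
        (∀ s ∈ probeRounds κ u m e, ω ∈ {ω | Candidate T δ θ κ (x ω) u n m s} →
          q n m < (coin s m ω : ℝ)) ∧
        8 * L ≤ q n m * (((probeRounds κ u m e).filter fun s =>
          ω ∈ {ω | Candidate T δ θ κ (x ω) u n m s}).card : ℝ)}}}}} ≤
        ENNReal.ofReal (Real.exp (-(4 * L))) := by
    refine measure_exists_le_exp hcI fun u hu => measure_exists_le_exp hcr fun n _ =>
      measure_exists_le_exp hcr fun m _ => measure_exists_le_exp hcI fun e he => ?_
    rw [show (4 + 1 + 1 + 1 + 1 : ℝ) = 8 by norm_num]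
    have hu1 := (Finset.mem_Icc.1 hu).1
    by_cases hmn : m ≤ n
    · have hr := h.ofulRho_ratio_mem hmn
      refine (measure_mono fun ω hω => ?_).trans (measure_forall_miss_le hM m hr.1 hr.2
        (D := probeRounds κ u m e) (fun s' hs' => ?_)
        (cand := fun s => {ω | Candidate T δ θ κ (x ω) u n m s}) (fun t ht _ =>
          h.measurableSet_candidate hM κ hu1 (by simp at ht; omega) n m) _)
      · refine ⟨hω.2.1, hω.2.2.trans (le_of_eq ?_)⟩
        congr!
      · have h1 := Finset.mem_Ioo.1 (Finset.mem_filter.1 hs').1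
        have h3 := Finset.mem_Icc.1 he
        simp; omega
    · simp [hmn]
  refine (measure_mono fun ω hω => ?_).trans ((measure_union_le _ _).trans (add_le_add
    ((measure_union_le _ _).trans (add_le_add b1 b2))
    ((measure_union_le _ _).trans (add_le_add b3 b4))) |>.trans ?_)
  · by_contra hn
    simp only [Set.mem_union, not_or] at hn
    obtain ⟨⟨n1, n2⟩, n3, n4⟩ := hn
    refine hω ⟨fun s hs t ht hst => ?_, fun u hu n hn s hs m hm t ht hut => ?_,
      fun u hu n hn m hm s hs e he hmn => ?_, fun u hu n hn m hm e he hmn hmiss => ?_⟩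
    · by_contra hc
      exact n1 ⟨s, hs, t, ht, hst, hc⟩
    · by_contra hc
      exact n2 ⟨u, hu, n, hn, s, hs, m, hm, t, ht, hut, hc⟩
    · by_contra hc
      refine n3 ⟨u, hu, n, hn, m, hm, s, hs, e, he, hmn, (not_lt.1 hc).trans (le_of_eq ?_)⟩
      congr!
    · by_contra hc
      refine n4 ⟨u, hu, n, hn, m, hm, e, he, hmn, hmiss, (not_lt.1 hc).trans (le_of_eq ?_)⟩
      congr!
  · simp only [← ENNReal.ofReal_add (Real.exp_pos _).le (Real.exp_pos _).le]
    rw [← ENNReal.ofReal_add (by positivity) (by positivity)]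
    refine ENNReal.ofReal_le_ofReal ?_
    have hT : (2 : ℝ) ≤ T := by exact_mod_cast h.T_ge
    -- The four failure probabilities add up to at most 4e^{−3L} ≤ e^{2L}e^{−3L} = δ/T.
    have e1 : Real.exp (-(5 * L)) ≤ Real.exp (-(3 * L)) := Real.exp_le_exp.2 (by linarith)
    have e2 : Real.exp (-(4 * L)) ≤ Real.exp (-(3 * L)) := Real.exp_le_exp.2 (by linarith)
    have e3 : Real.exp (-L) = Real.exp L * (Real.exp L * Real.exp (-(3 * L))) := by
      rw [← Real.exp_add, ← Real.exp_add]; congr 1; ring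
    have e4 : (2 : ℝ) ≤ Real.exp L := hT.trans h.T_le_exp
    have e5 : Real.exp (-L) ≤ δ := by
      rw [Real.exp_neg, h.exp_log, inv_div]
      exact div_le_self h.δ_pos.le (by linarith)
    have e6 := Real.exp_pos (-(3 * L))
    have e7 : 4 * Real.exp (-(3 * L)) ≤ Real.exp L * (Real.exp L * Real.exp (-(3 * L))) := by
      rw [← mul_assoc]
      exact mul_le_mul_of_nonneg_right (by nlinarith) e6.le
    linarith

end LinSetting

end GoodPath

section BlockStructure

/-! ## The block structure of MASTER -/

variable {P : Type v} (alg : BaseAlg P) (T : ℕ) (δ : ℝ) (ρ : ℕ → ℝ) (x : Transcript P)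

/-- A test fails at the end of round `t`. -/
def TestFails (B : Block) (t : ℕ) : Prop :=
  Test1Fails alg T δ ρ x B t ∨ Test2Fails alg T δ ρ x B t

variable {alg T δ ρ x}

open Classical in
lemma masterBlock_succ {t : ℕ} (ht : 1 ≤ t) : masterBlock alg T δ ρ x (t + 1) =
    if TestFails alg T δ ρ x (masterBlock alg T δ ρ x t) t then ⟨t + 1, 0⟩
    else if t + 1 = (masterBlock alg T δ ρ x t).start + 2 ^ (masterBlock alg T δ ρ x t).order
      then ⟨t + 1, (masterBlock alg T δ ρ x t).order + 1⟩
    else masterBlock alg T δ ρ x t := by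
  obtain ⟨t, rfl⟩ : ∃ s, t = s + 1 := ⟨t - 1, by omega⟩
  rw [masterBlock]
  by_cases h1 : TestFails alg T δ ρ x (masterBlock alg T δ ρ x (t + 1)) (t + 1)
  · rw [if_pos h1]
    exact if_pos h1
  · rw [if_neg h1]
    exact if_neg h1

lemma masterBlock_succ_cases {t : ℕ} (ht : 1 ≤ t) :
    (TestFails alg T δ ρ x (masterBlock alg T δ ρ x t) t ∧
      masterBlock alg T δ ρ x (t + 1) = ⟨t + 1, 0⟩) ∨
    (¬ TestFails alg T δ ρ x (masterBlock alg T δ ρ x t) t ∧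
      t + 1 = (masterBlock alg T δ ρ x t).start + 2 ^ (masterBlock alg T δ ρ x t).order ∧
      masterBlock alg T δ ρ x (t + 1) = ⟨t + 1, (masterBlock alg T δ ρ x t).order + 1⟩) ∨
    (¬ TestFails alg T δ ρ x (masterBlock alg T δ ρ x t) t ∧
      t + 1 ≠ (masterBlock alg T δ ρ x t).start + 2 ^ (masterBlock alg T δ ρ x t).order ∧
      masterBlock alg T δ ρ x (t + 1) = masterBlock alg T δ ρ x t) := by
  rw [masterBlock_succ ht]
  by_cases h1 : TestFails alg T δ ρ x (masterBlock alg T δ ρ x t) t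
  · exact Or.inl ⟨h1, by rw [if_pos h1]⟩
  by_cases h2 : t + 1 = (masterBlock alg T δ ρ x t).start + 2 ^ (masterBlock alg T δ ρ x t).order
  · exact Or.inr (Or.inl ⟨h1, h2, by rw [if_neg h1, if_pos h2]⟩)
  · exact Or.inr (Or.inr ⟨h1, h2, by rw [if_neg h1, if_neg h2]⟩)

/-- The bound of the length by the start holds because a block of order n + 1 follows a completed
block of length 2^n whose own start was at least 2^n. It keeps all orders below log₂ T. -/
lemma masterBlock_invariant {t : ℕ} (ht : 1 ≤ t) :
    1 ≤ (masterBlock alg T δ ρ x t).start ∧ (masterBlock alg T δ ρ x t).start ≤ t ∧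
    t < (masterBlock alg T δ ρ x t).start + 2 ^ (masterBlock alg T δ ρ x t).order ∧
    2 ^ (masterBlock alg T δ ρ x t).order ≤ (masterBlock alg T δ ρ x t).start ∧
    ∀ τ ∈ Finset.Icc (masterBlock alg T δ ρ x t).start t,
      masterBlock alg T δ ρ x τ = masterBlock alg T δ ρ x t := by
  induction t, ht using Nat.le_induction with
  | base =>
    have : masterBlock alg T δ ρ x 1 = ⟨1, 0⟩ := by rw [masterBlock]
    rw [this]
    refine ⟨le_rfl, le_rfl, by norm_num, by norm_num, fun τ hτ => ?_⟩
    have : τ = 1 := by simp at hτ; omega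
    subst this
    assumption
  | succ t ht ih =>
    obtain ⟨i1, i2, i3, i4, i5⟩ := ih
    rcases masterBlock_succ_cases (alg := alg) (T := T) (δ := δ) (ρ := ρ) (x := x) ht with
      ⟨-, e⟩ | ⟨-, h2, e⟩ | ⟨-, h2, e⟩
    · rw [e]
      refine ⟨by simp, le_rfl, by simp, by simp, fun τ hτ => ?_⟩
      have : τ = t + 1 := by simp at hτ; omega
      rw [this, e]
    · rw [e]
      refine ⟨by simp, le_rfl, by simp, ?_, fun τ hτ => ?_⟩
      · simp only [pow_succ]; omega
      · have : τ = t + 1 := by simp at hτ; omega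
        rw [this, e]
    · rw [e]
      refine ⟨i1, by omega, by omega, i4, fun τ hτ => ?_⟩
      rcases (Finset.mem_Icc.1 hτ).2.eq_or_lt with h | h
      · rw [h, e]
      · exact i5 τ (by simp at hτ ⊢; omega)

/-- A failed test would have opened a new block in the next round, so a block that is still running
has passed all its earlier tests. -/
lemma not_testFails_of_mem {t t' : ℕ} (ht : 1 ≤ t') (h1 : (masterBlock alg T δ ρ x t').start ≤ t)
    (h2 : t < t') : ¬ TestFails alg T δ ρ x (masterBlock alg T δ ρ x t') t := by
  obtain ⟨i1, i2, i3, i4, i5⟩ :=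
    masterBlock_invariant (alg := alg) (T := T) (δ := δ) (ρ := ρ) (x := x) ht
  have e1 := i5 t (by simp; omega)
  have e2 := i5 (t + 1) (by simp; omega)
  intro hf
  rcases masterBlock_succ_cases (alg := alg) (T := T) (δ := δ) (ρ := ρ) (x := x)
    (show 1 ≤ t by omega) with ⟨-, e⟩ | ⟨h3, -, -⟩ | ⟨h3, -, -⟩
  · rw [e2] at e
    rw [e] at h1
    simp at h1
  · rw [e1] at h3; exact h3 hf
  · rw [e1] at h3; exact h3 hf

lemma subStart_eq_of_mem {B : Block} {m s τ : ℕ} (hs : B.start ≤ s) (hd : 2 ^ m ∣ s - B.start)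
    (h1 : s ≤ τ) (h2 : τ < s + 2 ^ m) : subStart B m τ = s := by
  obtain ⟨k, hk⟩ := hd
  have hp : 0 < 2 ^ m := by positivity
  have : (τ - B.start) / 2 ^ m = k := by
    apply Nat.div_eq_of_lt_le
    · rw [mul_comm]; omega
    · rw [Nat.succ_mul, mul_comm]; omega
  rw [subStart, this, mul_comm]; omega

lemma le_subStart {B : Block} {m s τ : ℕ} (hs : B.start ≤ s) (hd : 2 ^ m ∣ s - B.start)
    (h1 : s ≤ τ) : s ≤ subStart B m τ := by
  obtain ⟨k, hk⟩ := hd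
  have hp : 0 < 2 ^ m := by positivity
  have : k ≤ (τ - B.start) / 2 ^ m := by
    rw [Nat.le_div_iff_mul_le hp, mul_comm]; omega
  have := Nat.mul_le_mul_right (2 ^ m) this
  rw [mul_comm] at this
  rw [subStart]; omega

lemma lt_subStart_add {B : Block} (m : ℕ) {τ : ℕ} (h : B.start ≤ τ) :
    τ < subStart B m τ + 2 ^ m := by
  have := Nat.lt_div_mul_add (a := τ - B.start) (b := 2 ^ m) (by positivity)
  rw [subStart]; omega

/-- The active instance of a round that is covered by a scheduled order-`m` instance. -/
lemma activeInst_spec {B : Block} {s m τ : ℕ} (hS : Scheduled ρ x B s m) (h1 : s ≤ τ)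
    (h2 : τ < s + 2 ^ m) :
    (activeInst ρ x B τ).2 ≤ m ∧ s ≤ (activeInst ρ x B τ).1 ∧
    (activeInst ρ x B τ).1 ≤ τ ∧ τ < (activeInst ρ x B τ).1 + 2 ^ (activeInst ρ x B τ).2 ∧
    Scheduled ρ x B (activeInst ρ x B τ).1 (activeInst ρ x B τ).2 := by
  have hm : m ∈ {m | Scheduled ρ x B (subStart B m τ) m} := by
    simpa [subStart_eq_of_mem hS.2.1 hS.2.2.2.1 h1 h2] using hS
  have ho : activeOrder ρ x B τ ≤ m := Nat.sInf_le hm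
  have hin : Scheduled ρ x B (subStart B (activeOrder ρ x B τ) τ) (activeOrder ρ x B τ) :=
    Nat.sInf_mem ⟨m, hm⟩
  have hst : B.start ≤ τ := hS.2.1.trans h1
  exact ⟨ho, le_subStart hS.2.1 ((Nat.pow_dvd_pow 2 ho).trans hS.2.2.2.1) h1,
    subStart_le _ hst, lt_subStart_add _ hst, hin⟩

lemma mem_of_activeInst_eq {B : Block} {i : ℕ × ℕ} {τ : ℕ} (hτ : B.start ≤ τ)
    (h : activeInst ρ x B τ = i) : i.1 ≤ τ ∧ τ < i.1 + 2 ^ i.2 := by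
  rw [← h]
  exact ⟨subStart_le _ hτ, lt_subStart_add _ hτ⟩

lemma card_gridRounds_le {u m s e : ℕ} (hu : u ≤ s) (hd : 2 ^ m ∣ s - u) :
    (gridRounds u m s e).card ≤ (e - s) / 2 ^ m := by
  rw [← Nat.Ioc_filter_dvd_card_eq_div]
  refine Finset.card_le_card_of_injOn (fun s' => s' - s) (fun s' hs' => ?_) fun a ha b hb hab => ?_
  · have h1 := Finset.mem_filter.1 hs'
    have h2 := Finset.mem_Ioc.1 h1.1
    simp only [Finset.coe_filter, Finset.mem_Ioc, Set.mem_ofPred_eq]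
    refine ⟨by omega, ?_⟩
    rw [show s' - s = (s' - u) - (s - u) by omega]
    exact Nat.dvd_sub h1.2 hd
  · have h1 := Finset.mem_Ioc.1 (Finset.mem_filter.1 ha).1
    have h2 := Finset.mem_Ioc.1 (Finset.mem_filter.1 hb).1
    simp only at hab
    omega

end BlockStructure

/-! ### Near-stationary intervals on a good path -/

section PathAnalysis

open Matrix

variable {d T : ℕ} {δ : ℝ} {A : Set (EuclideanSpace ℝ (Fin d))}
  {θ : ℕ → EuclideanSpace ℝ (Fin d)} {κ : ℕ → ℕ} {x : Transcript A}

/-- Number of scales, `n̂ = log₂ T + 1`. -/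
noncomputable def numScales (T : ℕ) : ℝ := Real.logb 2 T + 1

lemma add_one_le_numScales {n : ℕ} (h : 2 ^ n ≤ T) : (n : ℝ) + 1 ≤ numScales T := by
  have h1 : (2 : ℝ) ^ n ≤ T := by exact_mod_cast h
  have h2 : (n : ℝ) ≤ Real.logb 2 T := by
    rw [Real.le_logb_iff_rpow_le (by norm_num) (lt_of_lt_of_le (by positivity) h1)]
    exact_mod_cast h1
  rw [numScales]; linarith

lemma two_le_numScales (h : 2 ≤ T) : 2 ≤ numScales T := by
  have := add_one_le_numScales (T := T) (n := 1) (by simpa using h)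
  norm_num at this
  exact this

variable (T δ θ κ x) in
/-- A good realization of a MASTER run, together with a monotone labelling `κ` of the rounds whose
classes are near-stationary. -/
structure MasterPath : Prop where
  good : GoodPath T δ θ κ x
  follows : ∀ t ∈ Finset.Icc 1 T, x.pol t ∈ (oful A T δ).choices (instHistory
    (ofulRho 100 d T δ) x (masterBlock (oful A T δ) T δ (ofulRho 100 d T δ) x t) t)
  rew_mem : ∀ t ∈ Finset.Icc 1 T, x.rew t ∈ Set.Icc (0 : ℝ) 1
  mono : Monotone κ
  stat : ∀ s e, 1 ≤ s → s ≤ e → e ≤ T → κ s = κ e →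
    drift (ofulDelta 400 T δ θ) s e ≤ ofulRho 100 d T δ (e - s + 1)

namespace LinSetting

lemma rhoHat_eq (h : LinSetting d T δ A θ) (t : ℕ) :
    rhoHat T δ (ofulRho 100 d T δ) t =
      2400 * (numScales T * Real.log (T / δ) * (d * Real.log (T / δ))) / √t := by
  rw [rhoHat, h.ofulRho_eq, numScales]; ring

lemma eight_mul_rho_le (h : LinSetting d T δ A θ) {t : ℕ} (ht : 1 ≤ t) :
    8 * ofulRho 100 d T δ t ≤ rhoHat T δ (ofulRho 100 d T δ) t := by
  have h1 := (h.ofulRho_pos ht).le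
  have h2 := two_le_numScales h.T_ge
  have h3 := h.log_ge
  rw [rhoHat]
  change _ ≤ 6 * numScales T * _ * _
  refine mul_le_mul_of_nonneg_right ?_ h1
  nlinarith

lemma sqrt_mul_log_le (h : LinSetting d T δ A θ) (n : ℕ) :
    4 * √(n * Real.log (T / δ)) ≤ 5 * (d * Real.log (T / δ)) * √n := by
  have hL := h.log_ge
  have hd := h.d_cast
  rw [Real.sqrt_mul (by positivity)]
  have h4 : √(Real.log (T / δ)) ≤ 1.25 * (d * Real.log (T / δ)) := by
    refine Real.sqrt_le_iff.2 ⟨by positivity, ?_⟩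
    have h8 : Real.log (T / δ) ≤ d * Real.log (T / δ) := le_mul_of_one_le_left (by linarith) hd
    nlinarith
  nlinarith [Real.sqrt_nonneg (n : ℝ)]

lemma ofulRho_ratio_eq (h : LinSetting d T δ A θ) (m n : ℕ) :
    ofulRho 100 d T δ (2 ^ n) / ofulRho 100 d T δ (2 ^ m) =
      √((2 : ℝ) ^ m) / √((2 : ℝ) ^ n) := by
  have hL := h.log_ge
  have hd := h.d_cast
  rw [h.ofulRho_eq, h.ofulRho_eq]
  push_cast
  have h1 : (0 : ℝ) < √((2 : ℝ) ^ m) := by positivity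
  have h2 : (0 : ℝ) < √((2 : ℝ) ^ n) := by positivity
  field_simp

/-- The estimates and the regret of the rounds covered by a scheduled instance in a near-stationary
interval: contribution of one instance. -/
lemma inst_regret (h : LinSetting d T δ A θ) (hx : MasterPath T δ θ κ x) {u n m s e : ℕ}
    (hu : 1 ≤ u) (hse : s ≤ e) (heT : e ≤ T) (hnT : n < T)
    (hB : ∀ τ ∈ Finset.Icc s e,
      masterBlock (oful A T δ) T δ (ofulRho 100 d T δ) x τ = ⟨u, n⟩)
    (hS : Scheduled (ofulRho 100 d T δ) x ⟨u, n⟩ s m) (hem : e < s + 2 ^ m)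
    (hdr : drift (ofulDelta 400 T δ θ) s e ≤ ofulRho 100 d T δ (e - s + 1)) (i : ℕ × ℕ)
    (hi : i ∈ (Finset.Icc s e).image (activeInst (ofulRho 100 d T δ) x ⟨u, n⟩)) :
    (∀ τ ∈ Finset.Icc s e, activeInst (ofulRho 100 d T δ) x ⟨u, n⟩ τ = i →
      optReward (linReward A θ) τ ≤
        malgEst (oful A T δ) (ofulRho 100 d T δ) x ⟨u, n⟩ τ) ∧
    ∑ τ ∈ (Finset.Icc s e).filter (fun τ => activeInst (ofulRho 100 d T δ) x ⟨u, n⟩ τ = i),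
      (malgEst (oful A T δ) (ofulRho 100 d T δ) x ⟨u, n⟩ τ - linReward A θ τ (x.pol τ)) ≤
      32 * (d * Real.log (T / δ)) * √(min (2 ^ i.2) (e - s + 1) : ℕ) := by
  classical
  set ρ := ofulRho 100 d T δ with hρ
  have hus : u ≤ s := hS.2.1
  have hmn : m ≤ n := hS.1
  set sel : ℕ → Prop := fun τ => activeInst ρ x ⟨u, n⟩ τ = i with hsel
  obtain ⟨τ0, hτ0, hτi⟩ := Finset.mem_image.1 hi
  have hτ0' := Finset.mem_Icc.1 hτ0
  have hspec := activeInst_spec hS hτ0'.1 (by omega : τ0 < s + 2 ^ m)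
  rw [hτi] at hspec
  obtain ⟨hi2, hi1, hi3, -, -⟩ := hspec
  -- Dyadic nesting: an instance active under the covering one starts at `s` or later. So all its
  -- data up to `e` lie in [s, e], where the drift is small.
  have hcard : ∀ t ≤ e + 1, ((Finset.Ico u t).filter fun τ => selVec sel x.pol τ ≠ 0).card ≤
      min (2 ^ i.2) (e - s + 1) := fun t ht => by
    have hsub : ((Finset.Ico u t).filter fun τ => selVec sel x.pol τ ≠ 0) ⊆
        Finset.Ico i.1 (min (i.1 + 2 ^ i.2) (e + 1)) := fun τ hτ => by
      have h1 := Finset.mem_filter.1 hτ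
      have h2 := Finset.mem_Ico.1 h1.1
      have h3 : sel τ := by
        by_contra hc; exact h1.2 (by simp [selVec, hc])
      have := mem_of_activeInst_eq (B := ⟨u, n⟩) h2.1 h3
      simp only [Finset.mem_Ico]; omega
    refine (Finset.card_le_card hsub).trans ?_
    rw [Nat.card_Ico]
    exact le_min ((Nat.sub_le_sub_right (min_le_left _ _) _).trans (by simp))
      ((Nat.sub_le_sub_right (min_le_right _ _) _).trans (by omega))
  have hD := h.sum_norm_mul_sqrt_le (by omega : 1 ≤ e - s + 1) hdr
  have hDD : ∀ τ ∈ Finset.Icc s e, ∀ τ' ∈ Finset.Ico u τ, sel τ' →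
      ‖θ τ' - θ τ‖ ≤ ∑ j ∈ Finset.Ico s e, ‖θ j - θ (j + 1)‖ := fun τ hτ τ' hτ' hs => by
    have h1 := mem_of_activeInst_eq (B := ⟨u, n⟩) (Finset.mem_Ico.1 hτ').1 hs
    exact norm_sub_le_sum (by omega) (Finset.mem_Ico.1 hτ').2.le (Finset.mem_Icc.1 hτ).2
  have key : ∀ τ ∈ Finset.Icc s e, sel τ → _ := fun τ hτ hs => by
    have hτ' := Finset.mem_Icc.1 hτ
    have hp := hx.follows τ (by simp; omega)
    rw [hB τ hτ, instHistory_eq] at hp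
    rw [show activeInst (ofulRho 100 d T δ) x ⟨u, n⟩ τ = i from hs] at hp
    exact h.est_bounds (sel := sel) (by simp; omega : τ ∈ Finset.Icc 1 T)
      (hx.good.conf u (by simp; omega) n (by simpa using hnT) i.1 (by simp; omega) i.2
        (by simp; omega) τ (by simp; omega) (by omega))
      (Finset.sum_nonneg fun j _ => norm_nonneg _) (hDD τ hτ)
      ((hcard τ (by omega)).trans (min_le_right _ _)) hD hp
  have hest : ∀ τ, sel τ → malgEst (oful A T δ) ρ x ⟨u, n⟩ τ =
      (oful A T δ).est (selHistory sel x.pol x.rew u τ) := fun τ hs => by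
    rw [malgEst, instHistory_eq, show activeInst ρ x ⟨u, n⟩ τ = i from hs]
  refine ⟨fun τ hτ hs => ?_, ?_⟩
  · rw [hest τ hs]; exact (key τ hτ hs).1
  · refine le_trans ?_ (h.sum_width_le sel x.pol (u := u) (t := e + 1) (by omega) (by omega)
      (hcard (e + 1) le_rfl))
    have hw : ∀ τ, 0 ≤ 4 * ofulBeta d T δ *
        √(invForm (gramSeq (selVec sel x.pol) u τ) (selVec sel x.pol τ) (selVec sel x.pol τ)) :=
      fun τ => by
        have : 0 ≤ ofulBeta d T δ := by rw [ofulBeta]; positivity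
        positivity
    refine le_trans (Finset.sum_le_sum fun τ hτ => ?_)
      (Finset.sum_le_sum_of_subset_of_nonneg (s := (Finset.Icc s e).filter sel)
        (fun τ hτ => ?_) fun τ _ _ => hw τ)
    · obtain ⟨h1, h2⟩ := Finset.mem_filter.1 hτ
      have h3 : sel τ := h2
      rw [hest τ h3]
      have := (key τ h1 h3).2
      simp only [selVec, h3, if_true]
      linarith
    · have := Finset.mem_Icc.1 (Finset.mem_filter.1 hτ).1
      simp; omega

open Classical in
/-- Number of instances of order `m'` that can be active in `[s, e]`. -/
lemma card_scheduled_le (h : LinSetting d T δ A θ) (hx : MasterPath T δ θ κ x) {u n m' s e : ℕ}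
    (hu : 1 ≤ u) (hus : u ≤ s) (hse : s ≤ e) (heT : e ≤ T) (hnT : n < T) (hmn : m' ≤ n)
    (hd : 2 ^ m' ∣ s - u) (hen : e < s + 2 ^ n) :
    ((((Finset.Icc s e).filter fun s' =>
      Scheduled (ofulRho 100 d T δ) x ⟨u, n⟩ s' m').card : ℕ) : ℝ) *
        √(min (2 ^ m') (e - s + 1) : ℕ) ≤ 13 * Real.log (T / δ) * √(e - s + 1 : ℕ) := by
  have hL := h.log_ge
  set ρ := ofulRho 100 d T δ with hρ
  set ℓ := e - s + 1 with hℓ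
  have hc := hx.good.count u (by simp; omega) n (by simpa using hnT) m' (by simp; omega) s
    (by simp; omega) e (by simp; omega) hmn
  rw [h.ofulRho_ratio_eq] at hc
  have hg := card_gridRounds_le (e := e) hus hd
  -- The instance starting at `s` itself is outside the grid count and is added by hand.
  have hsub : ((Finset.Icc s e).filter fun s' => Scheduled ρ x ⟨u, n⟩ s' m') ⊆
      insert s ((gridRounds u m' s e).filter fun s' =>
        (x.coin s' m' : ℝ) ≤ √((2 : ℝ) ^ m') / √((2 : ℝ) ^ n)) := fun s' hs' => by
    obtain ⟨h1, h2⟩ := Finset.mem_filter.1 hs'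
    have h3 := Finset.mem_Icc.1 h1
    rcases h3.1.eq_or_lt with h4 | h4
    · simp [← h4]
    · refine Finset.mem_insert_of_mem (Finset.mem_filter.2 ⟨Finset.mem_filter.2
        ⟨by simp; omega, h2.2.2.2.1⟩, ?_⟩)
      rw [← h.ofulRho_ratio_eq]
      exact h2.2.2.2.2
  have hcard := (Finset.card_le_card hsub).trans (Finset.card_insert_le _ _)
  have hcard' : ((((Finset.Icc s e).filter fun s' => Scheduled ρ x ⟨u, n⟩ s' m').card : ℕ) : ℝ) ≤
      2 * (√((2 : ℝ) ^ m') / √((2 : ℝ) ^ n)) * (gridRounds u m' s e).card +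
        8 * Real.log (T / δ) + 1 := by
    refine le_trans (Nat.cast_le.2 hcard) ?_
    push_cast
    linarith
  have hp : (0 : ℝ) < 2 ^ m' := by positivity
  have hg' : ((gridRounds u m' s e).card : ℝ) ≤ ℓ / 2 ^ m' := by
    rw [le_div_iff₀ hp]
    have : (gridRounds u m' s e).card * 2 ^ m' ≤ ℓ :=
      (Nat.mul_le_mul_right _ hg).trans ((Nat.div_mul_le_self _ _).trans (by omega))
    exact_mod_cast this
  have hs1 : √(min (2 ^ m') ℓ : ℕ) ≤ √ℓ :=
    Real.sqrt_le_sqrt (by exact_mod_cast min_le_right _ _)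
  have hs2 : √(min (2 ^ m') ℓ : ℕ) ≤ √((2 : ℝ) ^ m') :=
    Real.sqrt_le_sqrt (by exact_mod_cast min_le_left _ _)
  have hs3 : √(ℓ : ℝ) ≤ √((2 : ℝ) ^ n) :=
    Real.sqrt_le_sqrt (by exact_mod_cast (by omega : ℓ ≤ 2 ^ n))
  set g := √(min (2 ^ m') ℓ : ℕ)
  have hg0 : 0 ≤ g := Real.sqrt_nonneg _
  set a := √((2 : ℝ) ^ m') with ha
  have ha0 : 0 < a := by positivity
  have ha2 : a * a = 2 ^ m' := Real.mul_self_sqrt (by positivity)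
  set b := √((2 : ℝ) ^ n)
  have hb0 : 0 < b := by positivity
  have hℓ2 : √(ℓ : ℝ) * √ℓ = ℓ := Real.mul_self_sqrt (by positivity)
  have hℓ0 : 0 ≤ √(ℓ : ℝ) := Real.sqrt_nonneg _
  -- Probability √(2^m'/2^n), ℓ/2^m' slots and cost √(2^m') per instance multiply to ℓ/√(2^n), which
  -- is at most √ℓ because ℓ ≤ 2^n.
  have e1 : 2 * (a / b) * (gridRounds u m' s e).card * g ≤ 2 * √ℓ := by
    calc _ ≤ 2 * (a / b) * (ℓ / 2 ^ m') * a := by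
          gcongr
      _ = 2 * (ℓ / b) := by rw [← ha2]; field_simp
      _ = 2 * (√ℓ * (√ℓ / b)) := by rw [← mul_div_assoc (√(ℓ : ℝ)), hℓ2]
      _ ≤ 2 * (√ℓ * 1) := by
          gcongr
          exact (div_le_one hb0).2 hs3
      _ = _ := by ring
  calc _ ≤ (2 * (a / b) * (gridRounds u m' s e).card + 8 * Real.log (T / δ) + 1) * g :=
        mul_le_mul_of_nonneg_right hcard' hg0
    _ ≤ 2 * √ℓ + (8 * Real.log (T / δ) + 1) * √ℓ := by
        rw [add_assoc, add_mul]
        exact add_le_add e1 (mul_le_mul_of_nonneg_left hs1 (by positivity))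
    _ = (3 + 8 * Real.log (T / δ)) * √ℓ := by ring
    _ ≤ _ := mul_le_mul_of_nonneg_right (by linarith) hℓ0

open Classical in
/-- Performance of a near-stationary interval that is covered by a scheduled instance. -/
lemma scheduled_regret (h : LinSetting d T δ A θ) (hx : MasterPath T δ θ κ x) {u n m s e : ℕ}
    (hu : 1 ≤ u) (hse : s ≤ e) (heT : e ≤ T) (hnT : 2 ^ n ≤ T)
    (hB : ∀ τ ∈ Finset.Icc s e,
      masterBlock (oful A T δ) T δ (ofulRho 100 d T δ) x τ = ⟨u, n⟩)
    (hS : Scheduled (ofulRho 100 d T δ) x ⟨u, n⟩ s m) (hem : e < s + 2 ^ m)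
    (hdr : drift (ofulDelta 400 T δ θ) s e ≤ ofulRho 100 d T δ (e - s + 1)) :
    (∀ τ ∈ Finset.Icc s e, optReward (linReward A θ) τ ≤
      malgEst (oful A T δ) (ofulRho 100 d T δ) x ⟨u, n⟩ τ) ∧
    ∑ τ ∈ Finset.Icc s e,
      (malgEst (oful A T δ) (ofulRho 100 d T δ) x ⟨u, n⟩ τ - x.rew τ) ≤
      (e - s + 1 : ℕ) * rhoHat T δ (ofulRho 100 d T δ) (e - s + 1) / 2 := by
  have hL := h.log_ge
  have hd := h.d_cast
  have hnT' : n < T := Nat.lt_two_pow_self.trans_le hnT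
  have hus : u ≤ s := hS.2.1
  have hmn : m ≤ n := hS.1
  have hen : e < s + 2 ^ n := hem.trans_le (by
    have := Nat.pow_le_pow_right (show 0 < 2 by norm_num) hmn; omega)
  set ρ := ofulRho 100 d T δ with hρ
  have hone := fun i hi => h.inst_regret hx hu hse heT hnT' hB hS hem hdr i hi
  refine ⟨fun τ hτ => (hone _ (Finset.mem_image_of_mem _ hτ)).1 τ hτ rfl, ?_⟩
  set ℓ := e - s + 1 with hℓ
  set c := d * Real.log (T / δ) with hc
  have hc0 : 0.69 ≤ c := by nlinarith
  set I := (Finset.Icc s e).image (activeInst ρ x ⟨u, n⟩) with hI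
  have e1 : ∑ τ ∈ Finset.Icc s e, (malgEst (oful A T δ) ρ x ⟨u, n⟩ τ - linReward A θ τ (x.pol τ))
      ≤ ∑ i ∈ I, 32 * c * √(min (2 ^ i.2) ℓ : ℕ) := by
    rw [← Finset.sum_fiberwise_of_maps_to (t := I) (g := activeInst ρ x ⟨u, n⟩)
      fun τ hτ => Finset.mem_image_of_mem _ hτ]
    exact Finset.sum_le_sum fun i hi => (hone i hi).2
  -- Only scheduled instances of order at most `m` starting in [s, e] can be active, so it suffices
  -- to count these order by order.
  have hsub : I ⊆ (Finset.Icc s e ×ˢ Finset.range (n + 1)).filter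
      fun i => Scheduled ρ x ⟨u, n⟩ i.1 i.2 ∧ i.2 ≤ m := fun i hi => by
    obtain ⟨τ, hτ, rfl⟩ := Finset.mem_image.1 hi
    have hτ' := Finset.mem_Icc.1 hτ
    obtain ⟨a1, a2, a3, a4, a5⟩ := activeInst_spec hS hτ'.1 (by omega : τ < s + 2 ^ m)
    simp only [Finset.mem_filter, Finset.mem_product, Finset.mem_Icc, Finset.mem_range]
    exact ⟨⟨⟨a2, by omega⟩, by omega⟩, a5, a1⟩
  have e2 : ∑ i ∈ I, 32 * c * √(min (2 ^ i.2) ℓ : ℕ) ≤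
      ((n : ℝ) + 1) * (32 * c * (13 * Real.log (T / δ) * √ℓ)) := by
    refine (Finset.sum_le_sum_of_subset_of_nonneg hsub fun _ _ _ => by positivity).trans ?_
    rw [Finset.sum_filter, Finset.sum_product_right]
    calc _ ≤ ∑ m' ∈ Finset.range (n + 1), 32 * c * (13 * Real.log (T / δ) * √ℓ) := by
          refine Finset.sum_le_sum fun m' hm' => ?_
          by_cases hm : m' ≤ m
          · simp only [hm, and_true]
            rw [← Finset.sum_filter, Finset.sum_const, nsmul_eq_mul, mul_left_comm]
            refine mul_le_mul_of_nonneg_left ?_ (by positivity)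
            exact h.card_scheduled_le hx hu hus hse heT hnT' (hm.trans hmn)
              ((Nat.pow_dvd_pow 2 hm).trans hS.2.2.2.1) hen
          · simp only [hm, and_false, if_false, Finset.sum_const_zero]
            positivity
      _ = _ := by rw [Finset.sum_const, Finset.card_range, nsmul_eq_mul, Nat.cast_add_one]
  have e3 := (abs_le.1 (hx.good.noise s (by simp; omega) e (by simp; omega) hse)).1
  have e4 := h.sqrt_mul_log_le ℓ
  have e5 : ∑ τ ∈ Finset.Icc s e, (malgEst (oful A T δ) ρ x ⟨u, n⟩ τ - x.rew τ) =
      ∑ τ ∈ Finset.Icc s e, (malgEst (oful A T δ) ρ x ⟨u, n⟩ τ - linReward A θ τ (x.pol τ)) -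
        ∑ τ ∈ Finset.Icc s e, pathNoise θ x.pol x.rew τ := by
    rw [← Finset.sum_sub_distrib]
    refine Finset.sum_congr rfl fun τ _ => ?_
    rw [pathNoise]; ring
  have e6 : (ℓ : ℝ) * rhoHat T δ ρ ℓ = 2400 * (numScales T * Real.log (T / δ) * c) * √ℓ := by
    have hℓ0 : (0 : ℝ) < √(ℓ : ℝ) := Real.sqrt_pos.2 (by positivity)
    rw [h.rhoHat_eq, mul_div_assoc', div_eq_iff hℓ0.ne']
    rw [mul_assoc _ (√(ℓ : ℝ)), Real.mul_self_sqrt (by positivity), mul_comm]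
  have e7 := add_one_le_numScales hnT
  have e8 := two_le_numScales h.T_ge
  rw [e5, e6]
  have hℓ0 : 0 ≤ √(ℓ : ℝ) := Real.sqrt_nonneg _
  have hcl : 0 ≤ c * √(ℓ : ℝ) := by positivity
  -- Widths cost 32·13 = 416 and noise 5, against 1200 available in half of ℓρ̂(ℓ).
  have e9 : ((n : ℝ) + 1) * (32 * c * (13 * Real.log (T / δ) * √ℓ)) ≤
      416 * (numScales T * Real.log (T / δ)) * (c * √ℓ) := by
    have : ((n : ℝ) + 1) * (416 * Real.log (T / δ) * (c * √ℓ)) ≤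
      numScales T * (416 * Real.log (T / δ) * (c * √ℓ)) :=
      mul_le_mul_of_nonneg_right e7 (by positivity)
    linarith
  have e10 : 5 * c * √(ℓ : ℝ) ≤ 5 * (numScales T * Real.log (T / δ)) * (c * √ℓ) := by
    have : 1 ≤ numScales T * Real.log (T / δ) := by nlinarith
    nlinarith
  have e11 : 0 ≤ numScales T * Real.log (T / δ) * (c * √ℓ) := by positivity
  nlinarith

end LinSetting

end PathAnalysis

/-! ### What makes a test fail -/

section Restarts

variable {d T : ℕ} {δ : ℝ} {A : Set (EuclideanSpace ℝ (Fin d))}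
  {θ : ℕ → EuclideanSpace ℝ (Fin d)} {κ : ℕ → ℕ} {x : Transcript A}

lemma runningMin_le {P : Type*} (alg : BaseAlg P) (ρ : ℕ → ℝ) (x : Transcript P) (B : Block)
    {τ t : ℕ} (h1 : B.start ≤ τ) (h2 : τ ≤ t) : runningMin alg ρ x B t ≤ malgEst alg ρ x B τ :=
  csInf_le ((Set.finite_Icc _ _).image _).bddBelow ⟨τ, ⟨h1, h2⟩, rfl⟩

lemma exists_runningMin_eq {P : Type*} (alg : BaseAlg P) (ρ : ℕ → ℝ) (x : Transcript P)
    (B : Block) {t : ℕ} (h : B.start ≤ t) :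
    ∃ τ ∈ Set.Icc B.start t, malgEst alg ρ x B τ = runningMin alg ρ x B t :=
  Set.Nonempty.csInf_mem (s := malgEst alg ρ x B '' Set.Icc B.start t)
    ⟨_, B.start, ⟨le_rfl, h⟩, rfl⟩ ((Set.finite_Icc _ _).image _)

namespace LinSetting

lemma rhoHat_pos (h : LinSetting d T δ A θ) {t : ℕ} (ht : 1 ≤ t) :
    0 < rhoHat T δ (ofulRho 100 d T δ) t := by
  linarith [h.eight_mul_rho_le ht, h.ofulRho_pos ht]

/-- The probability is ρ(2^n)/ρ(2^n) = 1, so whatever its coin, a block is covered by an instance of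
its own order. -/
lemma scheduled_top (h : LinSetting d T δ A θ) (u n : ℕ) :
    Scheduled (ofulRho 100 d T δ) x ⟨u, n⟩ u n := by
  refine ⟨le_rfl, le_rfl, by simp, by simp, ?_⟩
  simp only
  rw [div_self (h.ofulRho_pos Nat.one_le_two_pow).ne']
  exact (x.coin u n).2.2

/-- No test fails while a block is near-stationary. -/
lemma not_testFails_of_drift_le (h : LinSetting d T δ A θ) (hx : MasterPath T δ θ κ x)
    {u n t : ℕ} (ht : 1 ≤ t) (htT : t ≤ T)
    (hB : masterBlock (oful A T δ) T δ (ofulRho 100 d T δ) x t = ⟨u, n⟩)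
    (hdr : drift (ofulDelta 400 T δ θ) u t ≤ ofulRho 100 d T δ (t - u + 1)) :
    ¬ TestFails (oful A T δ) T δ (ofulRho 100 d T δ) x ⟨u, n⟩ t := by
  have hL := h.log_ge
  have hd := h.d_cast
  obtain ⟨i1, i2, i3, i4, i5⟩ := masterBlock_invariant (alg := oful A T δ) (T := T) (δ := δ)
    (ρ := ofulRho 100 d T δ) (x := x) ht
  simp only [hB] at i1 i2 i3 i4 i5
  obtain ⟨r1, r2⟩ := h.scheduled_regret hx i1 i2 htT (by omega) i5 (h.scheduled_top u n) i3 hdr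
  set ρ := ofulRho 100 d T δ with hρ
  have hp := h.rhoHat_pos (by omega : 1 ≤ t - u + 1)
  have hn0 : (0 : ℝ) < (t - u + 1 : ℕ) := by positivity
  rintro (⟨s, m, hS, hsm, hf⟩ | hf)
  · have hm0 : (0 : ℝ) < 2 ^ m := by positivity
    have hus : u ≤ s := hS.2.1
    have h2m := Nat.one_le_two_pow (n := m)
    have hst : s ≤ t := by omega
    obtain ⟨τ0, hτ0, hmin⟩ := exists_runningMin_eq (oful A T δ) ρ x ⟨u, n⟩ i2
    set U := runningMin (oful A T δ) ρ x ⟨u, n⟩ t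
    set D := ∑ i ∈ Finset.Ico u t, ‖θ i - θ (i + 1)‖
    -- The tested instance lies inside the block, so 2^m ≤ t − u + 1 and monotonicity of ρ applies.
    have hD : D ≤ ρ (2 ^ m) := (h.sum_norm_le_drift u t).trans (hdr.trans
      (h.ofulRho_le h2m (by omega)))
    -- The running minimum is attained in a round whose estimate is optimistic, and optimal rewards
    -- within the block differ by at most the variation D.
    have hopt : ∀ τ ∈ Finset.Icc s t, linReward A θ τ (x.pol τ) ≤ U + D := fun τ hτ => by
      have hτ' := Finset.mem_Icc.1 hτ
      have a1 := h.le_optReward (t := τ) (by simp; omega) (x.pol τ)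
      have a2 := h.optReward_sub_le (t := τ) (t' := τ0) (by simp at hτ0 ⊢; omega)
      have a3 := r1 τ0 (by simpa using hτ0)
      have a4 : ‖θ τ - θ τ0‖ ≤ D := by
        rcases le_total τ τ0 with hle | hle
        · exact norm_sub_le_sum (by omega) hle hτ0.2
        · rw [norm_sub_rev]; exact norm_sub_le_sum hτ0.1 hle hτ'.2
      rw [hmin] at a3
      linarith
    have hcard : (t - s + 1 : ℕ) = 2 ^ m := by omega
    have hsum : ∑ τ ∈ Finset.Icc s t, x.rew τ ≤
        2 ^ m * (U + D) + 5 * (d * Real.log (T / δ)) * √((2 : ℝ) ^ m) := by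
      have a1 := (abs_le.1 (hx.good.noise s (by simp; omega) t (by simp; omega) hst)).2
      have a2 := h.sqrt_mul_log_le (t - s + 1)
      have a3 : ∑ τ ∈ Finset.Icc s t, linReward A θ τ (x.pol τ) ≤ 2 ^ m * (U + D) := by
        refine (Finset.sum_le_card_nsmul _ _ _ hopt).trans (le_of_eq ?_)
        rw [Nat.card_Icc, nsmul_eq_mul, show t + 1 - s = 2 ^ m by omega]
        push_cast; rfl
      have a4 : ∑ τ ∈ Finset.Icc s t, x.rew τ = ∑ τ ∈ Finset.Icc s t, linReward A θ τ (x.pol τ) +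
          ∑ τ ∈ Finset.Icc s t, pathNoise θ x.pol x.rew τ := by
        rw [← Finset.sum_add_distrib]
        exact Finset.sum_congr rfl fun τ _ => by rw [pathNoise]; ring
      rw [hcard] at a1 a2
      push_cast at a1 a2
      linarith
    have hmul := h.mul_ofulRho (2 ^ m)
    push_cast at hmul
    rw [← hρ] at hmul
    have hr8 := h.eight_mul_rho_le h2m
    have hrp := h.ofulRho_pos h2m
    rw [← hρ] at hr8 hrp
    rw [one_div, ← div_eq_inv_mul, le_div_iff₀ hm0] at hf
    have a5 : 5 * (d * Real.log (T / δ)) * √((2 : ℝ) ^ m) = 2 ^ m * ρ (2 ^ m) / 80 := by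
      rw [hmul]; ring
    rw [a5] at hsum
    have a6 : 9 * rhoHat T δ ρ (2 ^ m) ≤ D + ρ (2 ^ m) / 80 := by
      have : (U + 9 * rhoHat T δ ρ (2 ^ m)) * 2 ^ m ≤ (U + D + ρ (2 ^ m) / 80) * 2 ^ m := by
        linarith
      have := le_of_mul_le_mul_right this hm0
      linarith
    linarith
  · unfold Test2Fails at hf
    simp only at hf
    have hq : 1 / ((t - u + 1 : ℕ) : ℝ) * ∑ τ ∈ Finset.Icc u t,
        (malgEst (oful A T δ) ρ x ⟨u, n⟩ τ - x.rew τ) ≤ rhoHat T δ ρ (t - u + 1) / 2 := by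
      rw [one_div, inv_mul_le_iff₀ hn0]
      linarith
    linarith

/-- A candidate whose coin succeeds ends the block. -/
lemma miss_of_candidate (h : LinSetting d T δ A θ) (hx : MasterPath T δ θ κ x)
    {u n m s e : ℕ} (he : 1 ≤ e) (heT : e ≤ T) (hmn : m ≤ n)
    (hB : masterBlock (oful A T δ) T δ (ofulRho 100 d T δ) x e = ⟨u, n⟩)
    (hs : s ∈ probeRounds κ u m e) (hc : Candidate T δ θ κ x u n m s) :
    ofulRho 100 d T δ (2 ^ n) / ofulRho 100 d T δ (2 ^ m) < (x.coin s m : ℝ) := by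
  obtain ⟨i1, i2, i3, i4, i5⟩ := masterBlock_invariant (alg := oful A T δ) (T := T) (δ := δ)
    (ρ := ofulRho 100 d T δ) (x := x) he
  have hnf : ∀ t, u ≤ t → t < e →
      ¬ TestFails (oful A T δ) T δ (ofulRho 100 d T δ) x ⟨u, n⟩ t := fun t h1 h2 => by
    have := not_testFails_of_mem (alg := oful A T δ) (T := T) (δ := δ)
      (ρ := ofulRho 100 d T δ) (x := x) (t := t) he (by rw [hB]; exact h1) h2
    rwa [hB] at this
  simp only [hB] at i1 i2 i3 i4 i5
  obtain ⟨hs1, hs2, hs3, hs4⟩ := Finset.mem_filter.1 hs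
  have hs1' := Finset.mem_Ioo.1 hs1
  have h2m := Nat.one_le_two_pow (n := m)
  by_contra hcoin
  rw [not_lt] at hcoin
  -- The last round of the probing instance precedes `e`, so a failure of Test 1 there contradicts
  -- that the block is still running at `e`.
  set t := s + 2 ^ m - 1 with ht
  have hS : Scheduled (ofulRho 100 d T δ) x ⟨u, n⟩ s m :=
    ⟨hmn, by simp only; omega, by simp only; omega, hs2, hcoin⟩
  have hdr := hx.stat s t (by omega) (by omega) (by omega) hs4.symm
  obtain ⟨-, r2⟩ := h.scheduled_regret hx (e := t) i1 (by omega) (by omega) (by omega)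
    (fun τ hτ => i5 τ (by simp at hτ ⊢; omega)) hS (by omega) hdr
  obtain ⟨r1, -⟩ := h.scheduled_regret hx (e := t) i1 (by omega) (by omega) (by omega)
    (fun τ hτ => i5 τ (by simp at hτ ⊢; omega)) hS (by omega) hdr
  obtain ⟨τ, hτ, hκ, hlow⟩ := hc
  have hτ' := Finset.mem_Ico.1 hτ
  refine hnf t (by omega) (by omega) (Or.inl ⟨s, m, hS, by omega, ?_⟩)
  set ρ := ofulRho 100 d T δ with hρ
  have hU := runningMin_le (oful A T δ) ρ x ⟨u, n⟩ (τ := τ) (t := t) hτ'.1 (by omega)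
  have hm0 : (0 : ℝ) < 2 ^ m := by positivity
  have hlen : t - s + 1 = 2 ^ m := by omega
  rw [hlen] at r2
  have hr8 := h.eight_mul_rho_le h2m
  have hrp := h.rhoHat_pos h2m
  rw [← hρ] at hr8 hrp
  set D := ∑ i ∈ Finset.Ico τ t, ‖θ i - θ (i + 1)‖
  -- Rounds `τ` and `t` share a label and are at least 2^m rounds long together, so the drift
  -- between them is at most ρ(2^m).
  have hD : D ≤ ρ (2 ^ m) := (h.sum_norm_le_drift τ t).trans
    ((hx.stat τ t (by omega) (by omega) (by omega) (hκ.trans hs4.symm)).trans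
      (h.ofulRho_le h2m (by omega)))
  have hest : ∀ τ' ∈ Finset.Icc s t, optReward (linReward A θ) τ - D ≤
      malgEst (oful A T δ) ρ x ⟨u, n⟩ τ' := fun τ' h' => by
    have h'' := Finset.mem_Icc.1 h'
    have a1 := h.optReward_sub_le (t := τ) (t' := τ') (by simp; omega)
    have a2 : ‖θ τ - θ τ'‖ ≤ D := norm_sub_le_sum le_rfl (by omega) h''.2
    linarith [r1 τ' h']
  have hsum := Finset.card_nsmul_le_sum _ _ _ hest
  rw [Nat.card_Icc, nsmul_eq_mul, show t + 1 - s = 2 ^ m by omega] at hsum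
  rw [Finset.sum_sub_distrib] at r2
  push_cast at hsum r2
  rw [one_div, ← div_eq_inv_mul, le_div_iff₀ hm0]
  -- The deficit exceeds 11ρ̂; drift takes at most ρ̂/8 and regret ρ̂/2, which leaves more than the
  -- 9ρ̂ of Test 1.
  have : (runningMin (oful A T δ) ρ x ⟨u, n⟩ t + 9 * rhoHat T δ ρ (2 ^ m)) ≤
      optReward (linReward A θ) τ - D - rhoHat T δ ρ (2 ^ m) / 2 := by linarith
  have := mul_le_mul_of_nonneg_right this hm0.le
  linarith

end LinSetting

end Restarts

/-! ### Dynamic regret inside one block -/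

section BlockRegret

variable {d T : ℕ} {δ : ℝ} {A : Set (EuclideanSpace ℝ (Fin d))}
  {θ : ℕ → EuclideanSpace ℝ (Fin d)} {κ : ℕ → ℕ} {x : Transcript A}

/-- Dyadic layer decomposition of a value below the top threshold. -/
lemma le_add_sum_layers {thr : ℕ → ℝ} {v : ℝ} (h0 : ∀ m, 0 ≤ thr m)
    (h2 : ∀ m, thr m ≤ 2 * thr (m + 1)) (hv : v ≤ thr 0) (n : ℕ) :
    v ≤ thr n + ∑ m ∈ Finset.range (n + 1), if thr m < v then 2 * thr m else 0 := by
  have hnn : ∀ m, 0 ≤ if thr m < v then 2 * thr m else 0 := fun m => by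
    have := h0 m
    split_ifs <;> linarith
  induction n with
  | zero => simpa using hv.trans (le_add_of_nonneg_right (hnn 0))
  | succ n ih =>
    rw [Finset.sum_range_succ]
    have h3 := Finset.sum_nonneg (s := Finset.range (n + 1)) fun m _ => hnn m
    have h4 := h0 (n + 1)
    have h5 := h2 n
    -- If the new layer is active, its term 2·thr(n+1) replaces thr(n); otherwise thr(n+1) already
    -- bounds `v`.
    split_ifs with hc <;> linarith

/-- The first round after `τ` on the grid of width `2 ^ m` anchored at `u`. -/
def nextGrid (u m τ : ℕ) : ℕ := u + ((τ - u) / 2 ^ m + 1) * 2 ^ m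

lemma lt_nextGrid {u m τ : ℕ} (h : u ≤ τ) : τ < nextGrid u m τ := by
  have h1 := Nat.lt_div_mul_add (a := τ - u) (show 0 < 2 ^ m by positivity)
  rw [nextGrid, add_one_mul]
  omega

lemma nextGrid_le {u m τ : ℕ} (h : u ≤ τ) : nextGrid u m τ ≤ τ + 2 ^ m := by
  have h1 := Nat.div_mul_le_self (τ - u) (2 ^ m)
  rw [nextGrid, add_one_mul]
  omega

/-- The minimum is at most the geometric mean of l and 2^{m+1}; this form survives a later
Cauchy–Schwarz over the classes. -/
lemma min_le_two_mul_sqrt (l m : ℕ) :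
    ((min l (2 ^ (m + 1)) : ℕ) : ℝ) ≤ 2 * √(l : ℝ) * √((2 : ℝ) ^ m) := by
  have h1 : √(l : ℝ) * √l = l := Real.mul_self_sqrt (by positivity)
  have h2 : √((2 : ℝ) ^ m) * √((2 : ℝ) ^ m) = 2 ^ m := Real.mul_self_sqrt (by positivity)
  have a1 : ((min l (2 ^ (m + 1)) : ℕ) : ℝ) ≤ l := by exact_mod_cast min_le_left _ _
  have a2 : ((min l (2 ^ (m + 1)) : ℕ) : ℝ) ≤ 2 ^ m * 2 := by
    exact_mod_cast (min_le_right l (2 ^ (m + 1))).trans_eq (pow_succ 2 m)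
  have h3 := Real.sqrt_nonneg (l : ℝ)
  have h4 := Real.sqrt_nonneg ((2 : ℝ) ^ m)
  rcases le_total √(l : ℝ) √((2 : ℝ) ^ m) with h | h <;> nlinarith

/-- Rounds followed by a full grid interval with the same label are charged to that interval; the
others are few for each label. -/
lemma card_le_of_nextGrid_mem (hκ : Monotone κ) {u e m : ℕ} {B C : Finset ℕ}
    (hB : B ⊆ Finset.Icc u e)
    (hC : ∀ τ ∈ B, nextGrid u m τ + 2 ^ m ≤ e → κ (nextGrid u m τ + 2 ^ m - 1) = κ τ →
      nextGrid u m τ ∈ C) :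
    (B.card : ℝ) ≤ 2 ^ m * C.card + 2 * √((2 : ℝ) ^ m) *
      ∑ i ∈ (Finset.Icc u e).image κ,
        √(((Finset.Icc u e).filter fun τ => κ τ = i).card : ℝ) := by
  classical
  set p : ℕ → Prop := fun τ =>
    nextGrid u m τ + 2 ^ m ≤ e ∧ κ (nextGrid u m τ + 2 ^ m - 1) = κ τ with hp
  have h2m := Nat.one_le_two_pow (n := m)
  -- Each grid point is the next one for at most 2^m rounds.
  have b1 : (B.filter p).card ≤ 2 ^ m * C.card := by
    refine (Finset.card_le_mul_card_image (f := nextGrid u m) _ (2 ^ m) fun s hs => ?_).trans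
      (Nat.mul_le_mul_left _ (Finset.card_le_card fun s hs => ?_))
    · refine (Finset.card_le_card (t := Finset.Ico (s - 2 ^ m) s) fun τ hτ => ?_).trans
        (by rw [Nat.card_Ico]; omega)
      obtain ⟨h1, rfl⟩ := Finset.mem_filter.1 hτ
      have h2 := Finset.mem_Icc.1 (hB (Finset.mem_filter.1 h1).1)
      have h3 := lt_nextGrid (m := m) h2.1
      have h4 := nextGrid_le (m := m) h2.1
      simp only [Finset.mem_Ico]; omega
    · obtain ⟨τ, hτ, rfl⟩ := Finset.mem_image.1 hs
      obtain ⟨h1, h2, h3⟩ := Finset.mem_filter.1 hτ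
      exact hC τ h1 h2 h3
  have b2 : ((B.filter fun τ => ¬ p τ).card : ℝ) ≤ 2 * √((2 : ℝ) ^ m) *
      ∑ i ∈ (Finset.Icc u e).image κ,
        √(((Finset.Icc u e).filter fun τ => κ τ = i).card : ℝ) := by
    rw [Finset.card_eq_sum_card_fiberwise (f := κ) (t := (Finset.Icc u e).image κ) fun τ hτ =>
      Finset.mem_image_of_mem _ (hB (Finset.mem_filter.1 hτ).1)]
    rw [Finset.mul_sum]
    push_cast
    refine Finset.sum_le_sum fun i _ => ?_
    refine le_trans (Nat.cast_le.2 (le_min ?_ ?_)) ((min_le_two_mul_sqrt _ m).trans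
      (le_of_eq (mul_right_comm _ _ _)))
    · exact Finset.card_le_card (Finset.filter_subset_filter _
        ((Finset.filter_subset _ _).trans hB))
    · set F := (B.filter fun τ => ¬ p τ).filter fun τ => κ τ = i with hF
      rcases F.eq_empty_or_nonempty with h0 | h0
      · simp [h0]
      -- Let `a` be the first such round of the class. A later one at distance 2^{m+1} or more would
      -- leave room for a full grid interval after `a` inside the class, making `a` satisfy `p`.
      have ha := F.min'_mem h0
      set a := F.min' h0
      refine (Finset.card_le_card (t := Finset.Ico a (a + 2 ^ (m + 1))) fun τ hτ => ?_).trans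
        (by simp)
      have hle : a ≤ τ := F.min'_le _ hτ
      obtain ⟨h1, h2⟩ := Finset.mem_filter.1 ha
      obtain ⟨h3, h4⟩ := Finset.mem_filter.1 h1
      obtain ⟨h5, h6⟩ := Finset.mem_filter.1 hτ
      have h7 := Finset.mem_Icc.1 (hB (Finset.mem_filter.1 h5).1)
      have h8 := Finset.mem_Icc.1 (hB h3)
      have h9 := nextGrid_le (m := m) h8.1
      have h10 := lt_nextGrid (m := m) h8.1
      rw [Finset.mem_Ico, pow_succ]
      refine ⟨hle, ?_⟩
      by_contra hc
      refine h4 ⟨by omega, le_antisymm ?_ (hκ (by omega))⟩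
      rw [h2, ← h6]
      exact hκ (by omega)
  have b3 := Finset.card_filter_add_card_filter_not (s := B) p
  have b1' : ((B.filter p).card : ℝ) ≤ 2 ^ m * C.card := by exact_mod_cast b1
  have b3' : (B.card : ℝ) = (B.filter p).card + (B.filter fun τ => ¬ p τ).card := by
    exact_mod_cast b3.symm
  linarith

namespace LinSetting

lemma mul_rhoHat (h : LinSetting d T δ A θ) (t : ℕ) :
    t * rhoHat T δ (ofulRho 100 d T δ) t =
      2400 * (numScales T * Real.log (T / δ) * (d * Real.log (T / δ))) * √t := by
  rcases Nat.eq_zero_or_pos t with rfl | ht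
  · simp
  have h0 : (0 : ℝ) < √(t : ℝ) := Real.sqrt_pos.2 (by positivity)
  rw [h.rhoHat_eq, mul_div_assoc', div_eq_iff h0.ne', mul_assoc _ (√(t : ℝ)),
    Real.mul_self_sqrt (by positivity), mul_comm]

lemma scale_ge (h : LinSetting d T δ A θ) :
    0.9 ≤ numScales T * Real.log (T / δ) * (d * Real.log (T / δ)) := by
  have hL := h.log_ge
  have hd := h.d_cast
  have hn := two_le_numScales h.T_ge
  have h1 : 1.38 ≤ numScales T * Real.log (T / δ) := by nlinarith
  have h2 : 0.69 ≤ d * Real.log (T / δ) := by nlinarith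
  nlinarith

/-- Excess of the rewards lost with respect to the estimates, from the second test. -/
lemma sum_est_sub_rew_le (h : LinSetting d T δ A θ) (hx : MasterPath T δ θ κ x) {u n e : ℕ}
    (he : 1 ≤ e) (heT : e ≤ T)
    (hB : masterBlock (oful A T δ) T δ (ofulRho 100 d T δ) x e = ⟨u, n⟩) :
    ∑ τ ∈ Finset.Icc u e, (malgEst (oful A T δ) (ofulRho 100 d T δ) x ⟨u, n⟩ τ - x.rew τ) ≤
      7202 * (numScales T * Real.log (T / δ) * (d * Real.log (T / δ))) * √((2 : ℝ) ^ n) := by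
  obtain ⟨i1, i2, i3, i4, -⟩ := masterBlock_invariant (alg := oful A T δ) (T := T) (δ := δ)
    (ρ := ofulRho 100 d T δ) (x := x) he
  have hnf : ∀ t, u ≤ t → t < e →
      ¬ TestFails (oful A T δ) T δ (ofulRho 100 d T δ) x ⟨u, n⟩ t := fun t h1 h2 => by
    have := not_testFails_of_mem (alg := oful A T δ) (T := T) (δ := δ)
      (ρ := ofulRho 100 d T δ) (x := x) (t := t) he (by rw [hB]; exact h1) h2
    rwa [hB] at this
  simp only [hB] at i1 i2 i3 i4
  have hQ := h.scale_ge
  have hmul := h.mul_rhoHat (e - u)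
  set Q := numScales T * Real.log (T / δ) * (d * Real.log (T / δ))
  set ρ := ofulRho 100 d T δ with hρ
  -- A test may fail in round `e` itself, so Test 2 is used only up to `e - 1` and the last round is
  -- paid by the trivial bound 1.
  have hlast : malgEst (oful A T δ) ρ x ⟨u, n⟩ e - x.rew e ≤ 1 := by
    have a1 := (hx.rew_mem e (by simp; omega)).1
    have a2 : malgEst (oful A T δ) ρ x ⟨u, n⟩ e ≤ 1 := max_le zero_le_one (min_le_left _ _)
    linarith
  have hs1 : (1 : ℝ) ≤ √((2 : ℝ) ^ n) := Real.one_le_sqrt.2 (one_le_pow₀ (by norm_num))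
  have hs2 : √((e - u : ℕ) : ℝ) ≤ √((2 : ℝ) ^ n) :=
    Real.sqrt_le_sqrt (by exact_mod_cast (by omega : e - u ≤ 2 ^ n))
  have hone : 1 ≤ 2 * Q * √((2 : ℝ) ^ n) := by nlinarith
  rcases i2.eq_or_lt with rfl | hlt
  · rw [Finset.Icc_self, Finset.sum_singleton]
    nlinarith
  · have hf := mt Or.inr (hnf (e - 1) (by omega) (by omega))
    rw [Test2Fails, not_le] at hf
    simp only [show e - 1 - u + 1 = e - u by omega] at hf
    have hpos : (0 : ℝ) < (e - u : ℕ) := by exact_mod_cast (by omega : 0 < e - u)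
    rw [one_div, inv_mul_lt_iff₀ hpos] at hf
    obtain ⟨e', rfl⟩ : ∃ e', e = e' + 1 := ⟨e - 1, by omega⟩
    rw [Finset.sum_Icc_succ_top (by omega)]
    simp only [Nat.add_sub_cancel] at hf
    have : 7200 * Q * √((e' + 1 - u : ℕ) : ℝ) ≤ 7200 * Q * √((2 : ℝ) ^ n) :=
      mul_le_mul_of_nonneg_left hs2 (by linarith)
    linarith

/-- Total deficit of the estimates in a block. -/
lemma sum_optReward_sub_est_le (h : LinSetting d T δ A θ) (hx : MasterPath T δ θ κ x)
    {u n e : ℕ} (he : 1 ≤ e) (heT : e ≤ T)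
    (hB : masterBlock (oful A T δ) T δ (ofulRho 100 d T δ) x e = ⟨u, n⟩) :
    ∑ τ ∈ Finset.Icc u e, (optReward (linReward A θ) τ -
        malgEst (oful A T δ) (ofulRho 100 d T δ) x ⟨u, n⟩ τ) ≤
      (numScales T * Real.log (T / δ) * (d * Real.log (T / δ))) *
        (26400 * √((2 : ℝ) ^ n) + numScales T * (422400 * Real.log (T / δ) * √((2 : ℝ) ^ n) +
          105600 * ∑ i ∈ (Finset.Icc u e).image κ,
            √(((Finset.Icc u e).filter fun τ => κ τ = i).card : ℝ))) := by
  classical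
  obtain ⟨i1, i2, i3, i4, -⟩ := masterBlock_invariant (alg := oful A T δ) (T := T) (δ := δ)
    (ρ := ofulRho 100 d T δ) (x := x) he
  simp only [hB] at i1 i2 i3 i4
  have hL := h.log_ge
  have hQ := h.scale_ge
  have hN := two_le_numScales h.T_ge
  have hn := add_one_le_numScales (T := T) (n := n) (by omega)
  have hnT : n < T := Nat.lt_two_pow_self.trans_le (by omega)
  have hrh : ∀ m : ℕ, rhoHat T δ (ofulRho 100 d T δ) (2 ^ m) = _ := fun m => h.rhoHat_eq (2 ^ m)
  set Q := numScales T * Real.log (T / δ) * (d * Real.log (T / δ))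
  clear_value Q
  set ρ := ofulRho 100 d T δ with hρ
  set Sg := ∑ i ∈ (Finset.Icc u e).image κ,
    √(((Finset.Icc u e).filter fun τ => κ τ = i).card : ℝ) with hSg
  have hSg0 : 0 ≤ Sg := Finset.sum_nonneg fun _ _ => Real.sqrt_nonneg _
  set v : ℕ → ℝ := fun τ => optReward (linReward A θ) τ - malgEst (oful A T δ) ρ x ⟨u, n⟩ τ
    with hv
  -- The thresholds are 11ρ̂(2^m), the deficits that an order-m instance can detect.
  set thr : ℕ → ℝ := fun m => 26400 * Q / √((2 : ℝ) ^ m) with hthr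
  have hthr' : ∀ m, 11 * rhoHat T δ ρ (2 ^ m) = thr m := fun m => by
    rw [hrh, hthr]; push_cast; ring
  have hsq : ∀ m : ℕ, 0 < √((2 : ℝ) ^ m) := fun m => by positivity
  have hsq2 : ∀ m : ℕ, √((2 : ℝ) ^ m) * √((2 : ℝ) ^ m) = 2 ^ m := fun m =>
    Real.mul_self_sqrt (by positivity)
  have ht0 : ∀ m, 0 ≤ thr m := fun m => by positivity
  have ht2 : ∀ m, thr m ≤ 2 * thr (m + 1) := fun m => by
    have : √((2 : ℝ) ^ (m + 1)) ≤ 2 * √((2 : ℝ) ^ m) := by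
      refine Real.sqrt_le_iff.2 ⟨by positivity, ?_⟩
      rw [mul_pow, Real.sq_sqrt (by positivity), pow_succ]
      nlinarith [pow_pos (show (0 : ℝ) < 2 by norm_num) m]
    simp only [hthr]
    rw [mul_div_assoc', div_le_div_iff₀ (hsq _) (hsq _)]
    have hq : 0 ≤ 26400 * Q := by linarith
    nlinarith [mul_le_mul_of_nonneg_left this hq]
  have hvle : ∀ τ ∈ Finset.Icc u e, v τ ≤ thr 0 := fun τ hτ => by
    have hτ' := Finset.mem_Icc.1 hτ
    have a1 := (h.optReward_mem (t := τ) (by simp; omega)).2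
    have a2 : 0 ≤ malgEst (oful A T δ) ρ x ⟨u, n⟩ τ := le_max_left _ _
    simp only [hv, hthr]
    simp
    linarith
  set Bad : ℕ → Finset ℕ := fun m => (Finset.Icc u e).filter fun τ => thr m < v τ with hBad
  have hbad : ∀ m ∈ Finset.range (n + 1), 2 * thr m * (Bad m).card ≤
      Q * (422400 * Real.log (T / δ) * √((2 : ℝ) ^ n) + 105600 * Sg) := fun m hm => by
    have hmn : m ≤ n := by simp at hm; omega
    -- A bad round of layer `m` makes the next grid point a candidate, unless the grid interval
    -- there leaves the class or the block.
    set C := (probeRounds κ u m e).filter (Candidate T δ θ κ x u n m) with hC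
    have hcard := card_le_of_nextGrid_mem (u := u) (e := e) (m := m) (B := Bad m) (C := C) hx.mono
      (Finset.filter_subset _ _) fun τ hτ h1 h2 => by
        obtain ⟨h3, h4⟩ := Finset.mem_filter.1 hτ
        have h5 := Finset.mem_Icc.1 h3
        have h6 := lt_nextGrid (m := m) h5.1
        have h7 := Nat.one_le_two_pow (n := m)
        have h8 : κ τ = κ (nextGrid u m τ) := le_antisymm (hx.mono h6.le)
          (h2 ▸ hx.mono (by omega))
        refine Finset.mem_filter.2 ⟨Finset.mem_filter.2 ⟨by simp; omega, ?_, h1, h2.trans h8⟩,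
          τ, by simp; omega, h8, ?_⟩
        · rw [nextGrid, Nat.add_sub_cancel_left]; exact dvd_mul_left _ _
        · rw [← hρ, hthr']; exact h4
    -- The block has survived until `e`, so all candidates missed their coins; the good path then
    -- has few candidates.
    have hhit := hx.good.hit u (by simp; omega) n (by simpa using hnT) m (by simp; omega) e
      (by simp; omega) hmn fun s hs hc => h.miss_of_candidate hx he heT hmn hB hs hc
    rw [h.ofulRho_ratio_eq] at hhit
    have hhit' : √((2 : ℝ) ^ m) * C.card ≤ 8 * Real.log (T / δ) * √((2 : ℝ) ^ n) := by
      have := hhit.le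
      rw [div_mul_eq_mul_div, div_le_iff₀ (hsq n)] at this
      convert this using 3
    rw [← hSg] at hcard
    have e1 : 2 * thr m * (Bad m).card ≤ 2 * thr m * (2 ^ m * C.card + 2 * √((2 : ℝ) ^ m) * Sg) :=
      mul_le_mul_of_nonneg_left hcard (by linarith [ht0 m])
    have e2 : 2 * thr m * (2 ^ m * C.card + 2 * √((2 : ℝ) ^ m) * Sg) =
        52800 * Q * (√((2 : ℝ) ^ m) * C.card + 2 * Sg) := by
      have a1 := mul_inv_cancel₀ (hsq m).ne'
      simp only [hthr]
      rw [div_eq_mul_inv]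
      linear_combination (52800 * Q * (√((2 : ℝ) ^ m) * C.card + 2 * Sg)) * a1 -
        52800 * Q * (√((2 : ℝ) ^ m))⁻¹ * C.card * hsq2 m
    rw [e2] at e1
    refine e1.trans ?_
    have := mul_le_mul_of_nonneg_left hhit' (show 0 ≤ 52800 * Q by linarith only [hQ])
    linarith only [this]
  have hmain : ∑ τ ∈ Finset.Icc u e, v τ ≤ ∑ τ ∈ Finset.Icc u e,
      (thr n + ∑ m ∈ Finset.range (n + 1), if thr m < v τ then 2 * thr m else 0) :=
    Finset.sum_le_sum fun τ hτ => le_add_sum_layers ht0 ht2 (hvle τ hτ) n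
  refine hmain.trans ?_
  rw [Finset.sum_add_distrib, Finset.sum_comm, Finset.sum_const, nsmul_eq_mul, Nat.card_Icc]
  have g1 : ((e + 1 - u : ℕ) : ℝ) * thr n ≤ 26400 * Q * √((2 : ℝ) ^ n) := by
    have : ((e + 1 - u : ℕ) : ℝ) ≤ 2 ^ n := by exact_mod_cast (by omega : e + 1 - u ≤ 2 ^ n)
    refine (mul_le_mul_of_nonneg_right this (ht0 n)).trans (le_of_eq ?_)
    have a1 := mul_inv_cancel₀ (hsq n).ne'
    simp only [hthr]
    rw [div_eq_mul_inv]
    linear_combination (26400 * Q * √((2 : ℝ) ^ n)) * a1 -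
      26400 * Q * (√((2 : ℝ) ^ n))⁻¹ * hsq2 n
  have g2 : ∑ m ∈ Finset.range (n + 1), ∑ τ ∈ Finset.Icc u e,
      (if thr m < v τ then 2 * thr m else 0) ≤
      ((n : ℝ) + 1) * (Q * (422400 * Real.log (T / δ) * √((2 : ℝ) ^ n) + 105600 * Sg)) := by
    refine (Finset.sum_le_card_nsmul _ _ (Q * (422400 * Real.log (T / δ) * √((2 : ℝ) ^ n) +
      105600 * Sg)) fun m hm => ?_).trans
      (le_of_eq (by rw [Finset.card_range, nsmul_eq_mul, Nat.cast_add_one]))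
    rw [← Finset.sum_filter, Finset.sum_const, nsmul_eq_mul, mul_comm]
    exact hbad m hm
  have g3 : 0 ≤ Q * (422400 * Real.log (T / δ) * √((2 : ℝ) ^ n) + 105600 * Sg) :=
    mul_nonneg (by linarith only [hQ]) (add_nonneg (mul_nonneg (mul_nonneg (by norm_num)
      (by linarith only [hL])) (hsq n).le) (mul_nonneg (by norm_num) hSg0))
  have g4 := mul_le_mul_of_nonneg_right hn g3
  linarith only [g1, g2, g4]

/-- Dynamic regret of MASTER in a block, up to a round `e` of the block. -/
lemma block_regret (h : LinSetting d T δ A θ) (hx : MasterPath T δ θ κ x) {u n e : ℕ}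
    (he : 1 ≤ e) (heT : e ≤ T)
    (hB : masterBlock (oful A T δ) T δ (ofulRho 100 d T δ) x e = ⟨u, n⟩) :
    ∑ τ ∈ Finset.Icc u e, (optReward (linReward A θ) τ - x.rew τ) ≤
      500000 * (numScales T * Real.log (T / δ)) ^ 2 * (d * Real.log (T / δ)) *
        (√((2 : ℝ) ^ n) + ∑ i ∈ (Finset.Icc u e).image κ,
            √(((Finset.Icc u e).filter fun τ => κ τ = i).card : ℝ)) := by
  have h1 := h.sum_est_sub_rew_le hx he heT hB
  have h2 := h.sum_optReward_sub_est_le hx he heT hB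
  have hL := h.log_ge
  have hd := h.d_cast
  have hN := two_le_numScales h.T_ge
  set Sg := ∑ i ∈ (Finset.Icc u e).image κ,
    √(((Finset.Icc u e).filter fun τ => κ τ = i).card : ℝ) with hSg
  have hSg0 : 0 ≤ Sg := Finset.sum_nonneg fun _ _ => Real.sqrt_nonneg _
  have hs0 := Real.sqrt_nonneg ((2 : ℝ) ^ n)
  have hsum := add_le_add h2 h1
  rw [← Finset.sum_add_distrib] at hsum
  simp only [sub_add_sub_cancel] at hsum
  refine hsum.trans ?_
  clear hsum h1 h2
  clear_value Sg
  generalize √((2 : ℝ) ^ n) = r at hs0 ⊢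
  generalize Real.log (T / δ) = l at hL ⊢
  generalize numScales T = N at hN ⊢
  have hNl : 1.38 ≤ N * l := by nlinarith
  have hQ0 : 0 ≤ N * l * (d * l) := by positivity
  have a1 : 33602 * r + N * (422400 * l * r + 105600 * Sg) ≤ 500000 * (N * l) * (r + Sg) := by
    have b1 : 1.38 * r ≤ N * l * r := mul_le_mul_of_nonneg_right hNl hs0
    have b2 : 0.69 * (N * Sg) ≤ l * (N * Sg) := mul_le_mul_of_nonneg_right hL (by positivity)
    have b3 : 0 ≤ N * Sg := by positivity
    linarith
  have a2 := mul_le_mul_of_nonneg_left a1 hQ0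
  linarith only [a2]

end LinSetting

end BlockRegret

/-! ### Summation over the blocks -/

section GlobalRegret

variable {d T : ℕ} {δ : ℝ} {A : Set (EuclideanSpace ℝ (Fin d))}
  {θ : ℕ → EuclideanSpace ℝ (Fin d)} {κ : ℕ → ℕ} {x : Transcript A}

lemma sum_sqrt_le_sqrt_card_mul_sum {ι : Type*} (s : Finset ι) (f : ι → ℝ) (hf : ∀ i ∈ s, 0 ≤ f i) :
    ∑ i ∈ s, √(f i) ≤ √(s.card * ∑ i ∈ s, f i) := by
  refine Real.le_sqrt_of_sq_le (sq_sum_le_card_mul_sum_sq.trans (le_of_eq ?_))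
  rw [Finset.sum_congr rfl fun i hi => Real.sq_sqrt (hf i hi)]

section Blocks

variable {P : Type v} {alg : BaseAlg P} {ρ : ℕ → ℝ} {y : Transcript P}

/-- Starting round of the block of MASTER that contains round `t`. -/
noncomputable def blockStart (alg : BaseAlg P) (T : ℕ) (δ : ℝ) (ρ : ℕ → ℝ) (y : Transcript P)
    (t : ℕ) : ℕ := (masterBlock alg T δ ρ y t).start

lemma blockStart_succ_cases {t : ℕ} (ht : 1 ≤ t) :
    blockStart alg T δ ρ y (t + 1) = t + 1 ∨
      blockStart alg T δ ρ y (t + 1) = blockStart alg T δ ρ y t := by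
  rcases masterBlock_succ_cases (alg := alg) (T := T) (δ := δ) (ρ := ρ) (x := y) ht with
    ⟨-, h⟩ | ⟨-, -, h⟩ | ⟨-, -, h⟩ <;> simp [blockStart, h]

lemma blockStart_le {t : ℕ} (ht : 1 ≤ t) : blockStart alg T δ ρ y t ≤ t :=
  (masterBlock_invariant ht).2.1

lemma image_blockStart_succ (t : ℕ) :
    (Finset.Icc 1 (t + 1)).image (blockStart alg T δ ρ y) =
      insert (blockStart alg T δ ρ y (t + 1)) ((Finset.Icc 1 t).image (blockStart alg T δ ρ y)) := by
  rw [← Finset.image_insert, Finset.insert_Icc_right_eq_Icc_add_one (by omega)]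

lemma succ_notMem_image_blockStart (t : ℕ) :
    t + 1 ∉ (Finset.Icc 1 t).image (blockStart alg T δ ρ y) := fun h => by
  obtain ⟨τ, hτ, h'⟩ := Finset.mem_image.1 h
  have h1 := Finset.mem_Icc.1 hτ
  have h2 := blockStart_le (alg := alg) (T := T) (δ := δ) (ρ := ρ) (y := y) h1.1
  omega

/-- Each new block pays for its planned length by the advance of the start: a completed block
advances it by 2^n, and 3·2^n ≥ 2^{n+1}; a restart advances it by at least 1 and plans a block of
length 1. -/
lemma sum_two_pow_order_le {t : ℕ} (ht : 1 ≤ t) :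
    ∑ u ∈ (Finset.Icc 1 t).image (blockStart alg T δ ρ y),
      2 ^ (masterBlock alg T δ ρ y u).order ≤ 3 * blockStart alg T δ ρ y t := by
  induction t, ht using Nat.le_induction with
  | base =>
    have : masterBlock alg T δ ρ y 1 = ⟨1, 0⟩ := by rw [masterBlock]
    simp [blockStart, this]
  | succ t ht ih =>
    have h0 := blockStart_le (alg := alg) (T := T) (δ := δ) (ρ := ρ) (y := y) ht
    have hnot := succ_notMem_image_blockStart (alg := alg) (T := T) (δ := δ) (ρ := ρ) (y := y) t
    rw [image_blockStart_succ]
    rcases masterBlock_succ_cases (alg := alg) (T := T) (δ := δ) (ρ := ρ) (x := y) ht with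
      ⟨-, h⟩ | ⟨-, h', h⟩ | ⟨-, -, h⟩
    · have e : blockStart alg T δ ρ y (t + 1) = t + 1 := by rw [blockStart, h]
      rw [e, Finset.sum_insert hnot, h]
      simp only [pow_zero]
      omega
    · have e : blockStart alg T δ ρ y (t + 1) = t + 1 := by rw [blockStart, h]
      rw [e, Finset.sum_insert hnot, h]
      change t + 1 = blockStart alg T δ ρ y t + _ at h'
      simp only [pow_succ]
      omega
    · have e : blockStart alg T δ ρ y (t + 1) = blockStart alg T δ ρ y t := by
        rw [blockStart, h, blockStart]
      rw [e, Finset.insert_eq_self.2 (Finset.mem_image_of_mem _ (by simp; omega))]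
      exact ih

/-- Along the rounds, a new pair appears only when a new block begins or the label increases. -/
lemma card_image_pair_le (hκ : Monotone κ) {t : ℕ} (ht : 1 ≤ t) :
    ((Finset.Icc 1 t).image fun τ => (blockStart alg T δ ρ y τ, κ τ)).card ≤
      ((Finset.Icc 1 t).image (blockStart alg T δ ρ y)).card + κ t := by
  induction t, ht using Nat.le_induction with
  | base => simp
  | succ t ht ih =>
    have hnot := succ_notMem_image_blockStart (alg := alg) (T := T) (δ := δ) (ρ := ρ) (y := y) t
    have hmono := hκ (show t ≤ t + 1 by omega)
    rw [image_blockStart_succ, ← Finset.insert_Icc_right_eq_Icc_add_one (by omega),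
      Finset.image_insert]
    have h1 := Finset.card_insert_le (blockStart alg T δ ρ y (t + 1), κ (t + 1))
      ((Finset.Icc 1 t).image fun τ => (blockStart alg T δ ρ y τ, κ τ))
    rcases blockStart_succ_cases (alg := alg) (T := T) (δ := δ) (ρ := ρ) (y := y) ht with h | h
    · rw [h] at h1 ⊢
      rw [Finset.card_insert_of_notMem hnot]
      omega
    · have hmem := Finset.mem_image_of_mem (blockStart alg T δ ρ y)
        (show t ∈ Finset.Icc 1 t by simp; omega)
      rw [h] at h1 ⊢
      rw [Finset.insert_eq_self.2 hmem]
      rcases hmono.eq_or_lt with h2 | h2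
      · rw [Finset.insert_eq_self.2 (Finset.mem_image.2 ⟨t, by simp; omega, by rw [h2]⟩)]
        omega
      · omega

/-- The rounds of a block, up to round `T`, are an interval. -/
lemma filter_blockStart_eq {u : ℕ} (hu : u ∈ (Finset.Icc 1 T).image (blockStart alg T δ ρ y)) :
    ∃ e ∈ Finset.Icc 1 T, masterBlock alg T δ ρ y e = ⟨u, (masterBlock alg T δ ρ y u).order⟩ ∧
      (Finset.Icc 1 T).filter (fun τ => blockStart alg T δ ρ y τ = u) = Finset.Icc u e := by
  obtain ⟨τ0, hτ0, h0⟩ := Finset.mem_image.1 hu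
  have hne : ((Finset.Icc 1 T).filter fun τ => blockStart alg T δ ρ y τ = u).Nonempty :=
    ⟨τ0, Finset.mem_filter.2 ⟨hτ0, h0⟩⟩
  have he := Finset.max'_mem _ hne
  set e := Finset.max' _ hne with hedef
  obtain ⟨h1, h2⟩ := Finset.mem_filter.1 he
  have h3 := Finset.mem_Icc.1 h1
  obtain ⟨i1, i2, -, -, i5⟩ :=
    masterBlock_invariant (alg := alg) (T := T) (δ := δ) (ρ := ρ) (x := y) h3.1
  have h2' : (masterBlock alg T δ ρ y e).start = u := h2
  rw [h2'] at i1 i2 i5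
  refine ⟨e, h1, ?_, ?_⟩
  · rw [i5 u (by simp; omega), ← h2']
  · ext τ
    rw [Finset.mem_filter, Finset.mem_Icc, Finset.mem_Icc]
    constructor
    · rintro ⟨h4, h5⟩
      have := blockStart_le (alg := alg) (T := T) (δ := δ) (ρ := ρ) (y := y) h4.1
      exact ⟨by omega, Finset.le_max' _ τ (Finset.mem_filter.2 ⟨Finset.mem_Icc.2 h4, h5⟩)⟩
    · intro h4
      exact ⟨by omega, by rw [blockStart, i5 τ (by simp; omega), h2']⟩

end Blocks

namespace LinSetting

/-- Every restart consumes a label. -/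
lemma card_blocks_le (h : LinSetting d T δ A θ) (hx : MasterPath T δ θ κ x) {t : ℕ} (ht : 1 ≤ t)
    (htT : t ≤ T) :
    ((Finset.Icc 1 t).image (blockStart (oful A T δ) T δ (ofulRho 100 d T δ) x)).card ≤
      (Nat.log 2 T + 1) * κ (blockStart (oful A T δ) T δ (ofulRho 100 d T δ) x t) +
        (masterBlock (oful A T δ) T δ (ofulRho 100 d T δ) x t).order + 1 := by
  set ρ := ofulRho 100 d T δ with hρ
  induction t, ht using Nat.le_induction with
  | base => simp
  | succ t ht ih =>
    have ih := ih (by omega)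
    obtain ⟨i1, i2, -, i4, -⟩ :=
      masterBlock_invariant (alg := oful A T δ) (T := T) (δ := δ) (ρ := ρ) (x := x) ht
    have hstart : (masterBlock (oful A T δ) T δ ρ x t).start = blockStart (oful A T δ) T δ ρ x t :=
      rfl
    rw [image_blockStart_succ]
    have hins := Finset.card_insert_le (blockStart (oful A T δ) T δ ρ x (t + 1))
      ((Finset.Icc 1 t).image (blockStart (oful A T δ) T δ ρ x))
    rcases masterBlock_succ_cases (alg := oful A T δ) (T := T) (δ := δ) (ρ := ρ) (x := x) ht with
      ⟨hf, h'⟩ | ⟨-, -, h'⟩ | ⟨-, -, h'⟩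
    · have e : blockStart (oful A T δ) T δ ρ x (t + 1) = t + 1 := by rw [blockStart, h']
      rw [e] at hins ⊢
      rw [h']
      -- A restart resets the order, of size at most log₂ T. The loss is covered by the increase of
      -- the label term, so the right-hand side still grows by at least 1.
      have hlog : (masterBlock (oful A T δ) T δ ρ x t).order ≤ Nat.log 2 T :=
        Nat.le_log_of_pow_le (by norm_num) (by omega)
      -- If the label were unchanged since the start of the block, the block would be
      -- near-stationary and no test could have failed.
      have hlt : κ (blockStart (oful A T δ) T δ ρ x t) < κ (t + 1) := by
        refine (lt_of_le_of_ne (hx.mono i2) fun hc => ?_).trans_le (hx.mono (by omega))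
        exact h.not_testFails_of_drift_le hx (u := (masterBlock (oful A T δ) T δ ρ x t).start)
          (n := (masterBlock (oful A T δ) T δ ρ x t).order) ht (by omega) rfl
          (hx.stat _ t i1 i2 (by omega) hc) hf
      have := Nat.mul_le_mul_left (Nat.log 2 T + 1) hlt
      simp only [Nat.succ_eq_add_one] at this
      rw [Nat.mul_add_one (Nat.log 2 T + 1)] at this
      simp only
      omega
    · have e : blockStart (oful A T δ) T δ ρ x (t + 1) = t + 1 := by rw [blockStart, h']
      rw [e] at hins ⊢
      rw [h']
      have := Nat.mul_le_mul_left (Nat.log 2 T + 1)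
        (hx.mono (show blockStart (oful A T δ) T δ ρ x t ≤ t + 1 by omega))
      simp only
      omega
    · have e : blockStart (oful A T δ) T δ ρ x (t + 1) = blockStart (oful A T δ) T δ ρ x t := by
        rw [blockStart, h', blockStart]
      rw [e, h', Finset.insert_eq_self.2 (Finset.mem_image_of_mem _ (by simp; omega))]
      exact ih

lemma numScales_le (h : LinSetting d T δ A θ) : numScales T ≤ 3 * Real.log (T / δ) := by
  have h1 := h.log_T_le
  have h2 := h.log_ge
  have h3 := Real.log_two_gt_d9
  have h4 : Real.logb 2 T ≤ Real.log (T / δ) / 0.69 := by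
    rw [Real.logb]
    exact div_le_div₀ (by linarith) h1 (by norm_num) (by linarith)
  rw [le_div_iff₀ (by norm_num)] at h4
  rw [numScales]
  linarith

/-- Dynamic regret of MASTER on a good realization. -/
lemma dynRegret_le (h : LinSetting d T δ A θ) (hx : MasterPath T δ θ κ x) :
    dynRegret (linReward A θ) T x.rew ≤
      50000000 * Real.log (T / δ) ^ 6 * (d * √((κ T + 1 : ℕ) * T)) := by
  have hT1 : 1 ≤ T := by have := h.T_ge; omega
  have hL := h.log_ge
  have hd := h.d_cast
  have hN := two_le_numScales h.T_ge
  have hN3 := h.numScales_le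
  set ρ := ofulRho 100 d T δ with hρ
  set st := blockStart (oful A T δ) T δ ρ x with hst
  set S := (Finset.Icc 1 T).image st with hS
  set c := 500000 * (numScales T * Real.log (T / δ)) ^ 2 * (d * Real.log (T / δ)) with hc
  have hc0 : 0 ≤ c := by positivity
  set F : ℕ → Finset ℕ := fun u => (Finset.Icc 1 T).filter fun τ => st τ = u with hF
  -- Pairs of a block and a label occurring in it; their round sets partition [1, T].
  set pairs := S.sigma fun u => (F u).image κ with hpairs
  have e1 : dynRegret (linReward A θ) T x.rew ≤ c *
      (∑ u ∈ S, √((2 ^ (masterBlock (oful A T δ) T δ ρ x u).order : ℕ) : ℝ) +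
        ∑ p ∈ pairs, √(((F p.1).filter fun τ => κ τ = p.2).card : ℝ)) := by
    rw [dynRegret, ← Finset.sum_fiberwise_of_maps_to (t := S) (g := st)
      fun τ hτ => Finset.mem_image_of_mem _ hτ, hpairs, Finset.sum_sigma, ← Finset.sum_add_distrib,
      Finset.mul_sum]
    refine Finset.sum_le_sum fun u hu => ?_
    obtain ⟨e, he, hBe, hFe⟩ := filter_blockStart_eq hu
    have he' := Finset.mem_Icc.1 he
    have := h.block_regret hx he'.1 he'.2 hBe
    simp only [show F u = Finset.Icc u e from hFe]
    rw [show ((Finset.Icc 1 T).filter fun τ => st τ = u) = Finset.Icc u e from hFe]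
    push_cast
    exact this
  have hScard : (S.card : ℝ) ≤ numScales T * (κ T + 1 : ℕ) := by
    have a1 := h.card_blocks_le hx hT1 le_rfl
    rw [← hρ, ← hst, ← hS] at a1
    obtain ⟨-, i2, -, i4, -⟩ :=
      masterBlock_invariant (alg := oful A T δ) (T := T) (δ := δ) (ρ := ρ) (x := x) hT1
    have a2 : (masterBlock (oful A T δ) T δ ρ x T).order ≤ Nat.log 2 T :=
      Nat.le_log_of_pow_le (by norm_num) (i4.trans i2)
    have a3 := Nat.mul_le_mul_left (Nat.log 2 T + 1) (hx.mono i2)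
    have a4 : S.card ≤ (Nat.log 2 T + 1) * (κ T + 1) := by
      rw [Nat.mul_add_one]
      refine a1.trans ?_
      change _ ≤ _ at a3
      have : (Nat.log 2 T + 1) * κ (st T) ≤ (Nat.log 2 T + 1) * κ T := a3
      omega
    have a5 := add_one_le_numScales (T := T) (n := Nat.log 2 T)
      (Nat.pow_log_le_self 2 (by omega))
    calc (S.card : ℝ) ≤ ((Nat.log 2 T + 1) * (κ T + 1) : ℕ) := by exact_mod_cast a4
      _ = ((Nat.log 2 T : ℝ) + 1) * (κ T + 1 : ℕ) := by push_cast; ring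
      _ ≤ _ := mul_le_mul_of_nonneg_right a5 (by positivity)
  have hpcard : (pairs.card : ℝ) ≤ (numScales T + 1) * (κ T + 1 : ℕ) := by
    have a1 := card_image_pair_le (alg := oful A T δ) (T := T) (δ := δ) (ρ := ρ) (y := x)
      hx.mono hT1
    have a2 : pairs.card ≤ ((Finset.Icc 1 T).image fun τ => (st τ, κ τ)).card := by
      refine Finset.card_le_card_of_injOn (fun p => (p.1, p.2)) (fun p hp => ?_) ?_
      · obtain ⟨h1, h2⟩ := Finset.mem_sigma.1 hp
        obtain ⟨τ, hτ, h3⟩ := Finset.mem_image.1 h2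
        obtain ⟨h4, h5⟩ := Finset.mem_filter.1 hτ
        exact Finset.mem_coe.2 (Finset.mem_image.2 ⟨τ, h4, by simp [h5, h3]⟩)
      · rintro ⟨a, b⟩ - ⟨a', b'⟩ - hab
        simp only [Prod.mk.injEq] at hab
        rw [hab.1, hab.2]
    have a3 : (pairs.card : ℝ) ≤ S.card + κ T := by exact_mod_cast a2.trans a1
    push_cast at hScard ⊢
    linarith
  have hFsum : ∑ p ∈ pairs, (((F p.1).filter fun τ => κ τ = p.2).card : ℝ) = T := by
    rw [hpairs, Finset.sum_sigma]
    have : ∀ u ∈ S, ∑ i ∈ (F u).image κ, (((F u).filter fun τ => κ τ = i).card : ℝ) =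
        ((F u).card : ℝ) := fun u _ => by
      rw [Finset.card_eq_sum_card_fiberwise (f := κ) (t := (F u).image κ) fun τ hτ =>
        Finset.mem_image_of_mem _ hτ]
      push_cast; rfl
    rw [Finset.sum_congr rfl this]
    have h2 := Finset.card_eq_sum_card_fiberwise (s := Finset.Icc 1 T) (f := st) (t := S) fun τ hτ =>
      Finset.mem_image_of_mem _ hτ
    rw [Nat.card_Icc, Nat.add_sub_cancel] at h2
    exact_mod_cast h2.symm
  have hT0 : (0 : ℝ) ≤ T := Nat.cast_nonneg T
  have hM0 : (0 : ℝ) ≤ (κ T + 1 : ℕ) := Nat.cast_nonneg _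
  have e2 : ∑ u ∈ S, √((2 ^ (masterBlock (oful A T δ) T δ ρ x u).order : ℕ) : ℝ) ≤
      2 * numScales T * √((κ T + 1 : ℕ) * T) := by
    refine (sum_sqrt_le_sqrt_card_mul_sum _ _ fun _ _ => Nat.cast_nonneg _).trans ?_
    have a1 : ∑ u ∈ S, ((2 ^ (masterBlock (oful A T δ) T δ ρ x u).order : ℕ) : ℝ) ≤ 3 * T := by
      have := sum_two_pow_order_le (alg := oful A T δ) (T := T) (δ := δ) (ρ := ρ) (y := x) hT1
      have h2 := blockStart_le (alg := oful A T δ) (T := T) (δ := δ) (ρ := ρ) (y := x) hT1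
      exact_mod_cast this.trans (Nat.mul_le_mul_left 3 h2)
    have a2 := mul_le_mul hScard a1 (Finset.sum_nonneg fun _ _ => Nat.cast_nonneg _)
      (by positivity)
    refine Real.sqrt_le_iff.2 ⟨by positivity, a2.trans ?_⟩
    rw [mul_pow, Real.sq_sqrt (by positivity)]
    have : 3 * numScales T ≤ (2 * numScales T) ^ 2 := by nlinarith
    have := mul_le_mul_of_nonneg_right this (show 0 ≤ ((κ T + 1 : ℕ) : ℝ) * T by positivity)
    linarith
  have e3 : ∑ p ∈ pairs, √(((F p.1).filter fun τ => κ τ = p.2).card : ℝ) ≤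
      numScales T * √((κ T + 1 : ℕ) * T) := by
    refine (sum_sqrt_le_sqrt_card_mul_sum _ _ fun _ _ => Nat.cast_nonneg _).trans ?_
    rw [hFsum]
    have a2 := mul_le_mul_of_nonneg_right hpcard hT0
    refine Real.sqrt_le_iff.2 ⟨by positivity, a2.trans ?_⟩
    rw [mul_pow, Real.sq_sqrt (by positivity)]
    have : numScales T + 1 ≤ numScales T ^ 2 := by nlinarith
    have := mul_le_mul_of_nonneg_right this (show 0 ≤ ((κ T + 1 : ℕ) : ℝ) * T by positivity)
    linarith
  refine e1.trans ((mul_le_mul_of_nonneg_left (add_le_add e2 e3) hc0).trans ?_)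
  rw [hc]
  have hr := Real.sqrt_nonneg (((κ T + 1 : ℕ) : ℝ) * T)
  clear e1 e2 e3 hFsum hScard hpcard
  generalize √(((κ T + 1 : ℕ) : ℝ) * T) = r at hr ⊢
  generalize Real.log (T / δ) = l at hL hN3 ⊢
  generalize numScales T = N at hN hN3 ⊢
  -- Two powers of n̂ come from the blocks and one from their number; with n̂ ≤ 3 log(T/δ), the
  -- total is six logarithms.
  have hN3' : N ^ 3 ≤ (3 * l) ^ 3 := pow_le_pow_left₀ (by linarith) hN3 3
  have h0 : 0 ≤ 1500000 * l ^ 3 * (d * r) := by positivity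
  have h1 : 0 ≤ l ^ 6 * (d * r) := by positivity
  calc _ = N ^ 3 * (1500000 * l ^ 3 * (d * r)) := by ring
    _ ≤ (3 * l) ^ 3 * (1500000 * l ^ 3 * (d * r)) := mul_le_mul_of_nonneg_right hN3' h0
    _ = 40500000 * (l ^ 6 * (d * r)) := by ring
    _ ≤ _ := by linarith

end LinSetting

end GlobalRegret

/-! ### Labellings by changes and by accumulated variation -/

section Labelling

variable {d T : ℕ} {δ : ℝ} {A : Set (EuclideanSpace ℝ (Fin d))}
  {θ : ℕ → EuclideanSpace ℝ (Fin d)}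

variable (T δ θ) in
/-- A monotone labelling of the rounds whose classes are near-stationary. -/
structure IsLabelling (κ : ℕ → ℕ) : Prop where
  mono : Monotone κ
  stat : ∀ s e, 1 ≤ s → s ≤ e → e ≤ T → κ s = κ e →
    drift (ofulDelta 400 T δ θ) s e ≤ ofulRho 100 d T δ (e - s + 1)

namespace LinSetting

/-- Labelling by the number of changes. -/
lemma exists_labelling_numStationary (h : LinSetting d T δ A θ) :
    ∃ κ, IsLabelling T δ θ κ ∧ κ T + 1 = numStationary (ofulDelta 400 T δ θ) T := by
  classical
  refine ⟨fun t => ((Finset.Ico 1 t).filter fun τ => ofulDelta 400 T δ θ τ ≠ 0).card,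
    ⟨fun s t hst => ?_, fun s e hs hse _ hκ => ?_⟩, ?_⟩
  · exact Finset.card_le_card (Finset.filter_subset_filter _ (Finset.Ico_subset_Ico_right hst))
  -- Nested sets of changes with equal cardinality coincide, so there is no change between `s` and
  -- `e` and the drift vanishes.
  · have heq := Finset.eq_of_subset_of_card_le (Finset.filter_subset_filter
      (fun τ => ofulDelta 400 T δ θ τ ≠ 0) (Finset.Ico_subset_Ico_right (a := 1) hse)) hκ.ge
    refine le_trans (le_of_eq ?_) (h.ofulRho_pos (by omega)).le
    refine Finset.sum_eq_zero fun τ hτ => ?_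
    have hτ' := Finset.mem_Ico.1 hτ
    by_contra hc
    have : τ ∈ (Finset.Ico 1 s).filter fun τ => ofulDelta 400 T δ θ τ ≠ 0 :=
      heq ▸ Finset.mem_filter.2 ⟨by simp; omega, hc⟩
    have := (Finset.mem_Ico.1 (Finset.mem_filter.1 this).1).2
    omega
  · rw [numStationary, add_comm]

lemma drift_split {s e : ℕ} (hs : 1 ≤ s) (hse : s ≤ e) :
    drift (ofulDelta 400 T δ θ) 1 s + drift (ofulDelta 400 T δ θ) s e =
      drift (ofulDelta 400 T δ θ) 1 e :=
  Finset.sum_Ico_consecutive _ hs hse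

lemma paramVariation_nonneg : 0 ≤ paramVariation T θ := Finset.sum_nonneg fun _ _ => norm_nonneg _

lemma paramVariation_le (h : LinSetting d T δ A θ) : paramVariation T θ ≤ 2 * T := by
  have : ∀ t ∈ Finset.Ico 1 T, ‖θ t - θ (t + 1)‖ ≤ 2 := fun t ht => by
    have ht' := Finset.mem_Ico.1 ht
    have h1 := h.norm_param t (by simp; omega)
    have h2 := h.norm_param (t + 1) (by simp; omega)
    linarith [norm_sub_le (θ t) (θ (t + 1))]
  have h3 := Finset.sum_le_card_nsmul _ _ _ this
  rw [Nat.card_Ico, nsmul_eq_mul] at h3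
  have h4 : ((T - 1 : ℕ) : ℝ) ≤ T := by exact_mod_cast Nat.sub_le _ _
  rw [paramVariation]
  linarith

/-- Labelling by windows of length `W`, cut further where the drift accumulates. -/
lemma exists_labelling_window (h : LinSetting d T δ A θ) {W : ℕ} (hW : 1 ≤ W) :
    ∃ κ, IsLabelling T δ θ κ ∧
      ((κ T + 1 : ℕ) : ℝ) ≤ 1 + T / W + 1.21 * (paramVariation T θ * √(W : ℝ)) := by
  have hρ := h.ofulRho_pos hW
  set r := ofulRho 100 d T δ W with hr
  have hm1 : Monotone fun t : ℕ => (t - 1) / W := fun s t hst => Nat.div_le_div_right (by omega)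
  have hm2 : Monotone fun t : ℕ => ⌊drift (ofulDelta 400 T δ θ) 1 t / r⌋₊ := fun s t hst =>
    Nat.floor_le_floor (div_le_div_of_nonneg_right (drift_le_of_subset le_rfl hst) hρ.le)
  -- Both summands are monotone, so equal labels force equal windows and equal drift cells: length
  -- at most `W` and drift at most ρ(W).
  refine ⟨fun t => (t - 1) / W + ⌊drift (ofulDelta 400 T δ θ) 1 t / r⌋₊,
    ⟨fun s t hst => Nat.add_le_add (hm1 hst) (hm2 hst), fun s e hs hse _ hκ => ?_⟩, ?_⟩
  · have a1 := hm1 hse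
    have a2 := hm2 hse
    simp only at a1 a2 hκ
    have b1 : (s - 1) / W = (e - 1) / W := by omega
    have b2 : ⌊drift (ofulDelta 400 T δ θ) 1 s / r⌋₊ = ⌊drift (ofulDelta 400 T δ θ) 1 e / r⌋₊ := by
      omega
    have c1 : e - s + 1 ≤ W := by
      have d1 := Nat.div_mul_le_self (s - 1) W
      have d2 := Nat.lt_div_mul_add (a := e - 1) (show 0 < W by omega)
      rw [← b1] at d2
      omega
    have c2 : drift (ofulDelta 400 T δ θ) s e ≤ r := by
      have d1 := Nat.floor_le (div_nonneg (drift_nonneg (T := T) (δ := δ) (θ := θ) 1 s) hρ.le)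
      have d2 := Nat.lt_floor_add_one (drift (ofulDelta 400 T δ θ) 1 e / r)
      rw [← b2] at d2
      have d3 : drift (ofulDelta 400 T δ θ) 1 e / r < drift (ofulDelta 400 T δ θ) 1 s / r + 1 := by
        linarith
      rw [← drift_split hs hse, add_div, add_lt_add_iff_left, div_lt_one hρ] at d3
      exact d3.le
    exact c2.trans (h.ofulRho_le (by omega) c1)
  · have hL := h.log_ge
    have hd := h.d_cast
    have hV := paramVariation_nonneg (T := T) (θ := θ)
    have a1 : (((T - 1) / W : ℕ) : ℝ) ≤ T / W := Nat.cast_div_le.trans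
      (div_le_div_of_nonneg_right (by exact_mod_cast Nat.sub_le _ _) (Nat.cast_nonneg _))
    have a2 := Nat.floor_le (div_nonneg (drift_nonneg (T := T) (δ := δ) (θ := θ) 1 T) hρ.le)
    have a3 : drift (ofulDelta 400 T δ θ) 1 T / r ≤ 1.21 * (paramVariation T θ * √(W : ℝ)) := by
      rw [div_le_iff₀ hρ, hr, h.ofulRho_eq, drift_ofulDelta]
      change 400 * d * √(Real.log (T / δ)) * paramVariation T θ ≤ _
      have hw : (0 : ℝ) < √(W : ℝ) := Real.sqrt_pos.2 (by exact_mod_cast hW)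
      -- The ratio of the drift to ρ(W) is Δ̂√W/√log(T/δ), and log(T/δ) ≥ 0.69 turns the last factor
      -- into 1.21.
      have hs : √(Real.log (T / δ)) ≤ 1.21 * Real.log (T / δ) :=
        Real.sqrt_le_iff.2 ⟨by positivity, by nlinarith⟩
      have e1 : 1.21 * (paramVariation T θ * √(W : ℝ)) *
          (400 * (d * Real.log (T / δ)) / √(W : ℝ)) =
          400 * d * paramVariation T θ * (1.21 * Real.log (T / δ)) := by
        field_simp
      rw [e1]
      have := mul_le_mul_of_nonneg_left hs
        (show 0 ≤ 400 * d * paramVariation T θ by positivity)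
      linarith
    push_cast
    linarith

/-- Labelling that balances the window length against the variation. -/
lemma exists_labelling_paramVariation (h : LinSetting d T δ A θ) :
    ∃ κ, IsLabelling T δ θ κ ∧ √((κ T + 1 : ℕ) * T) ≤
      2 * (paramVariation T θ ^ (1 / 3 : ℝ) * (T : ℝ) ^ (2 / 3 : ℝ) + √(T : ℝ)) := by
  have hT2 : (2 : ℝ) ≤ T := by exact_mod_cast h.T_ge
  have hV := paramVariation_nonneg (T := T) (θ := θ)
  rcases hV.eq_or_lt with h0 | hpos
  -- Without variation a single class suffices; the window length below would be infinite.
  · refine ⟨fun _ => 0, ⟨monotone_const, fun s e hs hse heT _ => ?_⟩, ?_⟩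
    · refine le_trans ?_ (h.ofulRho_pos (by omega)).le
      refine (drift_le_of_subset hs heT).trans (le_of_eq ?_)
      rw [drift_ofulDelta]
      change _ * paramVariation T θ = 0
      rw [← h0, mul_zero]
    · have := Real.sqrt_nonneg (T : ℝ)
      rw [← h0]
      simp
      linarith
  set D := paramVariation T θ with hD
  set a := (T : ℝ) ^ (1 / 3 : ℝ) with ha
  set b := D ^ (1 / 3 : ℝ) with hb
  have ha0 : 0 < a := by positivity
  have hb0 : 0 < b := by positivity
  have ha3 : a ^ 3 = T := by
    rw [ha, ← Real.rpow_natCast, ← Real.rpow_mul (by positivity)]; norm_num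
  have hb3 : b ^ 3 = D := by
    rw [hb, ← Real.rpow_natCast, ← Real.rpow_mul hV]; norm_num
  have ha2 : (T : ℝ) ^ (2 / 3 : ℝ) = a ^ 2 := by
    rw [ha, ← Real.rpow_natCast, ← Real.rpow_mul (by positivity)]; norm_num
  set y := a / b with hy
  have hy0 : 0 < y := by positivity
  have hya : y * b = a := div_mul_cancel₀ _ hb0.ne'
  -- Since Δ̂ ≤ 2T, the ideal scale y = (T/Δ̂)^{1/3} is at least 1/2; hence rounding y² up gives W ≤
  -- 5y² ≤ (2.25y)².
  have hy2 : 1 ≤ 4 * y ^ 2 := by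
    have h1 : b ^ 3 ≤ 2 * (y * b) ^ 3 := by rw [hya, ha3, hb3]; exact h.paramVariation_le
    rw [mul_pow, ← mul_assoc] at h1
    have h2 : 1 ≤ 2 * y ^ 3 := by
      by_contra hc
      have := mul_lt_mul_of_pos_right (not_le.1 hc) (pow_pos hb0 3)
      linarith
    by_contra hc
    have h3 : y < 1 / 2 := by nlinarith
    nlinarith [pow_pos hy0 2]
  set W := ⌈y ^ 2⌉₊ with hW
  have hW1 : 1 ≤ W := Nat.one_le_ceil_iff.2 (by positivity)
  have hW2 : y ^ 2 ≤ W := Nat.le_ceil _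
  have hW3 : (W : ℝ) ≤ (2.25 * y) ^ 2 := by
    have := Nat.ceil_lt_add_one (show 0 ≤ y ^ 2 by positivity)
    nlinarith
  have hW4 : √(W : ℝ) ≤ 2.25 * y := Real.sqrt_le_iff.2 ⟨by positivity, hW3⟩
  obtain ⟨κ, hκ, hM⟩ := h.exists_labelling_window hW1
  refine ⟨κ, hκ, ?_⟩
  rw [ha2]
  have hW0 : (0 : ℝ) < W := by exact_mod_cast hW1
  have e1 : (T : ℝ) / W * T ≤ (b * a ^ 2) ^ 2 := by
    rw [div_mul_eq_mul_div, div_le_iff₀ hW0]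
    refine le_trans (le_of_eq ?_) (mul_le_mul_of_nonneg_left hW2 (by positivity))
    rw [← ha3]
    have : (b * a ^ 2) ^ 2 * y ^ 2 = a ^ 4 * (y * b) ^ 2 := by ring
    rw [this, hya]; ring
  have e2 : 1.21 * (D * √(W : ℝ)) * T ≤ 2.75 * (b * a ^ 2) ^ 2 := by
    have : D * √(W : ℝ) * T ≤ D * (2.25 * y) * T := by gcongr
    have e3 : D * (2.25 * y) * T = 2.25 * (b * a ^ 2) ^ 2 := by
      rw [← ha3, ← hb3]
      have : b ^ 3 * (2.25 * y) * a ^ 3 = 2.25 * (b ^ 2 * a ^ 3 * (y * b)) := by ring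
      rw [this, hya]; ring
    have : 0 ≤ (b * a ^ 2) ^ 2 := by positivity
    linarith
  have e4 := mul_le_mul_of_nonneg_right hM (show (0 : ℝ) ≤ T by positivity)
  have hs := Real.sq_sqrt (show (0 : ℝ) ≤ T by positivity)
  have hs0 := Real.sqrt_nonneg (T : ℝ)
  have hq : 0 ≤ b * a ^ 2 := by positivity
  refine Real.sqrt_le_iff.2 ⟨by positivity, ?_⟩
  -- The three terms of the class count, times T, are at most T, q² and 2.75q² with q =
  -- Δ̂^{1/3}T^{2/3}; the square of 2(q + √T) exceeds their sum.
  nlinarith [mul_nonneg hq hs0]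

/-- Regret bound of MASTER for a fixed labelling, with high probability. -/
lemma measure_dynRegret_le (h : LinSetting d T δ A θ) {κ : ℕ → ℕ} (hκ : IsLabelling T δ θ κ)
    {Ω : Type u} [mΩ : MeasurableSpace Ω] {μ : Measure Ω} [IsProbabilityMeasure μ]
    {G : Filtration ℕ mΩ} {coin : ℕ → ℕ → Ω → unitInterval} {pol : ℕ → Ω → A} {rew : ℕ → Ω → ℝ}
    (hM : IsMasterRun (oful A T δ) δ (ofulRho 100 d T δ) μ G T (linReward A θ) coin pol rew)
    {b : ℝ} (hb : √((κ T + 1 : ℕ) * T) ≤ 2 * b) :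
    μ {ω | ¬ (dynRegret (linReward A θ) T (rew · ω) ≤
      100000000 * Real.log (T / δ) ^ 6 * (d * b))} ≤ ENNReal.ofReal δ := by
  refine le_trans (measure_mono fun ω hω => ?_) (h.measure_not_goodPath_le hM κ)
  rw [Set.mem_ofPred_eq] at hω ⊢
  refine fun hgood => hω ?_
  have hL := h.log_ge
  refine (h.dynRegret_le (x := runTranscript coin pol rew ω)
    ⟨hgood, fun t ht => hM.follows t ht ω, fun t ht => hM.interaction.rew_mem t ht ω, hκ.mono,
      hκ.stat⟩).trans ?_
  have h1 := mul_le_mul_of_nonneg_left hb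
    (show 0 ≤ 50000000 * Real.log (T / δ) ^ 6 * d by positivity)
  linarith

end LinSetting

end Labelling

/-! ### Assembly of the theorem -/

theorem mainTheorem4 :
    ∃ cρ > (0 : ℝ), ∃ cΔ > (0 : ℝ), ∃ K > (0 : ℝ), ∃ k : ℕ,
      ∀ (d T : ℕ) (δ : ℝ) (A : Set (EuclideanSpace ℝ (Fin d)))
        (θ : ℕ → EuclideanSpace ℝ (Fin d)),
        1 ≤ d → 2 ≤ T → 0 < δ → δ < 1 →
        A.Nonempty → (∀ a ∈ A, ‖a‖ ≤ 1) →
        (∀ t ∈ Finset.Icc 1 T, ‖θ t‖ ≤ 1) →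
        (∀ t ∈ Finset.Icc 1 T, ∀ a : A, linReward A θ t a ∈ Set.Icc (0 : ℝ) 1) →
        NearStationaryGuarantee.{u} (oful A T δ) (linReward A θ) T δ
            (ofulDelta cΔ T δ θ) (ofulRho cρ d T δ) ∧
        (∀ t ∈ Finset.Icc 1 T,
            (t : ℝ) * ofulRho cρ d T δ t ≤ K * Real.log (T / δ) ^ k * (d * √(t : ℝ))) ∧
        ∀ (Ω : Type u) [mΩ : MeasurableSpace Ω] (μ : Measure Ω) [IsProbabilityMeasure μ]
          (G : Filtration ℕ mΩ) (coin : ℕ → ℕ → Ω → unitInterval) (pol : ℕ → Ω → A)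
          (rew : ℕ → Ω → ℝ),
          IsMasterRun (oful A T δ) δ (ofulRho cρ d T δ) μ G T (linReward A θ) coin pol rew →
          μ {ω | ¬ (dynRegret (linReward A θ) T (rew · ω) ≤
                K * Real.log (T / δ) ^ k *
                  min (d * √((numStationary (ofulDelta cΔ T δ θ) T : ℝ) * T))
                    (d * paramVariation T θ ^ (1 / 3 : ℝ) * (T : ℝ) ^ (2 / 3 : ℝ)
                      + d * √(T : ℝ)))}
            ≤ ENNReal.ofReal δ := by
  refine ⟨100, by norm_num, 400, by norm_num, 100000000, by norm_num, 6, ?_⟩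
  intro d T δ A θ hd hT hδ0 hδ1 hA hnorm hθ hmem
  have h : LinSetting d T δ A θ := ⟨hd, hT, hδ0, hδ1, hA, hnorm, hθ, hmem⟩
  refine ⟨h.nearStationaryGuarantee, fun t _ => ?_, ?_⟩
  · rw [h.mul_ofulRho]
    have hL := h.log_ge
    have h1 : Real.log (T / δ) * 0.69 ^ 5 ≤ Real.log (T / δ) * Real.log (T / δ) ^ 5 :=
      mul_le_mul_of_nonneg_left (pow_le_pow_left₀ (by norm_num) hL 5) (by linarith)
    have h2 : 400 * Real.log (T / δ) ≤ 100000000 * Real.log (T / δ) ^ 6 := by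
      rw [pow_succ']
      norm_num at h1 ⊢
      linarith
    have := mul_le_mul_of_nonneg_right h2 (show 0 ≤ d * √(t : ℝ) by positivity)
    linarith
  · intro Ω mΩ μ _ G coin pol rew hM
    obtain ⟨κ₁, hκ₁, hb₁⟩ := h.exists_labelling_numStationary
    obtain ⟨κ₂, hκ₂, hb₂⟩ := h.exists_labelling_paramVariation
    rw [show (d : ℝ) * paramVariation T θ ^ (1 / 3 : ℝ) * (T : ℝ) ^ (2 / 3 : ℝ) + d * √(T : ℝ) =
      d * (paramVariation T θ ^ (1 / 3 : ℝ) * (T : ℝ) ^ (2 / 3 : ℝ) + √(T : ℝ)) by ring]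
    -- Which of the two bounds is smaller does not depend on the outcome, so one labelling and one
    -- good event suffice.
    rcases min_choice (d * √((numStationary (ofulDelta 400 T δ θ) T : ℝ) * T))
      (d * (paramVariation T θ ^ (1 / 3 : ℝ) * (T : ℝ) ^ (2 / 3 : ℝ) + √(T : ℝ))) with hm | hm
    · rw [hm]
      refine h.measure_dynRegret_le hκ₁ hM ?_
      rw [hb₁]
      linarith [Real.sqrt_nonneg ((numStationary (ofulDelta 400 T δ θ) T : ℝ) * T)]
    · rw [hm]
      exact h.measure_dynRegret_le hκ₂ hM hb₂
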